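/- Let $k$ be a field and let $d,n\ge 1$ be integers. \textbf{Ordered sequences.} For $e\ge 1$ let $\mathbf{os}^{(e)}=\{\mu\in\mathbb Z^e : \mu_1\ge\mu_2\ge\dots\ge\mu_e\}$ and $\mathbf{os}^{(e)}_n=\{\mu\in\mathbf{os}^{(e)} : n-1\ge\mu_1,\ \mu_e\ge 0\}$. \textbf{Kupisch series.} A Kupisch series of type $\mathbb A_n$ is a tuple $\underline\ell=(\ell_0,\dots,\ell_{n-1})$ of positive integers with $\ell_0=1$ and $\ell_i\le\ell_{i-1}+1$ for $1\le i\le n-1$; put $\mathbf{os}^{(e)}_{\underline\ell}=\{\mu\in\mathbf{os}^{(e)}_n : \mu_1-\mu_e+1\le\ell_{\mu_1}\}$. A Kupisch series of type $\widetilde{\mathbb A}_{n-1}$ is a tuple $\underline\ell=(\ell_0,\dots,\ell_{n-1})$ of positive integers, with indices read modulo $n$, such that $\ell_i\le\ell_{i-1}+1$ for all $i\in\mathbb Z/n$; with $\tilde\ell$ its $n$-periodic extension to $\mathbb Z$, put $\mathbf{os}^{(e)}_{\tilde{\underline\ell}}=\{\mu\in\mathbf{os}^{(e)} : \mu_1-\mu_e+1\le\tilde\ell_{\mu_1}\}$.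 \textbf{Algebras.} Let $A^{(d)}$ be the incidence $k$-category of $\mathbb Z^d$ with the product order: its morphism space $x\to y$ is $k f_{yx}$ if $x\le y$ and $0$ otherwise, and $f_{zy}f_{yx}=f_{zx}$. Let $\varphi_d$ be its automorphism $\mu\mapsto\mu-(1,\dots,1)$. For $d\ge 2$ the higher Nakayama algebra $A^{(d)}_{\underline\ell}$ of type $\mathbb A_n$ is the quotient of $A^{(d)}$ by the ideal generated by the identities of all objects outside $\mathbf{os}^{(d)}_{\underline\ell}$, and $\tilde A^{(d)}_{\underline\ell}$, for $\underline\ell$ of type $\widetilde{\mathbb A}_{n-1}$, is the quotient of the orbit category $A^{(d)}/\varphi_d^n$ by the ideal generated by the identities of the orbits of all objects outside $\mathbf{os}^{(d)}_{\tilde{\underline\ell}}$. For $d=1$ they are the Nakayama algebras with Kupisch series $\underline\ell$: one takes the full subcategory of $A^{(1)}$ on $\{0,\dots,n-1\}$, respectively $A^{(1)}/\varphi_1^n$, modulo the paths $i-\ell_i\leadsto i$ with $\ell_{i-1}\ge\ell_i$ (where $1\le i\le n-1$ in type $\mathbb A_n$, and $i\in\mathbb Z$ and $\ell$ is replaced by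 $\tilde\ell$ in type $\widetilde{\mathbb A}_{n-1}$). These categories have finitely many non-zero objects and are regarded as unital $k$-algebras; modules are left modules, with $f_{yx}$ mapping the component at $y$ to the component at $x$. \textbf{Interval modules.} For $\lambda\in\mathbf{os}^{(d+1)}_{\underline\ell}$, respectively $\lambda\in\mathbf{os}^{(d+1)}_{\tilde{\underline\ell}}$, the interval module $M_\lambda$ has a $k$-basis $(b_\kappa)$ indexed by the $\kappa\in\mathbb Z^d$ with $(\lambda_2,\dots,\lambda_{d+1})\le\kappa\le(\lambda_1,\dots,\lambda_d)$; the morphism $f_{yx}$ sends $b_y$ to $b_x$ if $x\le y$ are both in this interval, and all other $b_\kappa$ to $0$. In type $\widetilde{\mathbb A}_{n-1}$ the push-down of this module is meant: the class of $f_{yx}$ in the orbit category acts as the sum of the $f_{y'x'}$ over all $(x',y')$ in the $\varphi_d^n$-orbit of $(x,y)$. \textbf{Cluster tilting.} A finite-dimensional module $M$ over a finite-dimensional algebra $\Lambda$ is $d$-cluster-tilting if $$\operatorname{add}M=\{X : \operatorname{Ext}^i_\Lambda(X,M)=0\ \text{for}\ 0<i<d\}=\{Y : \operatorname{Ext}^i_\Lambda(M,Y)=0\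 \text{for}\ 0<i<d\},$$ where $X,Y$ run over the finite-dimensional $\Lambda$-modules and $\operatorname{add}M$ consists of the direct summands of the modules $M^r$, $r\ge1$. The algebra $\Lambda$ is weakly $d$-representation-finite if it has a $d$-cluster-tilting module. \textbf{Theorem.} For every Kupisch series $\underline\ell$ of type $\mathbb A_n$ (respectively of type $\widetilde{\mathbb A}_{n-1}$) the finite-dimensional algebra $A^{(d)}_{\underline\ell}$ (respectively $\tilde A^{(d)}_{\underline\ell}$) is weakly $d$-representation-finite. More precisely, it has a $d$-cluster-tilting module whose indecomposable direct summands are, up to isomorphism, exactly the interval modules $M_\lambda$ with $\lambda\in\mathbf{os}^{(d+1)}_{\underline\ell}$ (respectively $\lambda\in\mathbf{os}^{(d+1)}_{\tilde{\underline\ell}}$), and all these $M_\lambda$ are indecomposable. -/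

import Mathlib

open CategoryTheory

noncomputable section

namespace HigherNakayama

universe u

/-! ### Weakly `d`-representation-finite algebras -/

section ClusterTilting

variable {Λ : Type u} [Ring Λ]

/-- `X` is a direct summand of `M`. -/
def IsSummand (X M : ModuleCat.{u} Λ) : Prop := Nonempty (Retract X M)

/-- `X ∈ add M`: `X` is a direct summand of `M ^ r` for some positive integer `r`. -/
def InAdd (M X : ModuleCat.{u} Λ) : Prop :=
  ∃ r : ℕ, 0 < r ∧ IsSummand X (ModuleCat.of Λ (Fin r → M))

/-- `M` is a `d`-cluster-tilting module over the finite-dimensional algebra `Λ`. Over such an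
algebra the finite-dimensional modules are the finitely generated ones, and the extension groups
of two of them may be computed in the category of all modules. -/
def IsClusterTilting (d : ℕ) (M : ModuleCat.{u} Λ) : Prop :=
  Module.Finite Λ M ∧
  (∀ X : ModuleCat.{u} Λ, Module.Finite Λ X →
    (InAdd M X ↔ ∀ i : ℕ, 1 ≤ i → i < d → Subsingleton (Abelian.Ext X M i))) ∧
  (∀ Y : ModuleCat.{u} Λ, Module.Finite Λ Y →
    (InAdd M Y ↔ ∀ i : ℕ, 1 ≤ i → i < d → Subsingleton (Abelian.Ext M Y i)))

/-- The algebra `Λ` is weakly `d`-representation-finite: it is a finite-dimensional `k`-algebra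
having a `d`-cluster-tilting module. -/
def IsWeaklyRepFinite (k Λ : Type u) [Field k] [Ring Λ] [Algebra k Λ] (d : ℕ) : Prop :=
  Module.Finite k Λ ∧ ∃ M : ModuleCat.{u} Λ, IsClusterTilting d M

end ClusterTilting

/-! ### The category `A^{(d)}`, its orbit categories, and their quotients -/

/-- The poset `ℤ^d` with the product order. -/
abbrev Vtx (d : ℕ) : Type := Fin d → ℤ

/-- Translation by `m * p * (1, …, 1)`, that is, the action of `φ_d ^ (- m * p)` on vertices. -/
def shift {d : ℕ} (p : ℕ) (m : ℤ) (x : Vtx d) : Vtx d := fun i => x i + m * p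

section Shift

variable {d : ℕ} (p : ℕ)

lemma shift_zero (x : Vtx d) : shift p 0 x = x := by
  funext i; simp [shift]

lemma shift_shift (a b : ℤ) (x : Vtx d) : shift p a (shift p b x) = shift p (a + b) x := by
  funext i; simp only [shift]; ring

lemma shift_le_shift (m : ℤ) {x y : Vtx d} : shift p m x ≤ shift p m y ↔ x ≤ y := by
  simp [shift, Pi.le_def]

lemma shift_inj (m : ℤ) {x y : Vtx d} : shift p m x = shift p m y ↔ x = y := by
  simp [shift, funext_iff]

end Shift

variable (k : Type u) [Field k]

/-- The algebra (without unit, but with enough idempotents) of the orbit category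
`A^{(d)} / φ_d ^ p`, i.e. the direct sum of all its spaces of morphisms. A morphism between two
orbits is a `φ_d ^ p`-invariant family of morphisms of `A^{(d)}`, and a finite sum of such
morphisms is a `φ_d ^ p`-invariant function on the pairs `x ≤ y` of elements of `ℤ^d` whose
support is a finite union of orbits of pairs. The basis vector `f_{yx}` is the function supported
at `(x, y)`, so left modules are contravariant representations.
For `p = 0` this is the algebra of the incidence category `A^{(d)}` itself. -/
def orbitAlg (d p : ℕ) : NonUnitalSubalgebra k (IncidenceAlgebra k (Vtx d)) where
  carrier := {a | (∀ m x y, a (shift p m x) (shift p m y) = a x y) ∧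
    ∃ F : Finset (Vtx d), ∀ x y, a x y ≠ 0 → ∃ m, shift p m x ∈ F ∧ shift p m y ∈ F}
  zero_mem' := ⟨fun _ _ _ => rfl, ∅, fun _ _ h => (h rfl).elim⟩
  add_mem' := by
    classical
    rintro a b ⟨ha, F, hF⟩ ⟨hb, G, hG⟩
    refine ⟨fun m x y => by simp [IncidenceAlgebra.add_apply, ha, hb], F ∪ G, fun x y h => ?_⟩
    by_cases h' : a x y = 0
    · obtain ⟨m, h1, h2⟩ := hG x y (by
        intro h0; exact h (by simp [IncidenceAlgebra.add_apply, h', h0]))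
      exact ⟨m, Finset.mem_union_right _ h1, Finset.mem_union_right _ h2⟩
    · obtain ⟨m, h1, h2⟩ := hF x y h'
      exact ⟨m, Finset.mem_union_left _ h1, Finset.mem_union_left _ h2⟩
  smul_mem' := by
    rintro c a ⟨ha, F, hF⟩
    refine ⟨fun m x y => by simp [IncidenceAlgebra.constSMul_apply, ha], F, fun x y h => ?_⟩
    exact hF x y (fun h0 => h (by simp [IncidenceAlgebra.constSMul_apply, h0]))
  mul_mem' := by
    classical
    rintro a b ⟨ha, F, hF⟩ ⟨hb, G, hG⟩
    constructor
    · intro m x y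
      rw [IncidenceAlgebra.mul_apply, IncidenceAlgebra.mul_apply]
      refine Finset.sum_nbij' (shift p (-m)) (shift p m) ?_ ?_ ?_ ?_ ?_
      · intro z hz
        rw [Finset.mem_Icc] at hz ⊢
        rw [← shift_le_shift p m, ← shift_le_shift p m (x := shift p (-m) z)]
        simpa [shift_shift, shift_zero] using hz
      · intro z hz
        rw [Finset.mem_Icc] at hz ⊢
        simpa [shift_le_shift] using hz
      · intro z _; simp [shift_shift, shift_zero]
      · intro z _; simp [shift_shift, shift_zero]
      · intro z _
        rw [← ha m x, ← hb m _ y]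
        simp [shift_shift, shift_zero]
    · refine ⟨F ∪ ((G ×ˢ F) ×ˢ G).image (fun t => t.1.1 + (t.1.2 - t.2)), fun x y h => ?_⟩
      rw [IncidenceAlgebra.mul_apply] at h
      obtain ⟨z, -, hz⟩ := Finset.exists_ne_zero_of_sum_ne_zero h
      obtain ⟨m, h1, h2⟩ := hF x z (left_ne_zero_of_mul hz)
      obtain ⟨m', h3, h4⟩ := hG z y (right_ne_zero_of_mul hz)
      refine ⟨m, Finset.mem_union_left _ h1, Finset.mem_union_right _ ?_⟩
      refine Finset.mem_image.2 ⟨((shift p m' y, shift p m z), shift p m' z), ?_, ?_⟩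
      · simp [h2, h3, h4]
      · funext i; simp [shift]

open Classical in
/-- The image in `A^{(d)} / φ_d ^ p` of the basis vector `f_{vu} : u ⟶ v`, `u ≤ v`, of `A^{(d)}`
(and `0` if `u ≤ v` fails). -/
def arrow {d : ℕ} (p : ℕ) (u v : Vtx d) : orbitAlg k d p :=
  ⟨⟨fun x y => if u ≤ v ∧ ∃ m, x = shift p m u ∧ y = shift p m v then 1 else 0, by
      intro x y h
      refine if_neg ?_
      rintro ⟨huv, m, rfl, rfl⟩
      exact h ((shift_le_shift p m).2 huv)⟩, by
    constructor
    · intro m x y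
      have key : (∃ m', shift p m x = shift p m' u ∧ shift p m y = shift p m' v) ↔
          ∃ m', x = shift p m' u ∧ y = shift p m' v := by
        constructor
        · rintro ⟨m', h1, h2⟩
          refine ⟨m' - m, ?_, ?_⟩
          · rw [← shift_inj p m, h1, shift_shift]; congr 1; ring
          · rw [← shift_inj p m, h2, shift_shift]; congr 1; ring
        · rintro ⟨m', rfl, rfl⟩
          exact ⟨m + m', shift_shift _ _ _ _, shift_shift _ _ _ _⟩
      simp only [IncidenceAlgebra.coe_mk, key]
    · refine ⟨{u, v}, fun x y h => ?_⟩
      simp only [IncidenceAlgebra.coe_mk, ne_eq, ite_eq_right_iff, not_forall] at h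
      obtain ⟨⟨-, m, rfl, rfl⟩, -⟩ := h
      exact ⟨-m, by simp [shift_shift, shift_zero], by simp [shift_shift, shift_zero]⟩⟩

/-- A set of vertices and a set of morphisms `f_{vu}`, both stable under `φ_d ^ p`; the vertices
fall into finitely many orbits. -/
structure QuotientData (d p : ℕ) where
  /-- the vertices that are kept -/
  verts : Set (Vtx d)
  /-- pairs `(u, v)` such that `f_{vu}` is killed -/
  rels : Set (Vtx d × Vtx d)
  verts_shift : ∀ m x, x ∈ verts → shift p m x ∈ verts
  rels_shift : ∀ m u v, (u, v) ∈ rels → (shift p m u, shift p m v) ∈ rels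
  verts_finite : ∃ F : Finset (Vtx d), ∀ x ∈ verts, ∃ m, shift p m x ∈ F

variable {d p : ℕ} (D : QuotientData d p)

/-- The two-sided ideal of `A^{(d)} / φ_d ^ p` generated by the idempotents of the vertices
that are not kept and by the morphisms that are killed. -/
def relIdeal : TwoSidedIdeal (orbitAlg k d p) :=
  TwoSidedIdeal.span
    ({a | ∃ z, z ∉ D.verts ∧ a = arrow k p z z} ∪ {a | ∃ u v, (u, v) ∈ D.rels ∧ a = arrow k p u v})

/-- The quotient of `A^{(d)} / φ_d ^ p` by the ideal `relIdeal`. -/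
def QuotAlg : Type u := (relIdeal k D).ringCon.Quotient

open Classical in
/-- The sum of the idempotents of the vertices in `T`. -/
def idem (T : Set (Vtx d)) (hT : ∀ m x, x ∈ T → shift p m x ∈ T)
    (hF : ∃ F : Finset (Vtx d), ∀ x ∈ T, ∃ m, shift p m x ∈ F) : orbitAlg k d p :=
  ⟨⟨fun x y => if x = y ∧ x ∈ T then 1 else 0, fun x y h => if_neg fun h' => h h'.1.le⟩, by
    constructor
    · intro m x y
      have : shift p m x ∈ T ↔ x ∈ T :=
        ⟨fun h => by simpa [shift_shift, shift_zero] using hT (-m) _ h, hT m x⟩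
      simp only [IncidenceAlgebra.coe_mk, shift_inj, this]
    · obtain ⟨F, hF⟩ := hF
      refine ⟨F, fun x y h => ?_⟩
      simp only [IncidenceAlgebra.coe_mk, ne_eq, ite_eq_right_iff, not_forall] at h
      obtain ⟨⟨rfl, hx⟩, -⟩ := h
      obtain ⟨m, hm⟩ := hF x hx
      exact ⟨m, hm, hm⟩⟩

/-- The sum of the idempotents of the vertices that are kept. -/
def unitElt : orbitAlg k d p := idem k D.verts D.verts_shift D.verts_finite

section Unit

lemma orbit_ext {a b : orbitAlg k d p} (h : ∀ x y, a.1 x y = b.1 x y) : a = b :=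
  Subtype.ext (IncidenceAlgebra.ext fun x y _ => h x y)

open Classical in
lemma idem_apply (T : Set (Vtx d)) (hT hF) (x y : Vtx d) :
    (idem (p := p) k T hT hF).1 x y = if x = y ∧ x ∈ T then 1 else 0 := rfl

open Classical in
lemma arrow_apply (u v x y : Vtx d) :
    (arrow k p u v).1 x y =
      if u ≤ v ∧ ∃ m, x = shift p m u ∧ y = shift p m v then 1 else 0 := rfl

open Classical in
lemma idem_mul_apply (T : Set (Vtx d)) (hT hF) (a : orbitAlg k d p) (x y : Vtx d) :
    (idem k T hT hF * a).1 x y = if x ∈ T then a.1 x y else 0 := by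
  change ((idem k T hT hF).1 * a.1) x y = _
  rw [IncidenceAlgebra.mul_apply]
  by_cases h : x ≤ y
  · rw [Finset.sum_eq_single x]
    · simp [idem_apply]
    · intro z _ hz; simp [idem_apply, hz.symm]
    · intro hx; exact (hx (by simp [h])).elim
  · rw [IncidenceAlgebra.apply_eq_zero_of_not_le h, Finset.Icc_eq_empty h]; simp

open Classical in
lemma mul_idem_apply (T : Set (Vtx d)) (hT hF) (a : orbitAlg k d p) (x y : Vtx d) :
    (a * idem k T hT hF).1 x y = if y ∈ T then a.1 x y else 0 := by
  change (a.1 * (idem k T hT hF).1) x y = _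
  rw [IncidenceAlgebra.mul_apply]
  by_cases h : x ≤ y
  · rw [Finset.sum_eq_single y]
    · simp [idem_apply]
    · intro z _ hz; simp [idem_apply, hz]
    · intro hx; exact (hx (by simp [h])).elim
  · rw [IncidenceAlgebra.apply_eq_zero_of_not_le h, Finset.Icc_eq_empty h]; simp

lemma orbit_smul_mul (c : k) (a b : orbitAlg k d p) : (c • a) * b = c • (a * b) := by
  refine orbit_ext k fun x y => ?_
  change ((c • a.1) * b.1) x y = (c • (a.1 * b.1)) x y
  simp only [IncidenceAlgebra.constSMul_apply, IncidenceAlgebra.mul_apply, smul_eq_mul,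
    Finset.mul_sum, mul_assoc]

lemma orbit_mul_smul (c : k) (a b : orbitAlg k d p) : a * (c • b) = c • (a * b) := by
  refine orbit_ext k fun x y => ?_
  change (a.1 * (c • b.1)) x y = (c • (a.1 * b.1)) x y
  simp only [IncidenceAlgebra.constSMul_apply, IncidenceAlgebra.mul_apply, smul_eq_mul,
    Finset.mul_sum, mul_left_comm]

/-- The vertices that are not kept and whose orbit meets `F`. -/
def offVerts (F : Finset (Vtx d)) : Set (Vtx d) := {x | x ∉ D.verts ∧ ∃ m, shift p m x ∈ F}

lemma offVerts_shift (F : Finset (Vtx d)) (m : ℤ) (x : Vtx d) (hx : x ∈ offVerts D F) :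
    shift p m x ∈ offVerts D F := by
  obtain ⟨h, m', hm'⟩ := hx
  refine ⟨fun h' => h ?_, m' - m, ?_⟩
  · simpa [shift_shift, shift_zero] using D.verts_shift (-m) _ h'
  · rw [shift_shift]; simpa using hm'

lemma offVerts_finite (F : Finset (Vtx d)) :
    ∃ G : Finset (Vtx d), ∀ x ∈ offVerts D F, ∃ m, shift p m x ∈ G := ⟨F, fun _ h => h.2⟩

lemma idem_off_mem (F : Finset (Vtx d)) :
    idem k (offVerts D F) (offVerts_shift D F) (offVerts_finite D F) ∈ relIdeal k D := by
  classical
  induction F using Finset.induction_on with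
  | empty =>
    convert (relIdeal k D).zero_mem
    refine orbit_ext k fun x y => ?_
    rw [idem_apply, if_neg]
    · rfl
    · rintro ⟨-, -, m, hm⟩; simp at hm
  | insert z F hz ih =>
    by_cases h : z ∈ D.verts ∨ z ∈ offVerts D F
    · convert ih using 1
      refine orbit_ext k fun x y => ?_
      rw [idem_apply, idem_apply]
      have : x ∈ offVerts D (insert z F) ↔ x ∈ offVerts D F := by
        constructor
        · rintro ⟨hx, m, hm⟩
          rcases Finset.mem_insert.1 hm with hm | hm
          · rcases h with h | h
            · rw [← hm] at h
              exact (hx (by simpa [shift_shift, shift_zero] using D.verts_shift (-m) _ h)).elim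
            · rw [← hm] at h
              simpa [shift_shift, shift_zero] using offVerts_shift D F (-m) _ h
          · exact ⟨hx, m, hm⟩
        · rintro ⟨hx, m, hm⟩
          exact ⟨hx, m, Finset.mem_insert_of_mem hm⟩
      simp only [this]
    · push Not at h
      have harrow : arrow k p z z ∈ relIdeal k D :=
        TwoSidedIdeal.subset_span (Or.inl ⟨z, h.1, rfl⟩)
      convert (relIdeal k D).add_mem ih harrow using 1
      refine orbit_ext k fun x y => ?_
      change _ = (idem k (offVerts D F) _ _).1 x y + (arrow k p z z).1 x y
      rw [idem_apply, idem_apply, arrow_apply]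
      by_cases hxy : x = y
      · subst hxy
        by_cases h1 : ∃ m, x = shift p m z
        · obtain ⟨m, rfl⟩ := h1
          have e1 : shift p m z ∈ offVerts D (insert z F) := by
            refine offVerts_shift D _ m z ⟨h.1, 0, ?_⟩
            simp [shift_zero]
          have e2 : shift p m z ∉ offVerts D F := fun h' => h.2 (by
            simpa [shift_shift, shift_zero] using offVerts_shift D F (-m) _ h')
          rw [if_pos ⟨rfl, e1⟩, if_neg (fun h' => e2 h'.2), if_pos ⟨le_rfl, m, rfl, rfl⟩, zero_add]
        · have e : x ∈ offVerts D (insert z F) ↔ x ∈ offVerts D F := by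
            constructor
            · rintro ⟨hx, m, hm⟩
              rcases Finset.mem_insert.1 hm with hm | hm
              · exact (h1 ⟨-m, by rw [← hm]; simp [shift_shift, shift_zero]⟩).elim
              · exact ⟨hx, m, hm⟩
            · rintro ⟨hx, m, hm⟩
              exact ⟨hx, m, Finset.mem_insert_of_mem hm⟩
          have e' : ¬ (z ≤ z ∧ ∃ m, x = shift p m z ∧ x = shift p m z) :=
            fun h' => h1 ⟨h'.2.choose, h'.2.choose_spec.1⟩
          rw [if_neg e', add_zero]
          simp only [e]
      · rw [if_neg (fun h' => hxy h'.1), if_neg (fun h' => hxy h'.1), if_neg, add_zero]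
        rintro ⟨-, m, rfl, rfl⟩
        exact hxy rfl

lemma unit_mul_sub_mem (a : orbitAlg k d p) : unitElt k D * a - a ∈ relIdeal k D := by
  classical
  obtain ⟨F, hF⟩ := a.2.2
  have h := (relIdeal k D).neg_mem ((relIdeal k D).mul_mem_right _ a (idem_off_mem k D F))
  convert h using 1
  refine orbit_ext k fun x y => ?_
  change (unitElt k D * a).1 x y - a.1 x y = -((idem k _ _ _ * a).1 x y)
  rw [unitElt, idem_mul_apply, idem_mul_apply]
  by_cases hx : x ∈ D.verts
  · have : x ∉ offVerts D F := fun h' => h'.1 hx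
    simp [hx, this]
  · by_cases ha : a.1 x y = 0
    · simp [ha]
    · obtain ⟨m, h1, -⟩ := hF x y ha
      have : x ∈ offVerts D F := ⟨hx, m, h1⟩
      simp [hx, this]

lemma mul_unit_sub_mem (a : orbitAlg k d p) : a * unitElt k D - a ∈ relIdeal k D := by
  classical
  obtain ⟨F, hF⟩ := a.2.2
  have h := (relIdeal k D).neg_mem ((relIdeal k D).mul_mem_left a _ (idem_off_mem k D F))
  convert h using 1
  refine orbit_ext k fun x y => ?_
  change (a * unitElt k D).1 x y - a.1 x y = -((a * idem k _ _ _).1 x y)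
  rw [unitElt, mul_idem_apply, mul_idem_apply]
  by_cases hx : y ∈ D.verts
  · have : y ∉ offVerts D F := fun h' => h'.1 hx
    simp [hx, this]
  · by_cases ha : a.1 x y = 0
    · simp [ha]
    · obtain ⟨m, -, h1⟩ := hF x y ha
      have : y ∈ offVerts D F := ⟨hx, m, h1⟩
      simp [hx, this]

end Unit

/-- The class of an element in the quotient. -/
def QuotAlg.mk (a : orbitAlg k d p) : QuotAlg k D := (a : (relIdeal k D).ringCon.Quotient)

instance : AddCommGroup (QuotAlg k D) :=
  inferInstanceAs (AddCommGroup (relIdeal k D).ringCon.Quotient)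

instance : Mul (QuotAlg k D) :=
  inferInstanceAs (Mul (relIdeal k D).ringCon.Quotient)

lemma QuotAlg.mk_surjective : Function.Surjective (QuotAlg.mk k D) := Quotient.mk''_surjective

lemma QuotAlg.mk_eq {a b : orbitAlg k d p} :
    QuotAlg.mk k D a = QuotAlg.mk k D b ↔ a - b ∈ relIdeal k D := by
  rw [← TwoSidedIdeal.rel_iff]
  exact RingCon.eq _

lemma QuotAlg.mk_mul (a b : orbitAlg k d p) :
    QuotAlg.mk k D (a * b) = QuotAlg.mk k D a * QuotAlg.mk k D b := rfl

lemma QuotAlg.mk_add (a b : orbitAlg k d p) :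
    QuotAlg.mk k D (a + b) = QuotAlg.mk k D a + QuotAlg.mk k D b := rfl

/-- The quotient is unital, since only finitely many orbits of vertices are kept. -/
instance : Ring (QuotAlg k D) where
  one := QuotAlg.mk k D (unitElt k D)
  one_mul x := by
    obtain ⟨a, rfl⟩ := QuotAlg.mk_surjective k D x
    exact (QuotAlg.mk_eq k D).2 (unit_mul_sub_mem k D a)
  mul_one x := by
    obtain ⟨a, rfl⟩ := QuotAlg.mk_surjective k D x
    exact (QuotAlg.mk_eq k D).2 (mul_unit_sub_mem k D a)
  mul_assoc x y z := by
    obtain ⟨a, rfl⟩ := QuotAlg.mk_surjective k D x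
    obtain ⟨b, rfl⟩ := QuotAlg.mk_surjective k D y
    obtain ⟨c, rfl⟩ := QuotAlg.mk_surjective k D z
    simp only [← QuotAlg.mk_mul, mul_assoc]
  left_distrib x y z := by
    obtain ⟨a, rfl⟩ := QuotAlg.mk_surjective k D x
    obtain ⟨b, rfl⟩ := QuotAlg.mk_surjective k D y
    obtain ⟨c, rfl⟩ := QuotAlg.mk_surjective k D z
    simp only [← QuotAlg.mk_mul, ← QuotAlg.mk_add, mul_add]
  right_distrib x y z := by
    obtain ⟨a, rfl⟩ := QuotAlg.mk_surjective k D x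
    obtain ⟨b, rfl⟩ := QuotAlg.mk_surjective k D y
    obtain ⟨c, rfl⟩ := QuotAlg.mk_surjective k D z
    simp only [← QuotAlg.mk_mul, ← QuotAlg.mk_add, add_mul]
  zero_mul x := by
    obtain ⟨a, rfl⟩ := QuotAlg.mk_surjective k D x
    change QuotAlg.mk k D 0 * QuotAlg.mk k D a = QuotAlg.mk k D 0
    rw [← QuotAlg.mk_mul, zero_mul]
  mul_zero x := by
    obtain ⟨a, rfl⟩ := QuotAlg.mk_surjective k D x
    change QuotAlg.mk k D a * QuotAlg.mk k D 0 = QuotAlg.mk k D 0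
    rw [← QuotAlg.mk_mul, mul_zero]
  zsmul := (inferInstance : AddCommGroup (QuotAlg k D)).zsmul
  zsmul_zero' := (inferInstance : AddCommGroup (QuotAlg k D)).zsmul_zero'
  zsmul_succ' := (inferInstance : AddCommGroup (QuotAlg k D)).zsmul_succ'
  zsmul_neg' := (inferInstance : AddCommGroup (QuotAlg k D)).zsmul_neg'
  neg_add_cancel := neg_add_cancel
  sub_eq_add_neg := sub_eq_add_neg

lemma QuotAlg.one_def : (1 : QuotAlg k D) = QuotAlg.mk k D (unitElt k D) := rfl

/-- The `k`-algebra structure of the quotient: `c` acts as the class of `c` times the unit. -/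
instance : Algebra k (QuotAlg k D) :=
  RingHom.toAlgebra'
    { toFun := fun c => QuotAlg.mk k D (c • unitElt k D)
      map_one' := by rw [one_smul]; rfl
      map_mul' := fun a b => by
        have h : QuotAlg.mk k D (a • unitElt k D) * QuotAlg.mk k D (b • unitElt k D) =
            QuotAlg.mk k D (unitElt k D * ((a * b) • unitElt k D)) := by
          rw [← QuotAlg.mk_mul, orbit_smul_mul, orbit_mul_smul, orbit_mul_smul, smul_smul]
        rw [h, QuotAlg.mk_mul, ← QuotAlg.one_def, one_mul]
      map_zero' := by rw [zero_smul]; rfl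
      map_add' := fun a b => by rw [add_smul]; rfl }
    (fun c x => by
      obtain ⟨a, rfl⟩ := QuotAlg.mk_surjective k D x
      change QuotAlg.mk k D (c • unitElt k D) * QuotAlg.mk k D a =
        QuotAlg.mk k D a * QuotAlg.mk k D (c • unitElt k D)
      have h1 : QuotAlg.mk k D (c • unitElt k D) * QuotAlg.mk k D a =
          QuotAlg.mk k D (unitElt k D * (c • a)) := by
        rw [← QuotAlg.mk_mul, orbit_smul_mul, orbit_mul_smul]
      have h2 : QuotAlg.mk k D a * QuotAlg.mk k D (c • unitElt k D) =
          QuotAlg.mk k D ((c • a) * unitElt k D) := by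
        rw [← QuotAlg.mk_mul, orbit_smul_mul, orbit_mul_smul]
      rw [h1, h2, QuotAlg.mk_mul, QuotAlg.mk_mul, ← QuotAlg.one_def, one_mul, mul_one])

/-! ### Interval modules -/

/-- The interval `[lo, hi]` of `ℤ^d` consists of vertices that are kept and contains no relation. -/
def IsAdmissible (lo hi : Vtx d) : Prop :=
  (∀ z, lo ≤ z → z ≤ hi → z ∈ D.verts) ∧
    ∀ u v, (u, v) ∈ D.rels → lo ≤ u → u ≤ v → v ≤ hi → False

variable {D} {lo hi : Vtx d}

/-- The entries of an element of `A^{(d)} / φ_d ^ p` at the pairs of vertices in `[lo, hi]`. -/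
def restrictMat (lo hi : Vtx d) (a : orbitAlg k d p) :
    Matrix (Finset.Icc lo hi) (Finset.Icc lo hi) k :=
  Matrix.of fun x y => a.1 x.1 y.1

lemma restrictMat_add (a b : orbitAlg k d p) :
    restrictMat k lo hi (a + b) = restrictMat k lo hi a + restrictMat k lo hi b := rfl

lemma restrictMat_mul (a b : orbitAlg k d p) :
    restrictMat k lo hi (a * b) = restrictMat k lo hi a * restrictMat k lo hi b := by
  ext x y
  rw [Matrix.mul_apply]
  change (a.1 * b.1) x.1 y.1 = ∑ z : Finset.Icc lo hi, a.1 x.1 z.1 * b.1 z.1 y.1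
  rw [IncidenceAlgebra.mul_apply, Finset.sum_coe_sort (Finset.Icc lo hi)
    (fun z => a.1 x.1 z * b.1 z y.1)]
  have hx := Finset.mem_Icc.1 x.2
  have hy := Finset.mem_Icc.1 y.2
  refine Finset.sum_subset (Finset.Icc_subset_Icc hx.1 hy.2) fun z _ hz => ?_
  by_cases h : x.1 ≤ z
  · rw [IncidenceAlgebra.apply_eq_zero_of_not_le (fun h' => hz (Finset.mem_Icc.2 ⟨h, h'⟩)) b.1,
      mul_zero]
  · rw [IncidenceAlgebra.apply_eq_zero_of_not_le h, zero_mul]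

lemma restrictMat_eq_zero (h : IsAdmissible D lo hi) {a : orbitAlg k d p}
    (ha : a ∈ relIdeal k D) : restrictMat k lo hi a = 0 := by
  classical
  let J : TwoSidedIdeal (orbitAlg k d p) := TwoSidedIdeal.mk' {a | restrictMat k lo hi a = 0}
    rfl
    (fun {a b} ha hb => by
      have ha : restrictMat k lo hi a = 0 := ha
      have hb : restrictMat k lo hi b = 0 := hb
      change restrictMat k lo hi (a + b) = 0
      rw [restrictMat_add, ha, hb, add_zero])
    (fun {a} ha => by
      have ha : restrictMat k lo hi a = 0 := ha
      change -restrictMat k lo hi a = 0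
      rw [ha, neg_zero])
    (fun {a b} hb => by
      have hb : restrictMat k lo hi b = 0 := hb
      change restrictMat k lo hi (a * b) = 0
      rw [restrictMat_mul, hb, mul_zero])
    (fun {a b} ha => by
      have ha : restrictMat k lo hi a = 0 := ha
      change restrictMat k lo hi (a * b) = 0
      rw [restrictMat_mul, ha, zero_mul])
  have hle : relIdeal k D ≤ J := by
    refine TwoSidedIdeal.span_le.2 ?_
    rintro a (⟨z, hz, rfl⟩ | ⟨u, v, huv, rfl⟩)
    · refine (TwoSidedIdeal.mem_mk' _ _ _ _ _ _ _).2 ?_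
      ext x y
      change (arrow k p z z).1 x.1 y.1 = 0
      rw [arrow_apply, if_neg]
      rintro ⟨-, m, hx, -⟩
      have hxI := Finset.mem_Icc.1 x.2
      have := D.verts_shift (-m) _ (h.1 _ hxI.1 hxI.2)
      rw [hx, shift_shift] at this
      exact hz (by simpa [shift_zero] using this)
    · refine (TwoSidedIdeal.mem_mk' _ _ _ _ _ _ _).2 ?_
      ext x y
      change (arrow k p u v).1 x.1 y.1 = 0
      rw [arrow_apply, if_neg]
      rintro ⟨hle, m, hx, hy⟩
      refine h.2 _ _ (D.rels_shift m u v huv) ?_ ((shift_le_shift p m).2 hle) ?_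
      · rw [← hx]; exact (Finset.mem_Icc.1 x.2).1
      · rw [← hy]; exact (Finset.mem_Icc.1 y.2).2
  have haJ : a ∈ J := hle ha
  have := (TwoSidedIdeal.mem_mk' {a | restrictMat k lo hi a = 0} _ _ _ _ _ a).1 haJ
  exact this

lemma restrictMat_unitElt (h : IsAdmissible D lo hi) : restrictMat k lo hi (unitElt k D) = 1 := by
  classical
  ext x y
  change (idem (p := p) k D.verts D.verts_shift D.verts_finite).1 x.1 y.1 = _
  have hx := h.1 x.1 (Finset.mem_Icc.1 x.2).1 (Finset.mem_Icc.1 x.2).2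
  rw [idem_apply, Matrix.one_apply]
  by_cases hxy : x = y
  · rw [if_pos hxy, if_pos ⟨congrArg _ hxy, hx⟩]
  · rw [if_neg hxy, if_neg fun h' => hxy (Subtype.ext h'.1)]

/-- The matrix representation of the quotient algebra on an admissible interval. -/
def intervalRep (h : IsAdmissible D lo hi) :
    QuotAlg k D →+* Matrix (Finset.Icc lo hi) (Finset.Icc lo hi) k where
  toFun := fun x => Quotient.liftOn' x (restrictMat k lo hi) (fun a b hab => by
    have := restrictMat_eq_zero k h (((relIdeal k D).rel_iff a b).1 hab)
    have e : restrictMat k lo hi a - restrictMat k lo hi b = 0 := this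
    exact sub_eq_zero.1 e)
  map_one' := restrictMat_unitElt k h
  map_zero' := rfl
  map_mul' x y := by
    obtain ⟨a, rfl⟩ := QuotAlg.mk_surjective k D x
    obtain ⟨b, rfl⟩ := QuotAlg.mk_surjective k D y
    exact restrictMat_mul k a b
  map_add' x y := by
    obtain ⟨a, rfl⟩ := QuotAlg.mk_surjective k D x
    obtain ⟨b, rfl⟩ := QuotAlg.mk_surjective k D y
    rfl

/-- The interval module on `[lo, hi]` (if `p > 0`, its image under the push-down functor): it has
a basis indexed by the vertices in `[lo, hi]`, and for `x ≤ y` in `[lo, hi]` the morphism `f_{yx}`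
sends the basis vector at `y` to the one at `x`, all other basis elements acting by zero. -/
def IntervalModule (_h : IsAdmissible D lo hi) : Type u := Finset.Icc lo hi → k

instance (h : IsAdmissible D lo hi) : AddCommGroup (IntervalModule k h) :=
  inferInstanceAs (AddCommGroup (Finset.Icc lo hi → k))

instance (h : IsAdmissible D lo hi) : Module (QuotAlg k D) (IntervalModule k h) :=
  Module.compHom (Finset.Icc lo hi → k)
    ((Matrix.toLinAlgEquiv' : Matrix (Finset.Icc lo hi) (Finset.Icc lo hi) k ≃ₐ[k]
      Module.End k (Finset.Icc lo hi → k)).toRingEquiv.toRingHom.comp (intervalRep k h))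

/-- The class of `a` acts on the interval module by the matrix of entries of `a`. -/
lemma intervalModule_smul (h : IsAdmissible D lo hi) (a : orbitAlg k d p)
    (v : IntervalModule k h) :
    QuotAlg.mk k D a • v = (restrictMat k lo hi a).mulVec v := rfl

/-! ### Kupisch series and ordered sequences -/

/-- The last index of a non-empty sequence. -/
abbrev lastIdx (e : ℕ) [NeZero e] : Fin e := Fin.rev 0

/-- The set `os^{(e)}` of non-increasing sequences `μ_1 ≥ ⋯ ≥ μ_e` of integers. -/
def os (e : ℕ) : Set (Vtx e) := {μ | Antitone μ}

/-- The set `os^{(e)}_n`: sequences in `os^{(e)}` with `n - 1 ≥ μ_1` and `μ_e ≥ 0`. -/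
def osN (e n : ℕ) [NeZero e] : Set (Vtx e) :=
  {μ | μ ∈ os e ∧ μ 0 ≤ (n : ℤ) - 1 ∧ 0 ≤ μ (lastIdx e)}

/-- A Kupisch series `(ℓ_0, …, ℓ_{n-1})` of type `𝔸_n`: positive integers with `ℓ_0 = 1` and
`ℓ_i ≤ ℓ_{i-1} + 1`. Entries `ℓ_i = 1` with `i > 0`, for which the algebra is not connected, are
allowed. -/
structure KupischA (n : ℕ) [NeZero n] where
  len : Fin n → ℕ
  pos : ∀ i, 1 ≤ len i
  first : len 0 = 1
  step : ∀ i j : Fin n, (j : ℕ) = i + 1 → len j ≤ len i + 1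

/-- A Kupisch series `(ℓ_0, …, ℓ_{n-1})` of type `𝔸̃_{n-1}`: positive integers, indexed modulo
`n`, with `ℓ_i ≤ ℓ_{i-1} + 1` for all `i`. -/
structure KupischTilde (n : ℕ) [NeZero n] where
  len : ZMod n → ℕ
  pos : ∀ i, 1 ≤ len i
  step : ∀ i, len i ≤ len (i - 1) + 1

/-- The set `os^{(e)}_ℓ` for `ℓ` of type `𝔸_n`. -/
def KupischA.os {n : ℕ} [NeZero n] (ℓ : KupischA n) (e : ℕ) [NeZero e] : Set (Vtx e) :=
  {μ | μ ∈ osN e n ∧ ∃ i : Fin n, μ 0 = (i : ℕ) ∧ μ 0 - μ (lastIdx e) + 1 ≤ ℓ.len i}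

/-- The set `os^{(e)}_{ℓ̃}` for `ℓ` of type `𝔸̃_{n-1}`, with `ℓ̃` the periodic extension of `ℓ`. -/
def KupischTilde.os {n : ℕ} [NeZero n] (ℓ : KupischTilde n) (e : ℕ) [NeZero e] : Set (Vtx e) :=
  {μ | μ ∈ HigherNakayama.os e ∧ μ 0 - μ (lastIdx e) + 1 ≤ ℓ.len (μ 0 : ZMod n)}

/-- The lower end `(λ_2, …, λ_{d+1})` of the interval given by `λ`. -/
def lower (lam : Vtx (d + 1)) : Vtx d := fun i => lam i.succ

/-- The upper end `(λ_1, …, λ_d)` of the interval given by `λ`. -/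
def upper (lam : Vtx (d + 1)) : Vtx d := fun i => lam i.castSucc

/-- All elements of `ℤ^d` in the interval `[lower λ, upper λ]` lie in `os^{(d)}`. -/
lemma mem_os_of_mem_interval {lam : Vtx (d + 1)} {z : Vtx d} (h1 : lower lam ≤ z)
    (h2 : z ≤ upper lam) (hlam : lam ∈ os (d + 1)) : z ∈ os d := by
  intro i j hij
  rcases hij.eq_or_lt with rfl | hlt
  · exact le_rfl
  · have a := h2 j
    have b := h1 i
    have c : lam j.castSucc ≤ lam i.succ := hlam (by
      rw [Fin.le_def]; simpa using hlt)
    exact a.trans (c.trans b)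

lemma le_zero_of_os {e : ℕ} [NeZero e] {μ : Vtx e} (h : μ ∈ os e) (i : Fin e) : μ i ≤ μ 0 :=
  h (Fin.zero_le i)

lemma last_le_of_os {e : ℕ} [NeZero e] {μ : Vtx e} (h : μ ∈ os e) (i : Fin e) :
    μ (lastIdx e) ≤ μ i :=
  h (by rw [Fin.le_def, Fin.val_rev]; simp; omega)

variable {n : ℕ} [NeZero n] [NeZero d]

lemma lower_last (lam : Vtx (d + 1)) : lower lam (lastIdx d) = lam (lastIdx (d + 1)) := by
  unfold lower
  congr 1
  ext
  have := NeZero.pos d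
  simp [Fin.val_rev]
  omega

lemma upper_zero (lam : Vtx (d + 1)) : upper lam 0 = lam 0 := rfl

/-! ### Higher Nakayama algebras of type `𝔸` -/

lemma KupischA.mono (ℓ : KupischA n) {i j : Fin n} (h : i ≤ j) :
    (i : ℤ) - ℓ.len i ≤ (j : ℤ) - ℓ.len j := by
  obtain ⟨i, hi⟩ := i
  obtain ⟨j, hj⟩ := j
  replace h : i ≤ j := h
  induction j, h using Nat.le_induction with
  | base => exact le_rfl
  | succ m hm ih =>
    have h1 := ih (by omega)
    have h2 := ℓ.step ⟨m, by omega⟩ ⟨m + 1, hj⟩ rfl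
    push_cast at *
    omega

/-- For `d ≥ 2` only the idempotents of the vertices outside `os^{(d)}_ℓ` are killed. For `d = 1`
all vertices `0, …, n - 1` are kept, and the paths `i - ℓ_i ⇝ i` with `ℓ_{i-1} ≥ ℓ_i` are
killed. -/
def KupischA.data (ℓ : KupischA n) (d : ℕ) [NeZero d] : QuotientData d 0 where
  verts := ℓ.os d
  rels := {q | d = 1 ∧ ∃ j i : Fin n, (i : ℕ) = j + 1 ∧ ℓ.len i ≤ ℓ.len j ∧
    q = (fun _ => (i : ℤ) - ℓ.len i, fun _ => (i : ℤ))}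
  verts_shift m x hx := by
    have : shift 0 m x = x := by funext i; simp [shift]
    rwa [this]
  rels_shift m u v h := by
    have (x : Vtx d) : shift 0 m x = x := by funext i; simp [shift]
    rwa [this, this]
  verts_finite := by
    refine ⟨Finset.Icc (fun _ => 0) (fun _ => (n : ℤ)), fun x hx => ⟨0, ?_⟩⟩
    rw [shift_zero, Finset.mem_Icc]
    obtain ⟨⟨h1, h2, h3⟩, -⟩ := hx
    refine ⟨fun i => h3.trans (last_le_of_os h1 i), fun i => (le_zero_of_os h1 i).trans ?_⟩
    linarith

/-- The higher Nakayama algebra `A^{(d)}_ℓ` of type `𝔸_n`. -/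
abbrev NakayamaA (ℓ : KupischA n) (d : ℕ) [NeZero d] : Type u := QuotAlg k (ℓ.data d)

lemma KupischA.isAdmissible (ℓ : KupischA n) {lam : Vtx (d + 1)} (h : lam ∈ ℓ.os (d + 1)) :
    IsAdmissible (ℓ.data d) (lower lam) (upper lam) := by
  obtain ⟨⟨h1, h2, h3⟩, i, hi, hlen⟩ := h
  constructor
  · intro z hz1 hz2
    have hz := mem_os_of_mem_interval hz1 hz2 h1
    have a0 : z 0 ≤ lam 0 := hz2 0
    have al : lam (lastIdx (d + 1)) ≤ z (lastIdx d) := by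
      rw [← lower_last lam]; exact hz1 _
    have hzz := le_zero_of_os hz (lastIdx d)
    refine ⟨⟨hz, by omega, by omega⟩, ⟨(z 0).toNat, by omega⟩, ?_, ?_⟩
    · change z 0 = ((z 0).toNat : ℤ)
      omega
    · have hm := ℓ.mono (i := ⟨(z 0).toNat, by omega⟩) (j := i) (by rw [Fin.le_def]; simp; omega)
      have : (((⟨(z 0).toNat, by omega⟩ : Fin n) : ℕ) : ℤ) = z 0 := by simp; omega
      rw [this] at hm
      omega
  · rintro u v ⟨hd, j', j, -, -, huv⟩ hu - hv
    rw [Prod.mk.injEq] at huv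
    obtain ⟨rfl, rfl⟩ := huv
    have a := hu (lastIdx d)
    rw [lower_last] at a
    have b := hv 0
    rw [upper_zero] at b
    have hm := ℓ.mono (i := j) (j := i) (by rw [Fin.le_def]; simp only at b; omega)
    simp only at a b
    omega

/-- The interval module `M_λ` over `A^{(d)}_ℓ`, for `λ` in `os^{(d+1)}_ℓ`. -/
def intervalA (ℓ : KupischA n) (d : ℕ) [NeZero d] (lam : ℓ.os (d + 1)) :
    ModuleCat.{u} (NakayamaA k ℓ d) :=
  ModuleCat.of _ (IntervalModule k (ℓ.isAdmissible lam.2))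

/-! ### Higher Nakayama algebras of type `𝔸̃` -/

lemma KupischTilde.mono (ℓ : KupischTilde n) {i j : ℤ} (h : i ≤ j) :
    i - ℓ.len (i : ZMod n) ≤ j - ℓ.len (j : ZMod n) := by
  induction j, h using Int.leInduction with
  | base => exact le_rfl
  | succ m hm ih =>
    have h2 := ℓ.step ((m + 1 : ℤ) : ZMod n)
    have e : ((m + 1 : ℤ) : ZMod n) - 1 = (m : ZMod n) := by push_cast; ring
    rw [e] at h2
    omega

/-- For `d ≥ 2` only the idempotents of the vertices outside `os^{(d)}_{ℓ̃}` are killed. For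
`d = 1` all vertices are kept, and the paths `i - ℓ̃_i ⇝ i` with `ℓ̃_{i-1} ≥ ℓ̃_i` are killed. -/
def KupischTilde.data (ℓ : KupischTilde n) (d : ℕ) [NeZero d] : QuotientData d n where
  verts := ℓ.os d
  rels := {q | d = 1 ∧ ∃ i : ℤ, ℓ.len (i : ZMod n) ≤ ℓ.len ((i - 1 : ℤ) : ZMod n) ∧
    q = (fun _ => i - ℓ.len (i : ZMod n), fun _ => i)}
  verts_shift m x hx := by
    obtain ⟨h1, h2⟩ := hx
    refine ⟨fun i j hij => ?_, ?_⟩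
    · have := h1 hij
      simpa [shift] using this
    · have e : ((shift n m x 0 : ℤ) : ZMod n) = ((x 0 : ℤ) : ZMod n) := by simp [shift]
      rw [e]
      simp only [shift]
      linarith
  rels_shift m u v h := by
    obtain ⟨hd, i, hi, huv⟩ := h
    rw [Prod.mk.injEq] at huv
    obtain ⟨rfl, rfl⟩ := huv
    refine ⟨hd, i + m * n, ?_, ?_⟩
    · simpa using hi
    · rw [Prod.mk.injEq]
      constructor
      · funext j
        simp only [shift]
        have : ((i + m * n : ℤ) : ZMod n) = (i : ZMod n) := by simp
        rw [this]
        ring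
      · rfl
  verts_finite := by
    refine ⟨Finset.Icc (fun _ => -(∑ i, ℓ.len i : ℕ)) (fun _ => (n : ℤ)), fun x hx =>
      ⟨-(x 0 / n), ?_⟩⟩
    obtain ⟨h1, h2⟩ := hx
    have hn : (0 : ℤ) < n := by exact_mod_cast NeZero.pos n
    have hB : ℓ.len (x 0 : ZMod n) ≤ ∑ i, ℓ.len i :=
      Finset.single_le_sum (f := ℓ.len) (fun _ _ => Nat.zero_le _) (Finset.mem_univ _)
    have hmod := Int.emod_add_mul_ediv (x 0) n
    have hlt := Int.emod_lt_of_pos (x 0) hn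
    have hge := Int.emod_nonneg (x 0) hn.ne'
    rw [Finset.mem_Icc]
    constructor
    · intro i
      have := last_le_of_os h1 i
      have hB' : (ℓ.len (x 0 : ZMod n) : ℤ) ≤ ((∑ i, ℓ.len i : ℕ) : ℤ) := by exact_mod_cast hB
      simp only [shift]
      nlinarith
    · intro i
      have := le_zero_of_os h1 i
      simp only [shift]
      nlinarith

/-- The higher Nakayama algebra `Ã^{(d)}_ℓ` of type `𝔸̃_{n-1}`. -/
abbrev NakayamaTilde (ℓ : KupischTilde n) (d : ℕ) [NeZero d] : Type u := QuotAlg k (ℓ.data d)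

lemma KupischTilde.isAdmissible (ℓ : KupischTilde n) {lam : Vtx (d + 1)}
    (h : lam ∈ ℓ.os (d + 1)) : IsAdmissible (ℓ.data d) (lower lam) (upper lam) := by
  obtain ⟨h1, hlen⟩ := h
  constructor
  · intro z hz1 hz2
    have hz := mem_os_of_mem_interval hz1 hz2 h1
    have a0 : z 0 ≤ lam 0 := hz2 0
    have al : lam (lastIdx (d + 1)) ≤ z (lastIdx d) := by
      rw [← lower_last lam]; exact hz1 _
    have hm := ℓ.mono a0
    exact ⟨hz, by omega⟩
  · rintro u v ⟨hd, j, -, huv⟩ hu - hv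
    rw [Prod.mk.injEq] at huv
    obtain ⟨rfl, rfl⟩ := huv
    have a := hu (lastIdx d)
    rw [lower_last] at a
    have b := hv 0
    rw [upper_zero] at b
    have hm := ℓ.mono b
    simp only at a b hm
    omega

/-- The image of the interval module `M_λ`, for `λ` in `os^{(d+1)}_{ℓ̃}`, as a module over
`Ã^{(d)}_ℓ`. -/
def intervalTilde (ℓ : KupischTilde n) (d : ℕ) [NeZero d] (lam : ℓ.os (d + 1)) :
    ModuleCat.{u} (NakayamaTilde k ℓ d) :=
  ModuleCat.of _ (IntervalModule k (ℓ.isAdmissible lam.2))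

/-- The indecomposable direct summands of `M` are, up to isomorphism, exactly the modules of the
family `N`. -/
def SummandsAre {Λ : Type u} [Ring Λ] {ι : Type} (M : ModuleCat.{u} Λ)
    (N : ι → ModuleCat.{u} Λ) : Prop :=
  (∀ j, Indecomposable (N j)) ∧
    ∀ X : ModuleCat.{u} Λ, Indecomposable X → (IsSummand X M ↔ ∃ j, Nonempty (X ≅ N j))

end HigherNakayama

end

open CategoryTheory

noncomputable section

namespace HigherNakayama

universe u

open Abelian Limits

/-! ### A criterion for cluster tilting -/

section Criterion

variable {Λ : Type u} [Ring Λ]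

/-! The proof is one half of the higher Auslander correspondence. If `M` generates and cogenerates,
satisfies `Ext^i(M, M) = 0` for `0 < i < d`, and its endomorphism ring has global dimension at most
`d + 1`, then `M` is `d`-cluster-tilting (`isClusterTilting_of_projectiveDimension`). Under `Hom(M,
-)`, the Ext conditions on a module turn into drops of projective dimension over the endomorphism
ring, and projectivity there means membership in `add M`.

Both types are treated at once through `IsNakayama`. A monotone function `L` cuts out the vertices
as the non-increasing sequences with `L (μ 0) ≤` last entry, and an arrow from `u` to `v` survives
only if `u` and `v` are interlaced. The module is the sum `IsNakayama.total` of the interval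
modules, one per orbit of translations. Adding `L (x 0)` after a vertex `x` gives the projective at
`x`; putting the largest admissible entry in front of `x` gives the injective at `x`. Hence `M`
generates and cogenerates (`isSeparator_total`, `cogenerates_total`).

Every homomorphism between interval modules is a sum of translations followed by truncation
(`hom_mem_of_transfer`), so the rest is combinatorics of integer sequences. For rigidity, `extSeq`,
`syzLo` and `syzHi` describe an explicit resolution by projective intervals. Each step cuts one
interval along one coordinate, and maps from the syzygies to interval modules extend over the next
projective until the coordinate `0` is reached (`exists_extension`, `ext_subsingleton`).

For the global dimension, filter `Hom(M, M_ν)` by the maps that factor through lowering one of the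
first `t` entries of `ν`. Each increase of `t` costs at most one in the projective dimension of the
quotient (`hasProjectiveDimensionLT_low`). For `t = d + 1` the quotients that occur include every
simple module (`hasProjectiveDimensionLT_simple`), and finite length gives the bound for all
finitely generated modules.

Indecomposability comes from the coefficient at the top of an interval, which detects idempotent
endomorphisms. A Krull–Schmidt argument then identifies the summands of `M`. -/

/-- A factorization of the identity of `Y` through copies of `M` puts `Y` into `add M`. -/
lemma inAdd_of_sum {M Y : ModuleCat.{u} Λ} {ι : Type*} [Fintype ι] (p : ι → (Y ⟶ M))
    (q : ι → (M ⟶ Y)) (h : ∑ i, p i ≫ q i = 𝟙 Y) : InAdd M Y := by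
  let e := Fintype.equivFin ι
  -- The extra zero coordinate keeps the exponent positive even if `ι` is empty.
  let p' : Fin (Fintype.card ι + 1) → (Y →ₗ[Λ] M) :=
    Fin.snoc (α := fun _ => Y →ₗ[Λ] M) (fun i => (p (e.symm i)).hom) 0
  let q' : Fin (Fintype.card ι + 1) → (M →ₗ[Λ] Y) :=
    Fin.snoc (α := fun _ => M →ₗ[Λ] Y) (fun i => (q (e.symm i)).hom) 0
  refine ⟨Fintype.card ι + 1, Nat.succ_pos _, ⟨⟨ModuleCat.ofHom (LinearMap.pi p'),
    ModuleCat.ofHom (∑ i, (q' i).comp (LinearMap.proj i)), ?_⟩⟩⟩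
  ext y
  have h1 : ∑ i, (q i).hom ((p i).hom y) = y := by
    have := congrArg (fun f => f.hom y) h
    simpa [ModuleCat.hom_sum] using this
  have h2 : ∑ i, q' i (p' i y) = y := by
    rw [Fin.sum_univ_castSucc]
    simp only [p', q', Fin.snoc_castSucc, Fin.snoc_last, LinearMap.zero_apply, add_zero]
    exact (Equiv.sum_comp e.symm (fun i => (q i).hom ((p i).hom y))).trans h1
  simpa using h2

/-- In this form, membership in `add M` is an equation between morphisms, which every additive
functor preserves. -/
lemma exists_sum_of_inAdd {M Y : ModuleCat.{u} Λ} (h : InAdd M Y) :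
    ∃ (r : ℕ) (p : Fin r → (Y ⟶ M)) (q : Fin r → (M ⟶ Y)), ∑ i, p i ≫ q i = 𝟙 Y := by
  classical
  obtain ⟨r, -, ⟨R⟩⟩ := h
  refine ⟨r, fun i => R.i ≫ ModuleCat.ofHom (LinearMap.proj i),
    fun i => ModuleCat.ofHom (LinearMap.single Λ (fun _ => (M : Type u)) i) ≫ R.r, ?_⟩
  have h1 : ∑ i : Fin r, (ModuleCat.ofHom (LinearMap.proj i : (Fin r → M) →ₗ[Λ] M)) ≫
      ModuleCat.ofHom (LinearMap.single Λ (fun _ => (M : Type u)) i) =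
      𝟙 (ModuleCat.of Λ (Fin r → M)) := by
    refine ModuleCat.hom_ext (LinearMap.ext fun x => ?_)
    simp only [ModuleCat.hom_sum, LinearMap.sum_apply, ModuleCat.hom_comp, ModuleCat.hom_ofHom,
      LinearMap.comp_apply, LinearMap.proj_apply, ModuleCat.hom_id, LinearMap.id_apply,
      LinearMap.coe_single]
    exact Finset.univ_sum_single x
  calc _ = R.i ≫ (∑ i : Fin r, (ModuleCat.ofHom (LinearMap.proj i : (Fin r → M) →ₗ[Λ] M)) ≫
      ModuleCat.ofHom (LinearMap.single Λ (fun _ => (M : Type u)) i)) ≫ R.r := by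
        simp only [Preadditive.sum_comp, Preadditive.comp_sum, Category.assoc]
    _ = _ := by rw [h1]; simp

/-- A class equals its composite with the identity of `Y`, hence a sum of classes that pass through
the zero groups `Ext X (N i) n`. -/
lemma ext_right_subsingleton_of_sum {X Y : ModuleCat.{u} Λ} {ι : Type*} [Fintype ι]
    {N : ι → ModuleCat.{u} Λ} (p : ∀ i, Y ⟶ N i) (q : ∀ i, N i ⟶ Y)
    (h : ∑ i, p i ≫ q i = 𝟙 Y) (n : ℕ) (hN : ∀ i, Subsingleton (Ext X (N i) n)) :
    Subsingleton (Ext X Y n) := by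
  refine subsingleton_of_forall_eq 0 fun e => ?_
  rw [← e.comp_mk₀_id, ← h, Ext.mk₀_sum, Ext.comp_sum]
  refine Finset.sum_eq_zero fun i _ => ?_
  rw [← Ext.mk₀_comp_mk₀, ← Ext.comp_assoc_of_third_deg_zero,
    (hN i).elim (e.comp (Ext.mk₀ (p i)) (add_zero n)) 0, Ext.zero_comp]

lemma ext_left_subsingleton_of_sum {X Y : ModuleCat.{u} Λ} {ι : Type*} [Fintype ι]
    {N : ι → ModuleCat.{u} Λ} (p : ∀ i, Y ⟶ N i) (q : ∀ i, N i ⟶ Y)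
    (h : ∑ i, p i ≫ q i = 𝟙 Y) (n : ℕ) (hN : ∀ i, Subsingleton (Ext (N i) X n)) :
    Subsingleton (Ext Y X n) := by
  refine subsingleton_of_forall_eq 0 fun e => ?_
  rw [← e.mk₀_id_comp, ← h, Ext.mk₀_sum, Ext.sum_comp]
  refine Finset.sum_eq_zero fun i _ => ?_
  rw [← Ext.mk₀_comp_mk₀, Ext.comp_assoc_of_second_deg_zero,
    (hN i).elim ((Ext.mk₀ (q i)).comp e (zero_add n)) 0, Ext.comp_zero]

/-- The functor `Hom(M, -)` with values in modules over the endomorphism ring of `M`. -/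
abbrev homFunctor (M : ModuleCat.{u} Λ) : ModuleCat.{u} Λ ⥤ ModuleCat.{u} (End M)ᵐᵒᵖ :=
  preadditiveCoyonedaObj M

lemma homFunctor_smul {M X : ModuleCat.{u} Λ} (a : (End M)ᵐᵒᵖ) (f : M ⟶ X) :
    (a • f : M ⟶ X) = (show M ⟶ M from a.unop) ≫ f := rfl

lemma projective_homFunctor_self (M : ModuleCat.{u} Λ) : Projective ((homFunctor M).obj M) := by
  have : Module.Projective (End M)ᵐᵒᵖ ((homFunctor M).obj M) :=
    Module.Projective.of_equiv (Preadditive.homSelfLinearEquivEndMulOpposite M).symm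
  exact (IsProjective.iff_projective _).1 this

lemma projective_homFunctor {M Y : ModuleCat.{u} Λ} (h : InAdd M Y) :
    Projective ((homFunctor M).obj Y) := by
  obtain ⟨r, p, q, hpq⟩ := exists_sum_of_inAdd h
  have := projective_homFunctor_self M
  refine ⟨fun {E X} f e _ => ⟨∑ i, (homFunctor M).map (p i) ≫
    Projective.factorThru ((homFunctor M).map (q i) ≫ f) e, ?_⟩⟩
  simp only [Preadditive.sum_comp, Category.assoc, Projective.factorThru_comp]
  simp only [← Category.assoc, ← Functor.map_comp]
  rw [← Preadditive.sum_comp, ← Functor.map_sum, hpq,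
    CategoryTheory.Functor.map_id, Category.id_comp]

lemma finite_homFunctor {M Y : ModuleCat.{u} Λ} (h : InAdd M Y) :
    Module.Finite (End M)ᵐᵒᵖ ((homFunctor M).obj Y) := by
  obtain ⟨r, p, q, hpq⟩ := exists_sum_of_inAdd h
  refine ⟨Submodule.fg_def.2 ⟨Set.range q, Set.finite_range _, ?_⟩⟩
  rw [eq_top_iff]
  intro (g : M ⟶ Y) _
  have hg : g = ∑ i, (MulOpposite.op (show End M from g ≫ p i) • q i : M ⟶ Y) := by
    conv_lhs => rw [← Category.comp_id g, ← hpq, Preadditive.comp_sum]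
    refine Finset.sum_congr rfl fun i _ => ?_
    rw [homFunctor_smul]
    exact (Category.assoc _ _ _).symm
  rw [hg]
  exact Submodule.sum_mem _ fun i _ => Submodule.smul_mem _ _
    (Submodule.subset_span (Set.mem_range_self i))

/-- By Gabriel–Popescu `Hom(M, -)` is fully faithful. A splitting of a free cover of `Hom(M, X)`
therefore comes from morphisms between `X` and copies of `M`. -/
lemma inAdd_of_projective {M X : ModuleCat.{u} Λ} (hsep : IsSeparator M)
    (hfin : Module.Finite (End M)ᵐᵒᵖ ((homFunctor M).obj X))
    (hproj : Projective ((homFunctor M).obj X)) : InAdd M X := by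
  have hfull := IsGrothendieckAbelian.GabrielPopescu.full M hsep
  have hfaith := (isSeparator_iff_faithful_preadditiveCoyonedaObj M).1 hsep
  have hp : Module.Projective (End M)ᵐᵒᵖ ((homFunctor M).obj X) :=
    (IsProjective.iff_projective _).2 hproj
  obtain ⟨r, φ, hφ⟩ := Module.Finite.exists_fin' (End M)ᵐᵒᵖ ((homFunctor M).obj X)
  obtain ⟨s, hs⟩ := Module.projective_lifting_property φ LinearMap.id hφ
  have key : ∀ j : Fin r, ∃ p : X ⟶ M, ∀ x : M ⟶ X, s x j = MulOpposite.op (x ≫ p) := by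
    intro j
    -- The free module of rank one is identified with `Hom(M, M)`, so that fullness applies to the
    -- coordinates of the section.
    obtain ⟨p, hpj⟩ := hfull.map_surjective (ModuleCat.ofHom
      ((Preadditive.homSelfLinearEquivEndMulOpposite M).symm.toLinearMap.comp
        ((LinearMap.proj j).comp s)) : (homFunctor M).obj X ⟶ (homFunctor M).obj M)
    refine ⟨p, fun x => ?_⟩
    have := congrArg (fun f => f.hom x) hpj
    exact (congrArg MulOpposite.op this).symm
  choose p hp' using key
  refine inAdd_of_sum p (fun j => (φ (Pi.single j 1) : M ⟶ X)) ?_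
  refine hfaith.map_injective (ModuleCat.hom_ext (LinearMap.ext fun (x : M ⟶ X) => ?_))
  have h1 : φ (s x) = x := congrArg (fun f => f x) hs
  have h2 : s x = ∑ j, s x j • Pi.single j 1 := by
    ext j; simp [Finset.sum_apply, Pi.single_apply]
  rw [h2, map_sum] at h1
  simp only [map_smul, hp'] at h1
  change x ≫ (∑ j, p j ≫ _) = x ≫ 𝟙 X
  rw [Category.comp_id, Preadditive.comp_sum]
  refine Eq.trans (Finset.sum_congr rfl fun j _ => ?_) h1
  exact (Category.assoc _ _ _).symm

/-- Left exactness is automatic; only surjectivity on the right needs the lifting hypothesis. -/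
lemma shortExact_map_homFunctor {M : ModuleCat.{u} Λ} {S : ShortComplex (ModuleCat.{u} Λ)}
    (hS : S.ShortExact) (h : ∀ g : M ⟶ S.X₃, ∃ g' : M ⟶ S.X₂, g' ≫ S.g = g) :
    (S.map (homFunctor M)).ShortExact := by
  have := hS.mono_f
  refine { exact := ?_, mono_f := ?_, epi_g := ?_ }
  · rw [ShortComplex.moduleCat_exact_iff]
    intro (x : M ⟶ S.X₂) (hx : x ≫ S.g = 0)
    exact ⟨hS.exact.lift x hx, hS.exact.lift_f x hx⟩
  · rw [ModuleCat.mono_iff_injective]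
    intro (x : M ⟶ S.X₁) y (hxy : x ≫ S.f = y ≫ S.f)
    exact (cancel_mono S.f).1 hxy
  · rw [ModuleCat.epi_iff_surjective]
    exact h

lemma ext_subsingleton_of_inAdd_right {M X Y : ModuleCat.{u} Λ} (h : InAdd M Y) (n : ℕ)
    (hM : Subsingleton (Ext X M n)) : Subsingleton (Ext X Y n) := by
  obtain ⟨r, p, q, hpq⟩ := exists_sum_of_inAdd h
  exact ext_right_subsingleton_of_sum p q hpq n fun _ => hM

lemma ext_subsingleton_of_inAdd_left {M X Y : ModuleCat.{u} Λ} (h : InAdd M Y) (n : ℕ)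
    (hM : Subsingleton (Ext M X n)) : Subsingleton (Ext Y X n) := by
  obtain ⟨r, p, q, hpq⟩ := exists_sum_of_inAdd h
  exact ext_left_subsingleton_of_sum p q hpq n fun _ => hM

/-- The obstruction to lifting `g` is its product with the class of `S`, an element of `Ext X S.X₁
1`. -/
lemma exists_lift_of_ext_one {S : ShortComplex (ModuleCat.{u} Λ)} (hS : S.ShortExact)
    {X : ModuleCat.{u} Λ} (h : Subsingleton (Ext X S.X₁ 1)) (g : X ⟶ S.X₃) :
    ∃ g' : X ⟶ S.X₂, g' ≫ S.g = g := by
  obtain ⟨x, hx⟩ := Ext.covariant_sequence_exact₃ X hS (Ext.mk₀ g) (zero_add 1) (h.elim _ _)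
  obtain ⟨g', rfl⟩ := Ext.homEquiv₀.symm.surjective x
  refine ⟨g', Ext.homEquiv₀.symm.injective ?_⟩
  simpa [Ext.homEquiv₀] using hx

lemma inAdd_pow (M : ModuleCat.{u} Λ) (ι : Type) [Fintype ι] : InAdd M (ModuleCat.of Λ (ι → M)) := by
  classical
  refine inAdd_of_sum (fun i => ModuleCat.ofHom (LinearMap.proj i))
    (fun i => ModuleCat.ofHom (LinearMap.single Λ (fun _ => (M : Type u)) i)) ?_
  refine ModuleCat.hom_ext (LinearMap.ext fun x => ?_)
  simp only [ModuleCat.hom_sum, LinearMap.sum_apply, ModuleCat.hom_comp, ModuleCat.hom_ofHom,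
    LinearMap.comp_apply, LinearMap.proj_apply, ModuleCat.hom_id, LinearMap.id_apply,
    LinearMap.coe_single]
  exact Finset.univ_sum_single x

/-- Every finitely generated module is a submodule of a module in `add M`. -/
def Cogenerates (M : ModuleCat.{u} Λ) : Prop :=
  ∀ X : ModuleCat.{u} Λ, Module.Finite Λ X → ∃ (Y : ModuleCat.{u} Λ) (f : X ⟶ Y),
    Module.Finite Λ Y ∧ InAdd M Y ∧ Mono f

/-- Embedding `X` into `add M` makes `Hom(M, X)` a submodule of a finitely generated module over a
Noetherian ring. -/
lemma finite_homFunctor_of_cogenerates {M : ModuleCat.{u} Λ} [IsNoetherianRing (End M)ᵐᵒᵖ]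
    (hcog : Cogenerates M) (X : ModuleCat.{u} Λ)
    (hX : Module.Finite Λ X) : Module.Finite (End M)ᵐᵒᵖ ((homFunctor M).obj X) := by
  obtain ⟨Y, f, -, hY, hf⟩ := hcog X hX
  have := finite_homFunctor hY
  refine Module.Finite.of_injective ((homFunctor M).map f).hom ?_
  intro (x : M ⟶ X) y (hxy : x ≫ f = y ≫ f)
  exact (cancel_mono f).1 hxy

/-- The short exact sequence given by the cokernel of a monomorphism. -/
lemma shortExact_cokernel {X Y : ModuleCat.{u} Λ} (f : X ⟶ Y) [Mono f] :
    (ShortComplex.mk f (cokernel.π f) (cokernel.condition f)).ShortExact where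
  exact := ShortComplex.exact_cokernel f
  mono_f := ‹_›
  epi_g := inferInstance

lemma shortExact_kernel {R : Type u} [Ring R] {X Y : ModuleCat.{u} R} (f : X ⟶ Y) [Epi f] :
    (ShortComplex.mk (kernel.ι f) f (kernel.condition f)).ShortExact where
  exact := ShortComplex.exact_kernel f
  mono_f := inferInstance
  epi_g := ‹_›

lemma finite_cokernel {R : Type u} [Ring R] {X Y : ModuleCat.{u} R} (f : X ⟶ Y)
    (h : Module.Finite R Y) :
    Module.Finite R (cokernel f : ModuleCat.{u} R) :=
  Module.Finite.of_surjective (cokernel.π f).hom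
    ((ModuleCat.epi_iff_surjective _).1 inferInstance)

lemma finite_kernel [IsNoetherianRing Λ] {X Y : ModuleCat.{u} Λ} (f : X ⟶ Y)
    (h : Module.Finite Λ X) :
    Module.Finite Λ (kernel f : ModuleCat.{u} Λ) :=
  Module.Finite.of_injective (kernel.ι f).hom
    ((ModuleCat.mono_iff_injective _).1 inferInstance)

lemma hasProjectiveDimensionLT_of_projective {C : Type*} [Category* C] [Abelian C] {X : C} {n : ℕ}
    (h : Projective X) (hn : 1 ≤ n) : HasProjectiveDimensionLT X n :=
  hasProjectiveDimensionLT_of_ge X 1 n hn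

/-- Here `S.X₁` is a second syzygy of the cokernel. Splitting the four-term sequence at the image of
`S.g` lowers the dimension by one twice. -/
lemma hasProjectiveDimensionLT_of_copresentation {C : Type*} [Category* C] [Abelian C] {d : ℕ}
    {S : ShortComplex C} (hS : S.Exact) [Mono S.f] (h₂ : Projective S.X₂) (h₃ : Projective S.X₃)
    (h : HasProjectiveDimensionLT (cokernel S.g) (d + 3)) :
    HasProjectiveDimensionLT S.X₁ (d + 1) := by
  have s1 : (ShortComplex.mk (Abelian.image.ι S.g) (cokernel.π S.g)
      (kernel.condition (cokernel.π S.g))).ShortExact :=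
    { exact := ShortComplex.exact_kernel (cokernel.π S.g)
      mono_f := inferInstance
      epi_g := inferInstance }
  have h1 : HasProjectiveDimensionLT (Abelian.image S.g) (d + 2) :=
    s1.hasProjectiveDimensionLT_X₁ (d + 2) (hasProjectiveDimensionLT_of_ge _ 1 _ (by omega)) h
  have w : S.f ≫ Abelian.factorThruImage S.g = 0 := by
    rw [← cancel_mono (Abelian.image.ι S.g), Category.assoc, Abelian.image.fac, zero_comp, S.zero]
  have s2 : (ShortComplex.mk S.f (Abelian.factorThruImage S.g) w).ShortExact := by
    refine { exact := ?_, mono_f := ‹_›, epi_g := inferInstance }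
    let α : ShortComplex.mk S.f (Abelian.factorThruImage S.g) w ⟶ S :=
      { τ₁ := 𝟙 _, τ₂ := 𝟙 _, τ₃ := Abelian.image.ι S.g }
    have e1 : Epi α.τ₁ := inferInstanceAs (Epi (𝟙 _))
    have e2 : IsIso α.τ₂ := inferInstanceAs (IsIso (𝟙 _))
    have e3 : Mono α.τ₃ := inferInstanceAs (Mono (Abelian.image.ι S.g))
    exact (ShortComplex.exact_iff_of_epi_of_isIso_of_mono α).2 hS
  exact s2.hasProjectiveDimensionLT_X₁ (d + 1) (hasProjectiveDimensionLT_of_ge _ 1 _ (by omega)) h1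

/-- Copresent `X` by two modules in `add M`. As `Hom(M, -)` is left exact, `Hom(M, X)` is a second
syzygy of a finitely generated module, so its dimension is at most `d - 1`. -/
lemma hasProjectiveDimensionLT_homFunctor {M : ModuleCat.{u} Λ} {d : ℕ} (hd : 0 < d)
    (hcog : Cogenerates M)
    (hpd : ∀ N : ModuleCat.{u} (End M)ᵐᵒᵖ, Module.Finite (End M)ᵐᵒᵖ N →
      HasProjectiveDimensionLT N (d + 2))
    (X : ModuleCat.{u} Λ) (hX : Module.Finite Λ X) :
    HasProjectiveDimensionLT ((homFunctor M).obj X) d := by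
  obtain ⟨I, f, hI, hIM, hf⟩ := hcog X hX
  obtain ⟨J, g, hJ, hJM, hg⟩ := hcog (cokernel f) (finite_cokernel f hI)
  obtain ⟨d, rfl⟩ : ∃ e, d = e + 1 := ⟨d - 1, by omega⟩
  let S : ShortComplex (ModuleCat.{u} Λ) := ShortComplex.mk f (cokernel.π f ≫ g)
    (by rw [cokernel.condition_assoc, zero_comp])
  have hex : (S.map (homFunctor M)).Exact := by
    rw [ShortComplex.moduleCat_exact_iff]
    intro (x : M ⟶ I) (hx : x ≫ cokernel.π f ≫ g = 0)
    have hx2 : x ≫ cokernel.π f = 0 := by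
      rw [← cancel_mono g, Category.assoc, hx, zero_comp]
    exact ⟨(shortExact_cokernel f).exact.lift x hx2, (shortExact_cokernel f).exact.lift_f x hx2⟩
  have hmono : Mono (S.map (homFunctor M)).f := by
    rw [ModuleCat.mono_iff_injective]
    intro (x : M ⟶ X) y (hxy : x ≫ f = y ≫ f)
    exact (cancel_mono f).1 hxy
  exact hasProjectiveDimensionLT_of_copresentation hex (projective_homFunctor hIM)
    (projective_homFunctor hJM) (hpd _ (finite_cokernel _ (finite_homFunctor hJM)))

/-- Each vanishing `Ext^i(M, Y)` lowers the dimension by one more. With `Y` embedded in `I` in `add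
M`, vanishing of `Ext^1(M, Y)` makes `Hom(M, Y)` a syzygy of `Hom(M, I/Y)`, and rigidity of `M`
passes the other vanishings to `I/Y` with a shift by one. -/
lemma hasProjectiveDimensionLT_homFunctor_of_ext {M : ModuleCat.{u} Λ} {d : ℕ}
    (hcog : Cogenerates M) (hrig : ∀ i, 1 ≤ i → i < d → Subsingleton (Ext M M i))
    (hpd : ∀ N : ModuleCat.{u} (End M)ᵐᵒᵖ, Module.Finite (End M)ᵐᵒᵖ N →
      HasProjectiveDimensionLT N (d + 2)) (t : ℕ) (ht : t < d)
    (Y : ModuleCat.{u} Λ) (hY : Module.Finite Λ Y)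
    (hext : ∀ i, 1 ≤ i → i ≤ t → Subsingleton (Ext M Y i)) :
    HasProjectiveDimensionLT ((homFunctor M).obj Y) (d - t) := by
  induction t generalizing Y with
  | zero => exact hasProjectiveDimensionLT_homFunctor ht hcog hpd Y hY
  | succ t ih =>
    obtain ⟨I, f, hI, hIM, hf⟩ := hcog Y hY
    have hS := shortExact_cokernel f
    have hZ := ih (by omega) (cokernel f) (finite_cokernel f hI) (fun i h1 h2 => by
      refine subsingleton_of_forall_eq 0 fun x => ?_
      obtain ⟨y, hy⟩ := Ext.covariant_sequence_exact₃ M hS x rfl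
        ((hext (i + 1) (by omega) (by omega)).elim _ _)
      rw [← hy, (ext_subsingleton_of_inAdd_right hIM i (hrig i h1 (by omega))).elim y 0,
        Ext.zero_comp])
    have hF := shortExact_map_homFunctor (M := M) hS
      (exists_lift_of_ext_one hS (hext 1 le_rfl (by omega)))
    have e : d - t = d - (t + 1) + 1 := by omega
    rw [e] at hZ
    exact hF.hasProjectiveDimensionLT_X₁ _
      (hasProjectiveDimensionLT_of_projective (projective_homFunctor hIM) (by omega)) hZ

/-- A right approximation by a module in `add M`, as a short exact sequence. -/
lemma exists_approximation {M : ModuleCat.{u} Λ} [IsNoetherianRing (End M)ᵐᵒᵖ]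
    [IsNoetherianRing Λ] [Module.Finite Λ M] (hsep : IsSeparator M) (hcog : Cogenerates M)
    (X : ModuleCat.{u} Λ) (hX : Module.Finite Λ X) :
    ∃ S : ShortComplex (ModuleCat.{u} Λ), S.ShortExact ∧ S.X₃ = X ∧ InAdd M S.X₂ ∧
      Module.Finite Λ S.X₁ ∧ ∀ g : M ⟶ S.X₃, ∃ g' : M ⟶ S.X₂, g' ≫ S.g = g := by
  have hfin := finite_homFunctor_of_cogenerates hcog X hX
  obtain ⟨r, φ, hφ⟩ := Module.Finite.exists_fin' (End M)ᵐᵒᵖ ((homFunctor M).obj X)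
  -- Generators of `Hom(M, X)` assemble to a map from `M ^ r` through which every map from `M`
  -- factors; it is epi because `M` separates.
  let c : Fin r → (M ⟶ X) := fun j => φ (Pi.single j 1)
  let π : ModuleCat.of Λ (Fin r → M) ⟶ X :=
    ∑ j, ModuleCat.ofHom (LinearMap.proj j : (Fin r → M) →ₗ[Λ] M) ≫ c j
  have hlift : ∀ g : M ⟶ X, ∃ g' : M ⟶ ModuleCat.of Λ (Fin r → M), g' ≫ π = g := by
    intro g
    obtain ⟨a, ha⟩ := hφ g
    refine ⟨ModuleCat.ofHom (LinearMap.pi fun j => (show M ⟶ M from (a j).unop).hom), ?_⟩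
    have h2 : a = ∑ j, a j • Pi.single j 1 := by
      ext j; simp [Finset.sum_apply, Pi.single_apply]
    rw [h2, map_sum] at ha
    simp only [map_smul] at ha
    rw [Preadditive.comp_sum]
    refine Eq.trans (Finset.sum_congr rfl fun j _ => ?_) ha
    rfl
  have hepi : Epi π := by
    refine Preadditive.epi_of_cancel_zero _ fun {Z} h hh => ?_
    refine (Preadditive.isSeparator_iff M).1 hsep _ fun g => ?_
    obtain ⟨g', rfl⟩ := hlift g
    rw [Category.assoc, hh, comp_zero]
  exact ⟨_, shortExact_kernel π, rfl, inAdd_pow M (Fin r),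
    finite_kernel π inferInstance, hlift⟩

/-- Dimension shifting along approximations: `K` has a resolution of length `j` by `add M`, and
`Ext^s(X, K)` lies between `Ext^s(X, -)` of a module in `add M` and `Ext^{s+1}(X, -)` of the kernel.
-/
lemma ext_subsingleton_of_hasProjectiveDimensionLT {M : ModuleCat.{u} Λ}
    [IsNoetherianRing (End M)ᵐᵒᵖ] [IsNoetherianRing Λ] [Module.Finite Λ M]
    (hsep : IsSeparator M) (hcog : Cogenerates M) (X : ModuleCat.{u} Λ) (j s : ℕ)
    (hX : ∀ i, s ≤ i → i ≤ s + j → Subsingleton (Ext X M i))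
    (K : ModuleCat.{u} Λ) (hK : Module.Finite Λ K)
    (hpd : HasProjectiveDimensionLT ((homFunctor M).obj K) (j + 1)) :
    Subsingleton (Ext X K s) := by
  induction j generalizing s K with
  | zero =>
    exact ext_subsingleton_of_inAdd_right (inAdd_of_projective hsep
      (finite_homFunctor_of_cogenerates hcog K hK)
      (projective_iff_hasProjectiveDimensionLT_one.2 hpd)) s (hX s le_rfl le_rfl)
  | succ j ih =>
    obtain ⟨S, hS, rfl, h2, h1, hlift⟩ := exists_approximation hsep hcog K hK
    have hF := shortExact_map_homFunctor (M := M) hS hlift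
    have hpd1 := hF.hasProjectiveDimensionLT_X₁ (j + 1)
      (hasProjectiveDimensionLT_of_projective (projective_homFunctor h2) (by omega)) hpd
    have hs1 := ih (s + 1) (fun i a b => hX i (by omega) (by omega)) S.X₁ h1 hpd1
    refine subsingleton_of_forall_eq 0 fun x => ?_
    obtain ⟨y, hy⟩ := Ext.covariant_sequence_exact₃ X hS x rfl (hs1.elim _ _)
    rw [← hy, (ext_subsingleton_of_inAdd_right h2 s (hX s le_rfl (by omega))).elim y 0,
      Ext.zero_comp]

/-- A rigid separating and cogenerating module whose endomorphism ring has global dimension at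
most `d + 1` is `d`-cluster-tilting. -/
theorem isClusterTilting_of_projectiveDimension {M : ModuleCat.{u} Λ} {d : ℕ} (hd : 0 < d)
    [IsNoetherianRing (End M)ᵐᵒᵖ] [IsNoetherianRing Λ] [Module.Finite Λ M]
    (hsep : IsSeparator M) (hcog : Cogenerates M)
    (hrig : ∀ i, 1 ≤ i → i < d → Subsingleton (Ext M M i))
    (hpd : ∀ N : ModuleCat.{u} (End M)ᵐᵒᵖ, Module.Finite (End M)ᵐᵒᵖ N →
      HasProjectiveDimensionLT N (d + 2)) : IsClusterTilting d M := by
  refine ⟨inferInstance, fun X hX => ⟨fun h i h1 h2 =>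
    ext_subsingleton_of_inAdd_left h i (hrig i h1 h2), fun h => ?_⟩, fun Y hY => ⟨fun h i h1 h2 =>
    ext_subsingleton_of_inAdd_right h i (hrig i h1 h2), fun h => ?_⟩⟩
  · have hpdX := hasProjectiveDimensionLT_homFunctor hd hcog hpd X hX
    by_cases hd1 : d = 1
    · subst hd1
      exact inAdd_of_projective hsep (finite_homFunctor_of_cogenerates hcog X hX)
        (projective_iff_hasProjectiveDimensionLT_one.2 hpdX)
    -- For `d ≥ 2` the kernel of the approximation has `Hom`-dimension at most `d - 2`, so the
    -- vanishing of `Ext^i(X, M)` for `1 ≤ i ≤ d - 1` kills `Ext^1(X, S.X₁)`. The approximation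
    -- splits and `X` is a retract of a module in `add M`.
    · obtain ⟨S, hS, rfl, h2, h1, hlift⟩ := exists_approximation hsep hcog X hX
      have hF := shortExact_map_homFunctor (M := M) hS hlift
      obtain ⟨e, rfl⟩ : ∃ e, d = e + 2 := ⟨d - 2, by omega⟩
      have hpd1 := hF.hasProjectiveDimensionLT_X₁ (e + 1)
        (hasProjectiveDimensionLT_of_projective (projective_homFunctor h2) (by omega)) hpdX
      have hs := ext_subsingleton_of_hasProjectiveDimensionLT hsep hcog S.X₃ e 1
        (fun i a b => h i a (by omega)) S.X₁ h1 hpd1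
      obtain ⟨σ, hσ⟩ := exists_lift_of_ext_one hS hs (𝟙 S.X₃)
      obtain ⟨r, p, q, hpq⟩ := exists_sum_of_inAdd h2
      refine inAdd_of_sum (fun i => σ ≫ p i) (fun i => q i ≫ S.g) ?_
      calc _ = σ ≫ (∑ i, p i ≫ q i) ≫ S.g := by
            simp only [Preadditive.sum_comp, Preadditive.comp_sum, Category.assoc]
        _ = _ := by rw [hpq, Category.id_comp, hσ]
  -- With all `d - 1` vanishings used, the dimension drops to zero.
  · have := hasProjectiveDimensionLT_homFunctor_of_ext hcog hrig hpd (d - 1) (by omega) Y hY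
      (fun i h1 h2 => h i h1 (by omega))
    rw [show d - (d - 1) = 1 by omega] at this
    exact inAdd_of_projective hsep (finite_homFunctor_of_cogenerates hcog Y hY)
      (projective_iff_hasProjectiveDimensionLT_one.2 this)

end Criterion

/-! ### Multiplication of arrows -/

section Arrows

variable {d p : ℕ}

/-- Two vertices in the same orbit of translations. -/
def SameOrbit (p : ℕ) (x u : Vtx d) : Prop := ∃ m, x = shift p m u

lemma SameOrbit.refl (x : Vtx d) : SameOrbit p x x := ⟨0, (shift_zero p x).symm⟩

lemma SameOrbit.symm {x u : Vtx d} (h : SameOrbit p x u) : SameOrbit p u x := by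
  obtain ⟨m, rfl⟩ := h
  exact ⟨-m, by simp [shift_shift, shift_zero]⟩

lemma SameOrbit.trans {x u v : Vtx d} (h : SameOrbit p x u) (h' : SameOrbit p u v) :
    SameOrbit p x v := by
  obtain ⟨m, rfl⟩ := h
  obtain ⟨m', rfl⟩ := h'
  exact ⟨m + m', shift_shift _ _ _ _⟩

lemma shift_eq_add (m : ℤ) (u v : Vtx d) : shift p m v = shift p m u + (v - u) := by
  funext i; simp only [shift, Pi.add_apply, Pi.sub_apply]; ring

lemma SameOrbit.add {x u : Vtx d} (h : SameOrbit p x u) (v : Vtx d) :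
    SameOrbit p (x + v) (u + v) := by
  obtain ⟨m, rfl⟩ := h
  exact ⟨m, by funext i; simp only [shift, Pi.add_apply]; ring⟩

lemma SameOrbit.add_iff {x u : Vtx d} (v : Vtx d) :
    SameOrbit p (x + v) (u + v) ↔ SameOrbit p x u :=
  ⟨fun h => by simpa using h.add (-v), fun h => h.add v⟩

variable (k : Type u) [Field k]

open Classical in
-- The displacement `v - u` is invariant under translation, so only the source has to be compared up
-- to orbits. This makes products of arrows computable.
lemma arrow_apply_add (u v x y : Vtx d) :
    (arrow k p u v).1 x y = if u ≤ v ∧ SameOrbit p x u ∧ y = x + (v - u) then 1 else 0 := by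
  rw [arrow_apply]
  congr 1
  refine propext (and_congr_right fun _ => ⟨?_, ?_⟩)
  · rintro ⟨m, rfl, rfl⟩
    exact ⟨⟨m, rfl⟩, shift_eq_add _ _ _⟩
  · rintro ⟨⟨m, rfl⟩, rfl⟩
    exact ⟨m, rfl, (shift_eq_add _ _ _).symm⟩

open Classical in
lemma arrow_mul_apply {u v : Vtx d} (huv : u ≤ v) (a : orbitAlg k d p) (x y : Vtx d) :
    (arrow k p u v * a).1 x y = if SameOrbit p x u then a.1 (x + (v - u)) y else 0 := by
  change ((arrow k p u v).1 * a.1) x y = _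
  rw [IncidenceAlgebra.mul_apply]
  simp only [arrow_apply_add]
  have hle : x ≤ x + (v - u) := by simpa using huv
  by_cases hx : SameOrbit p x u
  · by_cases hy : x + (v - u) ≤ y
    · rw [Finset.sum_eq_single (x + (v - u))]
      · simp [huv, hx]
      · intro z _ hz; simp [hz]
      · intro h; exact (h (Finset.mem_Icc.2 ⟨hle, hy⟩)).elim
    · rw [IncidenceAlgebra.apply_eq_zero_of_not_le hy, ite_self]
      refine Finset.sum_eq_zero fun z hz => ?_
      rw [if_neg, zero_mul]
      rintro ⟨-, -, rfl⟩
      exact hy (Finset.mem_Icc.1 hz).2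
  · simp [hx]

lemma arrow_mul_arrow {u v w : Vtx d} (huv : u ≤ v) (hvw : v ≤ w) :
    arrow k p u v * arrow k p v w = arrow k p u w := by
  classical
  refine orbit_ext k fun x y => ?_
  rw [arrow_mul_apply k huv, arrow_apply_add, arrow_apply_add]
  have e : SameOrbit p (x + (v - u)) v ↔ SameOrbit p x u := by
    rw [← SameOrbit.add_iff (v - u) (x := x)]; simp
  have e' : x + (v - u) + (w - v) = x + (w - u) := by abel
  simp only [e, e', hvw, huv.trans hvw, true_and]
  by_cases hx : SameOrbit p x u <;> simp [hx]

lemma arrow_mul_arrow_of_not {u v w z : Vtx d} (huv : u ≤ v) (h : ¬ SameOrbit p v w) :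
    arrow k p u v * arrow k p w z = 0 := by
  classical
  refine orbit_ext k fun x y => ?_
  rw [arrow_mul_apply k huv, arrow_apply_add]
  by_cases hx : SameOrbit p x u
  · rw [if_pos hx, if_neg]
    · rfl
    rintro ⟨-, hw, -⟩
    have : SameOrbit p (x + (v - u)) v := by simpa using hx.add (v - u)
    exact h (this.symm.trans hw)
  · rw [if_neg hx]; rfl

lemma arrow_shift (m : ℤ) (u v : Vtx d) :
    arrow k p (shift p m u) (shift p m v) = arrow k p u v := by
  classical
  refine orbit_ext k fun x y => ?_
  rw [arrow_apply_add, arrow_apply_add, shift_le_shift]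
  have e : SameOrbit p x (shift p m u) ↔ SameOrbit p x u :=
    ⟨fun h => h.trans ⟨m, rfl⟩, fun h => h.trans (SameOrbit.symm ⟨m, rfl⟩)⟩
  have e' : shift p m v - shift p m u = v - u := by rw [shift_eq_add m u v]; abel
  rw [e, e']

lemma SameOrbit.exists_arrow {v w : Vtx d} (h : SameOrbit p v w) (u : Vtx d) :
    arrow k p u v = arrow k p (w - (v - u)) w := by
  obtain ⟨m, rfl⟩ := h
  rw [← arrow_shift k m _ w]
  congr 1
  funext i; simp [shift]; ring

/-- The algebra of the orbit category is spanned by the arrows. -/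
lemma orbitAlg_induction {P : orbitAlg k d p → Prop} (h0 : P 0)
    (hadd : ∀ a b, P a → P b → P (a + b))
    (harrow : ∀ (c : k) (u v : Vtx d), u ≤ v → P (c • arrow k p u v)) (a : orbitAlg k d p) :
    P a := by
  classical
  -- Induction on a finite set of pairs whose orbits cover the support.
  have key : ∀ (T : Finset (Vtx d × Vtx d)) (a : orbitAlg k d p),
      (∀ x y, a.1 x y ≠ 0 → ∃ m, (shift p m x, shift p m y) ∈ T) → P a := by
    intro T
    induction T using Finset.induction_on with
    | empty =>
      intro a ha
      convert h0
      refine orbit_ext k fun x y => ?_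
      by_contra h
      obtain ⟨m, hm⟩ := ha x y h
      simp at hm
    | insert t T ht ih =>
      intro a ha
      obtain ⟨u, v⟩ := t
      by_cases huv : u ≤ v
      -- By invariance of `a`, one multiple of one arrow clears the whole orbit of `(u, v)`.
      · have hP := ih (a - a.1 u v • arrow k p u v) (fun x y hxy => by
          change a.1 x y - a.1 u v * (arrow k p u v).1 x y ≠ 0 at hxy
          rw [arrow_apply] at hxy
          by_cases h : ∃ m, x = shift p m u ∧ y = shift p m v
          · obtain ⟨m, rfl, rfl⟩ := h
            rw [if_pos ⟨huv, m, rfl, rfl⟩, a.2.1] at hxy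
            simp at hxy
          · rw [if_neg (fun h' => h h'.2), mul_zero, sub_zero] at hxy
            obtain ⟨m, hm⟩ := ha x y hxy
            refine ⟨m, (Finset.mem_insert.1 hm).resolve_left fun h' => h ⟨-m, ?_⟩⟩
            rw [Prod.mk.injEq] at h'
            rw [← h'.1, ← h'.2]
            simp [shift_shift, shift_zero])
        have := hadd _ _ hP (harrow (a.1 u v) u v huv)
        have e : a - a.1 u v • arrow k p u v + a.1 u v • arrow k p u v = a :=
          orbit_ext k fun x y => sub_add_cancel (a.1 x y) ((a.1 u v • arrow k p u v).1 x y)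
        rwa [e] at this
      · refine ih a fun x y hxy => ?_
        obtain ⟨m, hm⟩ := ha x y hxy
        refine ⟨m, (Finset.mem_insert.1 hm).resolve_left fun h' => ?_⟩
        rw [Prod.mk.injEq] at h'
        rw [← a.2.1 m, h'.1, h'.2] at hxy
        exact hxy (IncidenceAlgebra.apply_eq_zero_of_not_le huv _)
  obtain ⟨F, hF⟩ := a.2.2
  exact key (F ×ˢ F) a fun x y h => by
    obtain ⟨m, h1, h2⟩ := hF x y h
    exact ⟨m, by simp [h1, h2]⟩

variable (D : QuotientData d p)

/-- The class of an arrow in the quotient algebra. -/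
def ar (u v : Vtx d) : QuotAlg k D := QuotAlg.mk k D (arrow k p u v)

variable {k D}

lemma ar_mul_ar {u v w : Vtx d} (huv : u ≤ v) (hvw : v ≤ w) :
    ar k D u v * ar k D v w = ar k D u w := by
  rw [ar, ar, ← QuotAlg.mk_mul, arrow_mul_arrow k huv hvw, ar]

lemma ar_mul_ar_of_not {u v w z : Vtx d} (huv : u ≤ v) (h : ¬ SameOrbit p v w) :
    ar k D u v * ar k D w z = 0 := by
  rw [ar, ar, ← QuotAlg.mk_mul, arrow_mul_arrow_of_not k huv h]; rfl

lemma ar_shift (m : ℤ) (u v : Vtx d) : ar k D (shift p m u) (shift p m v) = ar k D u v := by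
  rw [ar, arrow_shift, ar]

/-- Composition of two arrows that meet after a translation. -/
lemma ar_mul_ar_of_sameOrbit {u v w z : Vtx d} (huv : u ≤ v) (hwz : w ≤ z)
    (h : SameOrbit p v w) : ar k D u v * ar k D w z = ar k D (w - (v - u)) z := by
  rw [ar, h.exists_arrow k u]
  exact ar_mul_ar (by simpa using huv) hwz

lemma ar_eq_zero_of_mem {u v : Vtx d} (h : arrow k p u v ∈ relIdeal k D) : ar k D u v = 0 := by
  refine (QuotAlg.mk_eq k D).2 ?_
  convert h using 1
  exact orbit_ext k fun x y => sub_zero ((arrow k p u v).1 x y)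

lemma ar_eq_zero_of_notMem_left {u v : Vtx d} (huv : u ≤ v) (hu : u ∉ D.verts) :
    ar k D u v = 0 := by
  rw [← ar_mul_ar le_rfl huv,
    ar_eq_zero_of_mem (TwoSidedIdeal.subset_span (Or.inl ⟨u, hu, rfl⟩)), zero_mul]

lemma ar_eq_zero_of_notMem_right {u v : Vtx d} (huv : u ≤ v) (hv : v ∉ D.verts) :
    ar k D u v = 0 := by
  rw [← ar_mul_ar huv le_rfl, ar_eq_zero_of_notMem_left le_rfl hv, mul_zero]

/-- The arrow factors through the idempotent at `z`, which is killed. For `d ≥ 2` this is the only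
source of zero arrows. -/
lemma ar_eq_zero_of_between {u v z : Vtx d} (huz : u ≤ z) (hzv : z ≤ v) (hz : z ∉ D.verts) :
    ar k D u v = 0 := by
  rw [← ar_mul_ar huz hzv, ar_eq_zero_of_notMem_right huz hz, zero_mul]

lemma ar_eq_zero_of_rels {u v : Vtx d} (h : (u, v) ∈ D.rels) :
    ar k D u v = 0 :=
  ar_eq_zero_of_mem (TwoSidedIdeal.subset_span (Or.inr ⟨u, v, h, rfl⟩))

lemma algebraMap_mul_mk (c : k) (a : orbitAlg k d p) :
    algebraMap k (QuotAlg k D) c * QuotAlg.mk k D a = QuotAlg.mk k D (c • a) := by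
  change QuotAlg.mk k D (c • unitElt k D) * QuotAlg.mk k D a = _
  rw [← QuotAlg.mk_mul, orbit_smul_mul, ← orbit_mul_smul, QuotAlg.mk_mul, ← QuotAlg.one_def,
    one_mul]

lemma quotAlg_induction {P : QuotAlg k D → Prop} (h0 : P 0)
    (hadd : ∀ a b, P a → P b → P (a + b))
    (harrow : ∀ (c : k) (u v : Vtx d), u ≤ v → P (algebraMap k _ c * ar k D u v))
    (a : QuotAlg k D) : P a := by
  obtain ⟨a, rfl⟩ := QuotAlg.mk_surjective k D a
  refine orbitAlg_induction k (P := fun a => P (QuotAlg.mk k D a)) h0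
    (fun a b ha hb => hadd _ _ ha hb) (fun c u v huv => ?_) a
  have := harrow c u v huv
  rwa [ar, algebraMap_mul_mk] at this

/-- A map of modules over the quotient algebra is linear if it respects scalars and arrows. -/
def linearMapOfArrows {X Y : Type*} [AddCommGroup X] [AddCommGroup Y] [Module (QuotAlg k D) X]
    [Module (QuotAlg k D) Y] (f : X →+ Y)
    (hk : ∀ (c : k) x, f (algebraMap k (QuotAlg k D) c • x) = algebraMap k (QuotAlg k D) c • f x)
    (ha : ∀ (u v : Vtx d) (_ : u ≤ v) x, f (ar k D u v • x) = ar k D u v • f x) :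
    X →ₗ[QuotAlg k D] Y where
  toFun := f
  map_add' := f.map_add
  map_smul' a x := by
    rw [RingHom.id_apply]
    induction a using quotAlg_induction generalizing x with
    | h0 => simp
    | hadd a b iha ihb => rw [add_smul, map_add, iha, ihb, add_smul]
    | harrow c u v huv => rw [mul_smul, hk, ha u v huv, mul_smul]

/-- The identity is a sum of idempotents of vertices. -/
lemma sum_ar_smul {X : Type*} [AddCommGroup X] [Module (QuotAlg k D) X] (v : X) :
    v ∈ AddSubgroup.closure {w : X | ∃ (x : Vtx d) (w' : X), x ∈ D.verts ∧
      w = ar k D x x • w'} := by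
  rw [← one_smul (QuotAlg k D) v]
  generalize (1 : QuotAlg k D) = a
  induction a using quotAlg_induction with
  | h0 => rw [zero_smul]; exact AddSubgroup.zero_mem _
  | hadd a b iha ihb => rw [add_smul]; exact AddSubgroup.add_mem _ iha ihb
  | harrow c u w huw =>
    by_cases hu : u ∈ D.verts
    · refine AddSubgroup.subset_closure
        ⟨u, (algebraMap k (QuotAlg k D) c * ar k D u w) • v, hu, ?_⟩
      rw [← mul_smul, ← mul_assoc, ← Algebra.commutes, mul_assoc, ar_mul_ar le_rfl huw]
    · rw [ar_eq_zero_of_notMem_left huw hu, mul_zero, zero_smul]; exact AddSubgroup.zero_mem _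

end Arrows

/-! ### Maps between interval modules -/

section Intervals

variable {k : Type u} [Field k] {d p : ℕ} {D : QuotientData d p} {lo hi lo' hi' : Vtx d}

open Classical in
/-- The coefficient of an element of an interval module at any vertex. -/
def coeff {h : IsAdmissible D lo hi} (w : IntervalModule k h) (x : Vtx d) : k :=
  if hx : x ∈ Finset.Icc lo hi then w ⟨x, hx⟩ else 0

/-- The element of an interval module with given coefficients. -/
def ofCoeff (h : IsAdmissible D lo hi) (f : Vtx d → k) : IntervalModule k h := fun x => f x.1

variable {h : IsAdmissible D lo hi} {h' : IsAdmissible D lo' hi'}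

lemma coeff_of_notMem (w : IntervalModule k h) {x : Vtx d} (hx : ¬ (lo ≤ x ∧ x ≤ hi)) :
    coeff w x = 0 := dif_neg (by rwa [Finset.mem_Icc])

lemma mem_of_coeff_ne_zero {w : IntervalModule k h} {x : Vtx d} (hx : coeff w x ≠ 0) :
    lo ≤ x ∧ x ≤ hi := by
  by_contra h'; exact hx (coeff_of_notMem w h')

lemma coeff_coe (w : IntervalModule k h) (x : Finset.Icc lo hi) : coeff w x.1 = w x :=
  dif_pos x.2

lemma interval_ext {w w' : IntervalModule k h}
    (hw : ∀ x, lo ≤ x → x ≤ hi → coeff w x = coeff w' x) : w = w' := by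
  funext x
  rw [← coeff_coe w x, ← coeff_coe w' x]
  exact hw _ (Finset.mem_Icc.1 x.2).1 (Finset.mem_Icc.1 x.2).2

open Classical in
lemma coeff_ofCoeff (f : Vtx d → k) (x : Vtx d) :
    coeff (ofCoeff h f) x = if lo ≤ x ∧ x ≤ hi then f x else 0 := by
  by_cases hx : lo ≤ x ∧ x ≤ hi
  · rw [if_pos hx]; exact dif_pos (Finset.mem_Icc.2 hx)
  · rw [if_neg hx]; exact coeff_of_notMem _ hx

lemma coeff_add (w w' : IntervalModule k h) (x : Vtx d) :
    coeff (w + w') x = coeff w x + coeff w' x := by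
  by_cases hx : x ∈ Finset.Icc lo hi
  · simp only [coeff, dif_pos hx]; rfl
  · simp [coeff, dif_neg hx]

lemma coeff_zero (x : Vtx d) : coeff (0 : IntervalModule k h) x = 0 := by
  by_cases hx : x ∈ Finset.Icc lo hi
  · simp only [coeff, dif_pos hx]; rfl
  · simp [coeff, dif_neg hx]

lemma coeff_sum {ι : Type*} (s : Finset ι) (w : ι → IntervalModule k h) (x : Vtx d) :
    coeff (∑ i ∈ s, w i) x = ∑ i ∈ s, coeff (w i) x :=
  map_sum (AddMonoidHom.mk' (fun w : IntervalModule k h => coeff w x)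
    (fun a b => coeff_add a b x)) w s

lemma coeff_mk_smul (a : orbitAlg k d p) (w : IntervalModule k h) {x : Vtx d}
    (hx : lo ≤ x ∧ x ≤ hi) :
    coeff (QuotAlg.mk k D a • w) x = ∑ y ∈ Finset.Icc lo hi, a.1 x y * coeff w y := by
  have hx' := Finset.mem_Icc.2 hx
  have e : coeff (QuotAlg.mk k D a • w) x = (QuotAlg.mk k D a • w) ⟨x, hx'⟩ := dif_pos hx'
  rw [e, intervalModule_smul, ← Finset.sum_coe_sort]
  refine Finset.sum_congr rfl fun y _ => ?_
  rw [coeff_coe]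
  rfl

lemma coeff_algebraMap_smul (c : k) (w : IntervalModule k h) (x : Vtx d) :
    coeff (algebraMap k (QuotAlg k D) c • w) x = c * coeff w x := by
  classical
  by_cases hx : lo ≤ x ∧ x ≤ hi
  · change coeff (QuotAlg.mk k D (c • unitElt k D) • w) x = _
    rw [coeff_mk_smul _ _ hx, Finset.sum_eq_single x]
    · change c * (idem (p := p) k D.verts D.verts_shift D.verts_finite).1 x x * _ = _
      rw [idem_apply, if_pos ⟨rfl, h.1 x hx.1 hx.2⟩, mul_one]
    · intro y _ hy
      change c * (idem (p := p) k D.verts D.verts_shift D.verts_finite).1 x y * _ = _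
      rw [idem_apply, if_neg (fun h' => hy h'.1.symm), mul_zero, zero_mul]
    · intro hx'; exact (hx' (Finset.mem_Icc.2 hx)).elim
  · rw [coeff_of_notMem _ hx, coeff_of_notMem _ hx, mul_zero]

open Classical in
lemma coeff_ar_smul {u v : Vtx d} (huv : u ≤ v) (w : IntervalModule k h) (x : Vtx d) :
    coeff (ar k D u v • w) x =
      if SameOrbit p x u ∧ lo ≤ x ∧ x ≤ hi then coeff w (x + (v - u)) else 0 := by
  by_cases hx : lo ≤ x ∧ x ≤ hi
  · rw [ar, coeff_mk_smul _ _ hx]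
    simp only [arrow_apply_add, huv, true_and, hx, and_true]
    by_cases hu : SameOrbit p x u
    · simp only [hu, true_and, if_true, ite_mul, one_mul, zero_mul]
      rw [Finset.sum_ite_eq']
      by_cases hm : x + (v - u) ∈ Finset.Icc lo hi
      · rw [if_pos hm]
      · rw [if_neg hm, coeff_of_notMem]; rwa [Finset.mem_Icc] at hm
    · simp [hu]
  · rw [coeff_of_notMem _ hx, if_neg (fun h' => hx h'.2)]

/-- The map that translates and then cuts off, times a scalar. -/
def transfer (h : IsAdmissible D lo hi) (h' : IsAdmissible D lo' hi') (c : k) (m : ℤ)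
    (h1 : shift p m lo ≤ lo') (h2 : shift p m hi ≤ hi') :
    IntervalModule k h →ₗ[QuotAlg k D] IntervalModule k h' :=
  linearMapOfArrows
    (AddMonoidHom.mk' (fun w => ofCoeff h' fun x => c * coeff w (shift p (-m) x)) fun a b => by
      classical
      refine interval_ext fun x _ _ => ?_
      simp only [coeff_add, coeff_ofCoeff]
      split_ifs <;> ring)
    (fun a w => by
      classical
      refine interval_ext fun x _ _ => ?_
      simp only [AddMonoidHom.mk'_apply, coeff_ofCoeff, coeff_algebraMap_smul]
      split_ifs <;> ring)
    (fun u v huv w => by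
      classical
      refine interval_ext fun x hx1 hx2 => ?_
      simp only [AddMonoidHom.mk'_apply, coeff_ofCoeff, coeff_ar_smul huv, hx1, hx2, and_true,
        if_true]
      have e : SameOrbit p (shift p (-m) x) u ↔ SameOrbit p x u :=
        ⟨fun h => SameOrbit.trans (SameOrbit.symm ⟨-m, rfl⟩) h,
          fun h => SameOrbit.trans ⟨-m, rfl⟩ h⟩
      have e' : shift p (-m) (x + (v - u)) = shift p (-m) x + (v - u) := by
        rw [shift_eq_add (-m) x]; simp
      have hle : x ≤ x + (v - u) := by simpa using huv
      rw [e, e']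
      by_cases hu : SameOrbit p x u
      · simp only [hu, true_and, if_true]
        by_cases hy : lo ≤ shift p (-m) x + (v - u) ∧ shift p (-m) x + (v - u) ≤ hi
        · have a1 : lo' ≤ x + (v - u) := hx1.trans hle
          have a2 : x + (v - u) ≤ hi' := by
            refine le_trans ?_ h2
            rw [← shift_le_shift p (-m), shift_shift, e']
            simpa [shift_zero] using hy.2
          have a3 : lo ≤ shift p (-m) x := by
            rw [← shift_le_shift p m, shift_shift]
            simpa [shift_zero] using h1.trans hx1
          have a4 : shift p (-m) x ≤ hi := by
            refine le_trans ?_ hy.2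
            rw [← e', shift_le_shift]
            exact hle
          simp [a1, a2, a3, a4]
        · rw [coeff_of_notMem _ hy]; simp
      · simp [hu])

open Classical in
lemma coeff_transfer (c : k) (m : ℤ) (h1 : shift p m lo ≤ lo') (h2 : shift p m hi ≤ hi')
    (w : IntervalModule k h) (x : Vtx d) :
    coeff (transfer h h' c m h1 h2 w) x =
      if lo' ≤ x ∧ x ≤ hi' then c * coeff w (shift p (-m) x) else 0 :=
  coeff_ofCoeff (h := h') (fun x => c * coeff w (shift p (-m) x)) x

open Classical in
/-- The basis vector at a vertex. -/
def basisVec (h : IsAdmissible D lo hi) (z : Vtx d) : IntervalModule k h :=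
  ofCoeff h fun x => if x = z then 1 else 0

open Classical in
lemma coeff_basisVec {z : Vtx d} (hz : lo ≤ z ∧ z ≤ hi) (x : Vtx d) :
    coeff (basisVec h z : IntervalModule k h) x = if x = z then 1 else 0 := by
  rw [basisVec, coeff_ofCoeff]
  by_cases hx : x = z
  · subst hx; simp [hz]
  · simp [hx]

lemma eq_sum_basisVec (w : IntervalModule k h) :
    w = ∑ y ∈ Finset.Icc lo hi, algebraMap k (QuotAlg k D) (coeff w y) • basisVec h y := by
  classical
  refine interval_ext fun x hx1 hx2 => ?_
  rw [coeff_sum, Finset.sum_eq_single x]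
  · rw [coeff_algebraMap_smul, coeff_basisVec ⟨hx1, hx2⟩, if_pos rfl, mul_one]
  · intro y hy hyx
    rw [coeff_algebraMap_smul, coeff_basisVec (Finset.mem_Icc.1 hy), if_neg hyx.symm, mul_zero]
  · intro hx; exact (hx (Finset.mem_Icc.2 ⟨hx1, hx2⟩)).elim

lemma ar_smul_basisVec {y : Vtx d} (hy : lo ≤ y ∧ y ≤ hi) :
    ar k D y hi • (basisVec h hi : IntervalModule k h) = basisVec h y := by
  classical
  have hlh : lo ≤ hi := hy.1.trans hy.2
  refine interval_ext fun x hx1 hx2 => ?_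
  rw [coeff_ar_smul hy.2, coeff_basisVec ⟨hlh, le_rfl⟩, coeff_basisVec hy]
  have e : x + (hi - y) = hi ↔ x = y := by
    constructor
    · intro h; have := congrArg (· - (hi - y)) h; simpa using this
    · rintro rfl; abel
  simp only [hx1, hx2, and_true, e]
  by_cases hxy : x = y
  · subst hxy; simp [SameOrbit.refl]
  · simp [hxy]

lemma ar_smul_basisVec_eq_zero (hlh : lo ≤ hi) {y : Vtx d} (hyh : y ≤ hi) (hy : ¬ lo ≤ y) :
    ar k D y hi • (basisVec h hi : IntervalModule k h) = 0 := by
  classical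
  refine interval_ext fun x hx1 hx2 => ?_
  rw [coeff_ar_smul hyh, coeff_basisVec ⟨hlh, le_rfl⟩, coeff_zero]
  have e : x + (hi - y) = hi → x = y := by
    intro h; have := congrArg (· - (hi - y)) h; simpa using this
  by_cases hxy : x + (hi - y) = hi
  · exact (hy ((e hxy) ▸ hx1)).elim
  · simp [hxy]

/-- A linear map from an interval module is determined by the image of the top basis vector. -/
lemma interval_hom_ext {X : Type*} [AddCommGroup X] [Module (QuotAlg k D) X]
    {f g : IntervalModule k h →ₗ[QuotAlg k D] X} (hfg : f (basisVec h hi) = g (basisVec h hi)) :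
    f = g := by
  refine LinearMap.ext fun w => ?_
  rw [eq_sum_basisVec w, map_sum, map_sum]
  refine Finset.sum_congr rfl fun y hy => ?_
  rw [map_smul, map_smul, ← ar_smul_basisVec (Finset.mem_Icc.1 hy), map_smul, map_smul, hfg]

/-- The top vector is fixed by the idempotent at `hi`, which acts on the target as the projection to
the orbit of `hi`. -/
lemma coeff_hom_sameOrbit (hlh : lo ≤ hi) (g : IntervalModule k h →ₗ[QuotAlg k D] IntervalModule k h')
    {z : Vtx d} (hz : coeff (g (basisVec h hi)) z ≠ 0) : SameOrbit p z hi := by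
  classical
  rw [← ar_smul_basisVec (k := k) (h := h) ⟨hlh, le_rfl⟩, map_smul, coeff_ar_smul le_rfl] at hz
  by_contra hc
  simp [hc] at hz

/-- Otherwise a non-zero coefficient could be moved down to a vertex of the target interval by an
arrow that already kills the top vector of the source. -/
lemma coeff_hom_lower (hlh : lo ≤ hi) (g : IntervalModule k h →ₗ[QuotAlg k D] IntervalModule k h')
    {m : ℤ} (hz : coeff (g (basisVec h hi)) (shift p m hi) ≠ 0) : shift p m lo ≤ lo' := by
  classical
  by_contra hlo
  obtain ⟨j, hj⟩ : ∃ j, lo' j < shift p m lo j := by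
    simpa [Pi.le_def] using hlo
  have hzm := mem_of_coeff_ne_zero hz
  -- Lowering the coordinate `j` to `lo' j` stays inside the target interval but leaves the
  -- translated source interval.
  let z' : Vtx d := Function.update (shift p m hi) j (lo' j)
  let y : Vtx d := shift p (-m) z'
  have hz'z : z' ≤ shift p m hi := by
    intro i
    by_cases hi : i = j
    · subst hi; simpa [z'] using hzm.1 i
    · simp [z', hi]
  have hlz' : lo' ≤ z' := by
    intro i
    by_cases hi : i = j
    · subst hi; simp [z']
    · simpa [z', hi] using hzm.1 i
  have hyh : y ≤ hi := by
    rw [← shift_le_shift p m]; simpa [y, shift_shift, shift_zero] using hz'z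
  have hy : ¬ lo ≤ y := by
    intro hl
    rw [← shift_le_shift p m] at hl
    have := hl j
    simp only [y, shift_shift, add_neg_cancel, shift_zero] at this
    simp only [z', Function.update_self] at this
    exact absurd this (not_le.2 hj)
  have h0 : ar k D y hi • g (basisVec h hi) = 0 := by
    rw [← map_smul, ar_smul_basisVec_eq_zero hlh hyh hy, map_zero]
  have h1 := congrArg (fun w => coeff w z') h0
  simp only [coeff_ar_smul hyh, coeff_zero] at h1
  have hso : SameOrbit p z' y := ⟨m, by simp [y, shift_shift, shift_zero]⟩
  rw [if_pos ⟨hso, hlz', hz'z.trans hzm.2⟩] at h1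
  refine hz ?_
  rw [← h1]
  congr 1
  have : z' = shift p m y := by simp [y, shift_shift, shift_zero]
  rw [this, ← shift_eq_add]

lemma transfer_basisVec (hlh : lo ≤ hi) (c : k) (m : ℤ) (h1 : shift p m lo ≤ lo')
    (h2 : shift p m hi ≤ hi') (h3 : lo' ≤ shift p m hi) :
    transfer h h' c m h1 h2 (basisVec h hi) =
      algebraMap k (QuotAlg k D) c • basisVec h' (shift p m hi) := by
  classical
  refine interval_ext fun x hx1 hx2 => ?_
  rw [coeff_transfer, coeff_algebraMap_smul, coeff_basisVec ⟨h3, h2⟩,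
    coeff_basisVec ⟨hlh, le_rfl⟩, if_pos ⟨hx1, hx2⟩]
  have : shift p (-m) x = hi ↔ x = shift p m hi := by
    rw [← shift_inj p m, shift_shift]; simp [shift_zero]
  simp only [this]

/-- Every map between interval modules is a sum of transfer maps. -/
lemma hom_mem_of_transfer (hlh : lo ≤ hi)
    (g : IntervalModule k h →ₗ[QuotAlg k D] IntervalModule k h')
    (S : AddSubgroup (IntervalModule k h →ₗ[QuotAlg k D] IntervalModule k h'))
    (hS : ∀ (c : k) (m : ℤ) (h1 : shift p m lo ≤ lo') (h2 : shift p m hi ≤ hi'),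
      lo' ≤ shift p m hi → coeff (g (basisVec h hi)) (shift p m hi) ≠ 0 →
        transfer h h' c m h1 h2 ∈ S) : g ∈ S := by
  classical
  let w := g (basisVec h hi)
  let T := (Finset.Icc lo' hi').filter (fun z => coeff w z ≠ 0)
  have hT : ∀ z ∈ T, ∃ t ∈ S, t (basisVec h hi) =
      algebraMap k (QuotAlg k D) (coeff w z) • basisVec h' z := by
    intro z hz
    obtain ⟨hzI, hz0⟩ := Finset.mem_filter.1 hz
    have hzI := Finset.mem_Icc.1 hzI
    obtain ⟨m, rfl⟩ := coeff_hom_sameOrbit hlh g hz0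
    have h1 := coeff_hom_lower hlh g hz0
    exact ⟨transfer h h' (coeff w (shift p m hi)) m h1 hzI.2, hS _ _ _ _ hzI.1 hz0,
      transfer_basisVec hlh _ _ _ _ hzI.1⟩
  choose! t htS ht using hT
  have : g = ∑ z ∈ T, t z := by
    refine interval_hom_ext ?_
    rw [LinearMap.sum_apply]
    change w = _
    rw [Finset.sum_congr rfl ht, Finset.sum_filter_of_ne]
    · exact eq_sum_basisVec w
    · intro z _ hz hz0
      rw [hz0, map_zero, zero_smul] at hz
      exact hz rfl
  rw [this]
  exact S.sum_mem htS

/-- The map from an interval module to any module given by the image of the top basis vector. -/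
def intervalHom (h : IsAdmissible D lo hi) {X : Type*} [AddCommGroup X] [Module (QuotAlg k D) X]
    (v : X) (hv : ∀ y, y ≤ hi → ¬ lo ≤ y → ar k D y hi • v = 0) :
    IntervalModule k h →ₗ[QuotAlg k D] X :=
  linearMapOfArrows
    (AddMonoidHom.mk' (fun w => ∑ y ∈ Finset.Icc lo hi,
      algebraMap k (QuotAlg k D) (coeff w y) • ar k D y hi • v) fun a b => by
        simp only [coeff_add, map_add, add_smul, Finset.sum_add_distrib])
    (fun c w => by
      simp only [AddMonoidHom.mk'_apply, coeff_algebraMap_smul, Finset.smul_sum, map_mul, mul_smul])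
    (fun u u' huu' w => by
      classical
      simp only [AddMonoidHom.mk'_apply, Finset.smul_sum]
      -- Summands extended by zero to all of `ℤ^d`: the two sides become the same sum up to
      -- reindexing by the displacement `u' - u`.
      let G : Vtx d → X := fun z => if SameOrbit p z u' then
        algebraMap k (QuotAlg k D) (coeff w z) • ar k D (z - (u' - u)) hi • v else 0
      have hG : ∀ z, G z ≠ 0 → (lo ≤ z ∧ z ≤ hi) ∧ lo ≤ z - (u' - u) := by
        intro z hz
        have h1 : coeff w z ≠ 0 := by
          intro h0; apply hz; simp only [G]; rw [h0]; simp
        have h2 := mem_of_coeff_ne_zero h1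
        refine ⟨h2, ?_⟩
        by_contra hc
        apply hz
        simp only [G]
        rw [hv _ (le_trans (by simpa using huu') h2.2) hc]
        simp
      have hl : ∑ y ∈ Finset.Icc lo hi, algebraMap k (QuotAlg k D) (coeff (ar k D u u' • w) y) •
          ar k D y hi • v = ∑ᶠ y, G (y + (u' - u)) := by
        rw [finsum_eq_sum_of_support_subset (s := Finset.Icc lo hi)]
        · refine Finset.sum_congr rfl fun y hy => ?_
          have hy := Finset.mem_Icc.1 hy
          have e : SameOrbit p (y + (u' - u)) u' ↔ SameOrbit p y u := by
            rw [← SameOrbit.add_iff (u' - u) (x := y)]; simp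
          rw [coeff_ar_smul huu']
          simp only [hy, and_true, G, e, add_sub_cancel_right]
          split_ifs <;> simp
        · intro y hy
          obtain ⟨h1, h2⟩ := hG _ hy
          rw [add_sub_cancel_right] at h2
          exact Finset.mem_coe.2 (Finset.mem_Icc.2 ⟨h2, le_trans (by simpa using huu') h1.2⟩)
      have hr : ∑ z ∈ Finset.Icc lo hi, ar k D u u' •
          algebraMap k (QuotAlg k D) (coeff w z) • ar k D z hi • v = ∑ᶠ y, G y := by
        rw [finsum_eq_sum_of_support_subset (s := Finset.Icc lo hi)]
        · refine Finset.sum_congr rfl fun z hz => ?_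
          have hz := Finset.mem_Icc.1 hz
          rw [← mul_smul, ← Algebra.commutes, mul_smul, ← mul_smul (ar k D u u')]
          simp only [G]
          by_cases hzu : SameOrbit p z u'
          · rw [if_pos hzu, ar_mul_ar_of_sameOrbit huu' hz.2 hzu.symm]
          · rw [if_neg hzu, ar_mul_ar_of_not huu' (fun h => hzu h.symm), zero_smul, smul_zero]
        · intro y hy
          exact Finset.mem_coe.2 (Finset.mem_Icc.2 (hG _ hy).1)
      rw [hl, hr]
      exact finsum_comp_equiv (Equiv.addRight (u' - u)) (f := G))

lemma intervalHom_basisVec (hlh : lo ≤ hi) {X : Type*} [AddCommGroup X] [Module (QuotAlg k D) X]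
    (v : X) (hv : ∀ y, y ≤ hi → ¬ lo ≤ y → ar k D y hi • v = 0) :
    intervalHom h v hv (basisVec h hi) = ar k D hi hi • v := by
  classical
  change ∑ y ∈ Finset.Icc lo hi, algebraMap k (QuotAlg k D) (coeff (basisVec h hi) y) •
    ar k D y hi • v = _
  rw [Finset.sum_eq_single hi]
  · rw [coeff_basisVec ⟨hlh, le_rfl⟩, if_pos rfl, map_one, one_smul]
  · intro y _ hy
    rw [coeff_basisVec ⟨hlh, le_rfl⟩, if_neg hy, map_zero, zero_smul]
  · intro hh; exact (hh (Finset.mem_Icc.2 ⟨hlh, le_rfl⟩)).elim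

/-- The map to an interval module given by a linear form. -/
def intervalCohom (h : IsAdmissible D lo hi) {X : Type*} [AddCommGroup X] [Module (QuotAlg k D) X]
    (φ : X →+ k) (hφ : ∀ (c : k) x, φ (algebraMap k (QuotAlg k D) c • x) = c * φ x)
    (hv : ∀ y, lo ≤ y → ¬ y ≤ hi → ar k D lo y = 0) :
    X →ₗ[QuotAlg k D] IntervalModule k h :=
  linearMapOfArrows
    (AddMonoidHom.mk' (fun x => ofCoeff h fun y => φ (ar k D lo y • x)) fun a b => by
      classical
      refine interval_ext fun x _ _ => ?_
      simp only [coeff_add, coeff_ofCoeff, smul_add, map_add]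
      split_ifs <;> simp)
    (fun c x => by
      classical
      refine interval_ext fun y _ _ => ?_
      simp only [AddMonoidHom.mk'_apply, coeff_ofCoeff, coeff_algebraMap_smul]
      rw [← mul_smul, ← Algebra.commutes, mul_smul, hφ]
      split_ifs <;> simp)
    (fun u v huv x => by
      classical
      refine interval_ext fun y hy1 hy2 => ?_
      simp only [AddMonoidHom.mk'_apply, coeff_ofCoeff, coeff_ar_smul huv, hy1, hy2, and_true,
        if_true]
      have hle : lo ≤ y + (v - u) := hy1.trans (by simpa using huv)
      rw [← mul_smul]
      by_cases hu : SameOrbit p y u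
      · rw [if_pos hu]
        obtain ⟨m, rfl⟩ := hu
        rw [← shift_eq_add, ← ar_shift m u v, ar_mul_ar hy1 ((shift_le_shift p m).2 huv)]
        rw [← shift_eq_add] at hle
        -- If the arrow leads out of the interval, the arrow from `lo` to its target is zero by
        -- hypothesis.
        by_cases hc : shift p m v ≤ hi
        · rw [if_pos ⟨hle, hc⟩]
        · rw [if_neg (fun h => hc h.2), hv _ hle hc, zero_smul, map_zero]
      · rw [if_neg hu, ar_mul_ar_of_not hy1 hu, zero_smul, map_zero])

lemma coeff_intervalCohom {X : Type*} [AddCommGroup X] [Module (QuotAlg k D) X]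
    (φ : X →+ k) (hφ : ∀ (c : k) x, φ (algebraMap k (QuotAlg k D) c • x) = c * φ x)
    (hv : ∀ y, lo ≤ y → ¬ y ≤ hi → ar k D lo y = 0) (x : X) {y : Vtx d} (hy : lo ≤ y ∧ y ≤ hi) :
    coeff (intervalCohom h φ hφ hv x) y = φ (ar k D lo y • x) := by
  classical
  exact (coeff_ofCoeff (h := h) (fun y => φ (ar k D lo y • x)) y).trans (if_pos hy)

instance (h : IsAdmissible D lo hi) : Module k (IntervalModule k h) :=
  inferInstanceAs (Module k (Finset.Icc lo hi → k))

instance (h : IsAdmissible D lo hi) : Module.Finite k (IntervalModule k h) :=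
  inferInstanceAs (Module.Finite k (Finset.Icc lo hi → k))

lemma coeff_smul (c : k) (w : IntervalModule k h)
    (x : Vtx d) : coeff (c • w) x = c * coeff w x := by
  by_cases hx : x ∈ Finset.Icc lo hi
  · simp only [coeff, dif_pos hx]; rfl
  · simp [coeff, dif_neg hx]

instance (h : IsAdmissible D lo hi) :
    IsScalarTower k (QuotAlg k D) (IntervalModule k h) :=
  IsScalarTower.of_algebraMap_smul fun c w => interval_ext fun x _ _ => by
    rw [coeff_algebraMap_smul, coeff_smul]

instance (h : IsAdmissible D lo hi) :
    Module.Finite (QuotAlg k D) (IntervalModule k h) :=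
  Module.Finite.of_restrictScalars_finite k _ _

end Intervals

/-! ### Exact sequences, projectivity and rigidity of interval modules -/

section Rigid

variable {k : Type u} [Field k] {d p : ℕ} {D : QuotientData d p}
  {lo hi lo' hi' lo'' hi'' : Vtx d}

/-- Truncating to the middle interval loses nothing: a vertex of the last interval whose translate
lies in the first one has its translate in the middle one too. -/
lemma transfer_comp_transfer {h : IsAdmissible D lo hi} {h' : IsAdmissible D lo' hi'}
    {h'' : IsAdmissible D lo'' hi''} (c c' : k) (m m' : ℤ) (h1 : shift p m lo ≤ lo')
    (h2 : shift p m hi ≤ hi') (h1' : shift p m' lo' ≤ lo'') (h2' : shift p m' hi' ≤ hi'') :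
    (transfer h' h'' c' m' h1' h2').comp (transfer h h' c m h1 h2) =
      transfer h h'' (c' * c) (m' + m)
        (by rw [← shift_shift]; exact ((shift_le_shift p m').2 h1).trans h1')
        (by rw [← shift_shift]; exact ((shift_le_shift p m').2 h2).trans h2') := by
  classical
  refine LinearMap.ext fun w => interval_ext fun x hx1 hx2 => ?_
  simp only [LinearMap.comp_apply, coeff_transfer, hx1, hx2, and_self, if_true, shift_shift]
  rw [neg_add_rev]
  by_cases hw : coeff w (shift p (-m + -m') x) = 0
  · rw [hw]; simp
  · have hm := mem_of_coeff_ne_zero hw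
    rw [if_pos, mul_assoc]
    constructor
    · rw [← shift_le_shift p m', shift_shift]
      simpa [shift_zero] using h1'.trans hx1
    · refine le_trans ?_ h2
      rw [← shift_le_shift p (-m), shift_shift, shift_shift]
      simpa [shift_zero] using hm.2

lemma transfer_congr {h : IsAdmissible D lo hi} {h' : IsAdmissible D lo' hi'}
    {c c' : k} {m m' : ℤ} (hc : c = c') (hm : m = m') (h1 : shift p m lo ≤ lo')
    (h2 : shift p m hi ≤ hi') :
    transfer h h' c m h1 h2 = transfer h h' c' m' (hm ▸ h1) (hm ▸ h2) := by
  subst hc hm; rfl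

lemma transfer_eq_id {h : IsAdmissible D lo hi} {c : k} {m : ℤ} (hc : c = 1) (hm : m = 0)
    (h1 : shift p m lo ≤ lo) (h2 : shift p m hi ≤ hi) :
    transfer h h c m h1 h2 = LinearMap.id := by
  classical
  subst hc hm
  refine LinearMap.ext fun w => interval_ext fun x hx1 hx2 => ?_
  rw [coeff_transfer, if_pos ⟨hx1, hx2⟩, one_mul, neg_zero, shift_zero, LinearMap.id_apply]

lemma IsAdmissible.mono (h : IsAdmissible D lo hi) (h1 : lo ≤ lo') (h2 : hi' ≤ hi) :
    IsAdmissible D lo' hi' :=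
  ⟨fun z a b => h.1 z (h1.trans a) (b.trans h2),
    fun u v huv a b c => h.2 u v huv (h1.trans a) b (c.trans h2)⟩

lemma zero_shift_le {x y : Vtx d} (h : x ≤ y) : shift p 0 x ≤ y := by rwa [shift_zero]

/-- The canonical map between interval modules. -/
def canMap (h : IsAdmissible D lo hi) (h' : IsAdmissible D lo' hi') (h1 : lo ≤ lo')
    (h2 : hi ≤ hi') : IntervalModule k h →ₗ[QuotAlg k D] IntervalModule k h' :=
  transfer h h' 1 0 (zero_shift_le h1) (zero_shift_le h2)

open Classical in
lemma coeff_canMap {h : IsAdmissible D lo hi} {h' : IsAdmissible D lo' hi'} (h1 : lo ≤ lo')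
    (h2 : hi ≤ hi') (w : IntervalModule k h) (x : Vtx d) :
    coeff (canMap h h' h1 h2 w) x = if lo' ≤ x ∧ x ≤ hi' then coeff w x else 0 := by
  rw [canMap, coeff_transfer, one_mul, neg_zero, shift_zero]

lemma canMap_comp_canMap {h : IsAdmissible D lo hi} {h' : IsAdmissible D lo' hi'}
    {h'' : IsAdmissible D lo'' hi''} (h1 : lo ≤ lo') (h2 : hi ≤ hi') (h1' : lo' ≤ lo'')
    (h2' : hi' ≤ hi'') :
    (canMap h' h'' h1' h2').comp (canMap h h' h1 h2) =
      (canMap h h'' (h1.trans h1') (h2.trans h2') : _ →ₗ[QuotAlg k D] IntervalModule k h'') := by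
  rw [canMap, canMap, transfer_comp_transfer]
  exact transfer_congr (mul_one 1) (add_zero 0) _ _

/-- Cutting an interval into a lower and an upper part. -/
lemma shortExact_interval (h : IsAdmissible D lo hi) (h₁ : IsAdmissible D lo hi')
    (h₃ : IsAdmissible D lo' hi) (hl : lo ≤ lo') (hh : hi' ≤ hi)
    (hcut : ∀ x, lo ≤ x → x ≤ hi → (x ≤ hi' ↔ ¬ lo' ≤ x)) :
    ∃ w, (ShortComplex.mk (X₁ := ModuleCat.of (QuotAlg k D) (IntervalModule k h₁))
      (X₂ := ModuleCat.of (QuotAlg k D) (IntervalModule k h))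
      (X₃ := ModuleCat.of (QuotAlg k D) (IntervalModule k h₃))
      (ModuleCat.ofHom (canMap h₁ h le_rfl hh)) (ModuleCat.ofHom (canMap h h₃ hl le_rfl))
      w).ShortExact := by
  classical
  refine ⟨?_, ?_⟩
  · refine ModuleCat.hom_ext (LinearMap.ext fun (w : IntervalModule k h₁) => ?_)
    refine interval_ext (h := h₃) fun x hx1 hx2 => ?_
    change coeff (canMap h h₃ hl le_rfl (canMap h₁ h le_rfl hh w)) x =
      coeff (0 : IntervalModule k h₃) x
    rw [coeff_canMap, coeff_canMap, coeff_zero, if_pos ⟨hx1, hx2⟩, if_pos ⟨hl.trans hx1, hx2⟩]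
    exact coeff_of_notMem _ fun h' => (hcut x (hl.trans hx1) hx2).1 h'.2 hx1
  · refine { exact := ?_, mono_f := ?_, epi_g := ?_ }
    · rw [ShortComplex.moduleCat_exact_iff]
      intro (w : IntervalModule k h) (hw : canMap h h₃ hl le_rfl w = 0)
      refine ⟨(ofCoeff h₁ (coeff w) : IntervalModule k h₁), ?_⟩
      change canMap h₁ h le_rfl hh (ofCoeff h₁ (coeff w)) = w
      refine interval_ext fun x hx1 hx2 => ?_
      rw [coeff_canMap, coeff_ofCoeff, if_pos ⟨hx1, hx2⟩]
      by_cases hx : x ≤ hi'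
      · rw [if_pos ⟨hx1, hx⟩]
      · rw [if_neg (fun h' => hx h'.2)]
        have h2 : lo' ≤ x := by
          by_contra h3; exact hx ((hcut x hx1 hx2).2 h3)
        have := congrArg (fun w => coeff w x) hw
        simp only [coeff_canMap, coeff_zero] at this
        rw [if_pos ⟨h2, hx2⟩] at this
        exact this.symm
    · rw [ModuleCat.mono_iff_injective]
      intro (w : IntervalModule k h₁) (w' : IntervalModule k h₁)
        (hw : canMap h₁ h le_rfl hh w = canMap h₁ h le_rfl hh w')
      refine interval_ext fun x hx1 hx2 => ?_
      have := congrArg (fun w => coeff w x) hw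
      simpa only [coeff_canMap, if_pos (show lo ≤ x ∧ x ≤ hi from ⟨hx1, hx2.trans hh⟩)] using this
    · rw [ModuleCat.epi_iff_surjective]
      intro (w : IntervalModule k h₃)
      refine ⟨(ofCoeff h (coeff w) : IntervalModule k h), ?_⟩
      change canMap h h₃ hl le_rfl (ofCoeff h (coeff w)) = w
      refine interval_ext fun x hx1 hx2 => ?_
      rw [coeff_canMap, coeff_ofCoeff, if_pos ⟨hx1, hx2⟩, if_pos ⟨hl.trans hx1, hx2⟩]

/-- By `h0` no arrow into `hi` from outside the interval survives. Any preimage of the image of the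
generator therefore defines a lift. -/
lemma projective_interval (h : IsAdmissible D lo hi) (hlh : lo ≤ hi)
    (h0 : ∀ y, y ≤ hi → ¬ lo ≤ y → ar k D y hi = 0) :
    Projective (ModuleCat.of (QuotAlg k D) (IntervalModule k h)) := by
  refine ⟨fun {E X} f e he => ?_⟩
  obtain ⟨v, hv⟩ := (ModuleCat.epi_iff_surjective e).1 he (f.hom (basisVec h hi))
  have hv0 : ∀ y, y ≤ hi → ¬ lo ≤ y → ar k D y hi • v = 0 :=
    fun y h1 h2 => by rw [h0 y h1 h2, zero_smul]
  refine ⟨ModuleCat.ofHom (intervalHom h v hv0), ?_⟩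
  refine ModuleCat.hom_ext (interval_hom_ext ?_)
  change e.hom (intervalHom h v hv0 (basisVec h hi)) = f.hom (basisVec h hi)
  rw [intervalHom_basisVec hlh, map_smul, show e.hom v = _ from hv, ← map_smul,
    ar_smul_basisVec ⟨hlh, le_rfl⟩]

section Ext

variable {Λ : Type u} [Ring Λ] {S : ShortComplex (ModuleCat.{u} Λ)}

/-- Since `S.X₂` is projective, every class comes from a map `S.X₁ ⟶ Y` by the connecting
homomorphism, which kills the maps that extend to `S.X₂`. -/
lemma ext_one_subsingleton_of_extension (hS : S.ShortExact) (hP : Projective S.X₂)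
    {Y : ModuleCat.{u} Λ} (h : ∀ φ : S.X₁ ⟶ Y, ∃ ψ : S.X₂ ⟶ Y, S.f ≫ ψ = φ) :
    Subsingleton (Ext S.X₃ Y 1) := by
  refine subsingleton_of_forall_eq 0 fun x => ?_
  obtain ⟨y, hy⟩ := Ext.contravariant_sequence_exact₃ hS Y x
    (Ext.eq_zero_of_hasProjectiveDimensionLT _ 1 le_rfl) (add_zero 1)
  obtain ⟨φ, rfl⟩ := Ext.homEquiv₀.symm.surjective y
  obtain ⟨ψ, rfl⟩ := h φ
  rw [← hy]
  change hS.extClass.comp (Ext.mk₀ (S.f ≫ ψ)) _ = 0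
  rw [← Ext.mk₀_comp_mk₀, hS.extClass_comp_assoc]

lemma ext_succ_subsingleton (hS : S.ShortExact) (hP : Projective S.X₂)
    {Y : ModuleCat.{u} Λ} (n : ℕ) (h : Subsingleton (Ext S.X₁ Y n)) :
    Subsingleton (Ext S.X₃ Y (n + 1)) := by
  refine subsingleton_of_forall_eq 0 fun x => ?_
  obtain ⟨y, hy⟩ := Ext.contravariant_sequence_exact₃ hS Y x
    (Ext.eq_zero_of_hasProjectiveDimensionLT _ 1 (by omega)) (add_comm 1 n)
  rw [← hy, h.elim y 0, Ext.comp_zero]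

end Ext

/-! ### Common axioms for the algebras of both types -/

/-- The non-increasing sequences whose last entry is bounded below by `L` of the first one. -/
def osL (L : ℤ → ℤ) (e : ℕ) [NeZero e] : Set (Vtx e) :=
  {μ | Antitone μ ∧ L (μ 0) ≤ μ (lastIdx e)}

/-- The common features of the higher Nakayama algebras of both types: `L j` is the least index
of a composition factor of the indecomposable projective module of index `j`. -/
structure IsNakayama (k : Type u) [Field k] [NeZero d] (D : QuotientData d p) (L : ℤ → ℤ) :
    Prop where
  mono : Monotone L
  period : ∀ m j : ℤ, L (j + m * p) = L j + m * p
  bdd : ∃ B : ℤ, ∀ j, j - B ≤ L j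
  fin : ∃ F : Finset ℤ, ∀ j, L j ≤ j → ∃ m : ℤ, j + m * p ∈ F
  verts : D.verts = osL L d
  adm : ∀ lam ∈ osL L (d + 1), IsAdmissible D (lower lam) (upper lam)
  interlaced : ∀ u v : Vtx d, u ∈ D.verts → v ∈ D.verts → u ≤ v → ar k D u v ≠ 0 →
    (∀ i j : Fin d, (j : ℕ) = i + 1 → v j ≤ u i) ∧ L (v 0) ≤ u (lastIdx d)

variable {L : ℤ → ℤ}

lemma lastIdx_succ (e : ℕ) : lastIdx (e + 1) = Fin.last e := Fin.rev_zero e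

lemma val_lastIdx (e : ℕ) [NeZero e] : ((lastIdx e : Fin e) : ℕ) + 1 = e := by
  have := NeZero.pos e
  simp [Fin.val_rev]
  omega

lemma lower_le_upper {lam : Vtx (d + 1)} (h : lam ∈ osL L (d + 1)) : lower lam ≤ upper lam :=
  fun _ => h.1 (Fin.castSucc_lt_succ).le

/-! ### Explicit projective resolutions of interval modules -/

section Resolution

variable (L) in
/-- The entries of a sequence `λ`, followed by `L λ₀ + 1`. -/
def extSeq (lam : Vtx (d + 1)) (i : ℕ) : ℤ :=
  if h : i < d + 1 then lam ⟨i, h⟩ else L (lam 0) + 1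

/-- The strict inequality is exactly what allows the extra entry `L (lam 0) + 1` at the end; without
it the interval module is projective. -/
lemma extSeq_antitone {lam : Vtx (d + 1)} (h : lam ∈ osL L (d + 1))
    (hlast : L (lam 0) < lam (Fin.last d)) : Antitone (extSeq L lam) := by
  refine antitone_nat_of_succ_le fun i => ?_
  unfold extSeq
  by_cases h1 : i + 1 < d + 1
  · rw [dif_pos h1, dif_pos (by omega)]
    exact h.1 (by rw [Fin.le_def]; simp)
  · rw [dif_neg h1]
    by_cases h2 : i < d + 1
    · rw [dif_pos h2]
      have : (⟨i, h2⟩ : Fin (d + 1)) = Fin.last d := by ext; simp; omega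
      rw [this]; omega
    · rw [dif_neg h2]

/-- The lower end of the `j`-th syzygy of an interval module. -/
def syzLo (a : ℕ → ℤ) (j : ℕ) : Vtx d := fun i =>
  if (i : ℕ) + j < d then a (i + 1) else a (i + 2) - 1

/-- The upper end of the `j`-th syzygy of an interval module. -/
def syzHi (a : ℕ → ℤ) (j : ℕ) : Vtx d := fun i =>
  if (i : ℕ) + j < d then a i else a (i + 1) - 1

variable {a : ℕ → ℤ}

lemma syzLo_succ_le (ha : Antitone a) (j : ℕ) : (syzLo a (j + 1) : Vtx d) ≤ syzLo a j := by
  intro i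
  have := ha (show (i : ℕ) + 1 ≤ i + 2 by omega)
  simp only [syzLo]
  split_ifs <;> omega

lemma syzHi_succ_le (ha : Antitone a) (j : ℕ) : (syzHi a (j + 1) : Vtx d) ≤ syzHi a j := by
  intro i
  have := ha (show (i : ℕ) ≤ i + 1 by omega)
  simp only [syzHi]
  split_ifs <;> omega

lemma syzLo_le_syzHi (ha : Antitone a) (j : ℕ) : (syzLo a j : Vtx d) ≤ syzHi a j := by
  intro i
  have := ha (show (i : ℕ) ≤ i + 1 by omega)
  have := ha (show (i : ℕ) + 1 ≤ i + 2 by omega)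
  simp only [syzLo, syzHi]
  split_ifs <;> omega

/-- Consecutive syzygies differ only in the coordinate `d - 1 - j`. There the cover is cut between
the values `a (c + 1) - 1` and `a (c + 1)`. -/
lemma syz_cut {j : ℕ} (hj : j < d) {x : Vtx d} (hx1 : syzLo a (j + 1) ≤ x) (hx2 : x ≤ syzHi a j) :
    x ≤ syzHi a (j + 1) ↔ ¬ syzLo a j ≤ x := by
  have key : ∀ i : Fin d, (i : ℕ) + j + 1 ≠ d →
      (syzLo a j : Vtx d) i = syzLo a (j + 1) i ∧ (syzHi a j : Vtx d) i = syzHi a (j + 1) i := by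
    intro i hi
    simp only [syzLo, syzHi]
    constructor <;> split_ifs <;> omega
  let c : Fin d := ⟨d - 1 - j, by omega⟩
  have hc : (c : ℕ) = d - 1 - j := rfl
  have e1 : (syzHi a (j + 1) : Vtx d) c = a (c + 1) - 1 := by
    simp only [syzHi]; rw [if_neg (by omega)]
  have e2 : (syzLo a j : Vtx d) c = a (c + 1) := by
    simp only [syzLo]; rw [if_pos (by omega)]
  constructor
  · intro h1 h2
    have h1 := (h1 c).trans_eq e1
    have h2 := e2.symm.trans_le (h2 c)
    linarith
  · intro h i
    by_cases hi : (i : ℕ) + j + 1 = d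
    · have hic : i = c := by ext; omega
      rw [hic, e1]
      by_contra hlt
      refine h fun i' => ?_
      by_cases hi' : (i' : ℕ) + j + 1 = d
      · have hic : i' = c := by ext; omega
        rw [hic, e2]; exact (Int.sub_one_lt_iff.1 (not_le.1 hlt))
      · rw [(key i' hi').1]; exact hx1 i'
    · rw [← (key i hi).2]; exact hx2 i

end Resolution

lemma extSeq_of_lt {lam : Vtx (d + 1)} {i : ℕ} (hi : i < d + 1) :
    extSeq L lam i = lam ⟨i, hi⟩ := dif_pos hi

lemma extSeq_last (lam : Vtx (d + 1)) : extSeq L lam (d + 1) = L (lam 0) + 1 := dif_neg (by omega)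

lemma syzLo_zero (lam : Vtx (d + 1)) : (syzLo (extSeq L lam) 0 : Vtx d) = lower lam := by
  funext i
  simp only [syzLo]
  rw [if_pos (by omega), extSeq_of_lt (by omega)]
  rfl

lemma syzHi_zero (lam : Vtx (d + 1)) : (syzHi (extSeq L lam) 0 : Vtx d) = upper lam := by
  funext i
  simp only [syzHi]
  rw [if_pos (by omega), extSeq_of_lt (by omega)]
  rfl

/-- Each cover is interlaced with equality, which serves both for its admissibility and for its
projectivity. -/
lemma syzHi_succ_apply (a : ℕ → ℤ) (j : ℕ) {i i' : Fin d} (h : (i' : ℕ) = i + 1) :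
    (syzHi a j : Vtx d) i' = syzLo a (j + 1) i := by
  simp only [syzHi, syzLo]
  rw [h]
  split_ifs <;> first | omega | rfl

variable [NeZero d]

/-- The interval module of a sequence. -/
abbrev IsNakayama.Mod (H : IsNakayama k D L) (lam : osL L (d + 1)) : Type u :=
  IntervalModule k (H.adm lam.1 lam.2)

/-- The interval lies inside that of the sequence formed by `hi` and the last entry of `lo`. -/
lemma IsNakayama.admissible (H : IsNakayama k D L)
    (hlace : ∀ i j : Fin d, (j : ℕ) = i + 1 → hi j ≤ lo i) (hlast : L (hi 0) ≤ lo (lastIdx d))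
    (hlh : lo ≤ hi) : IsAdmissible D lo hi := by
  let lam : Vtx (d + 1) := Fin.snoc (α := fun _ => ℤ) hi (lo (lastIdx d))
  have hup : upper lam = hi := by funext i; simp [upper, lam]
  have hlast' : lam (Fin.last d) = lo (lastIdx d) := by simp [lam]
  have hlo : lower lam ≤ lo := by
    intro i
    by_cases hi' : (i : ℕ) + 1 < d
    · have : i.succ = (⟨i + 1, hi'⟩ : Fin d).castSucc := rfl
      simp only [lower, this, lam, Fin.snoc_castSucc]
      exact hlace i _ rfl
    · have hil : i = lastIdx d := by
        ext; have := val_lastIdx d; omega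
      have : i.succ = Fin.last d := by
        ext; simp; omega
      change lam i.succ ≤ lo i
      rw [this, hlast', hil]
  refine (H.adm lam ⟨?_, ?_⟩).mono hlo hup.ge
  · rw [Fin.antitone_iff_succ_le]
    intro i
    exact (hlo i).trans ((hlh i).trans (by simp [lam]))
  · rw [lastIdx_succ, hlast', ← upper_zero lam, hup]
    exact hlast

/-- A surviving arrow is interlaced, and interlacing already forces `lo ≤ y` when `lo` is as low as
the bounds given by `hi` allow. -/
lemma IsNakayama.ar_eq_zero_lower (H : IsNakayama k D L)
    (hlace : ∀ i j : Fin d, (j : ℕ) = i + 1 → lo i ≤ hi j) (hlast : lo (lastIdx d) ≤ L (hi 0))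
    {y : Vtx d} (hyh : y ≤ hi) (hy : ¬ lo ≤ y) : ar k D y hi = 0 := by
  by_contra h0
  have hyv : y ∈ D.verts := by
    by_contra h1; exact h0 (ar_eq_zero_of_notMem_left hyh h1)
  have hhv : hi ∈ D.verts := by
    by_contra h1; exact h0 (ar_eq_zero_of_notMem_right hyh h1)
  obtain ⟨h1, h2⟩ := H.interlaced y hi hyv hhv hyh h0
  refine hy fun i => ?_
  by_cases hi' : (i : ℕ) + 1 < d
  · exact (hlace i ⟨i + 1, hi'⟩ rfl).trans (h1 i _ rfl)
  · have hil : i = lastIdx d := by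
      ext; have := val_lastIdx d; omega
    rw [hil]; exact hlast.trans h2

lemma syzHi_zero_apply {lam : Vtx (d + 1)} {j : ℕ} (hj : j < d) :
    (syzHi (extSeq L lam) j : Vtx d) 0 = lam 0 := by
  simp only [syzHi]
  rw [if_pos (by simpa using hj), extSeq_of_lt (by simp)]
  congr 1

/-- The `+ 1` in the final entry of `extSeq` cancels the `- 1` in `syzLo`, so the cover ends exactly
at the bound required for projectivity. -/
lemma syzLo_lastIdx {lam : Vtx (d + 1)} (j : ℕ) :
    (syzLo (extSeq L lam) (j + 1) : Vtx d) (lastIdx d) = L (lam 0) := by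
  have := val_lastIdx d
  simp only [syzLo]
  rw [if_neg (by omega), show ((lastIdx d : Fin d) : ℕ) + 2 = d + 1 by omega, extSeq_last]
  ring

lemma IsNakayama.admissible_cover (H : IsNakayama k D L) {lam : Vtx (d + 1)}
    (hlam : lam ∈ osL L (d + 1)) (hlast : L (lam 0) < lam (Fin.last d)) {j : ℕ} (hj : j < d) :
    IsAdmissible D (syzLo (extSeq L lam) (j + 1)) (syzHi (extSeq L lam) j) := by
  have ha := extSeq_antitone hlam hlast
  refine H.admissible (fun i i' hii => (syzHi_succ_apply _ j hii).le) ?_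
    ((syzLo_succ_le ha j).trans (syzLo_le_syzHi ha j))
  rw [syzHi_zero_apply hj, syzLo_lastIdx]

lemma IsNakayama.admissible_syz (H : IsNakayama k D L) {lam : Vtx (d + 1)}
    (hlam : lam ∈ osL L (d + 1)) (hlast : L (lam 0) < lam (Fin.last d)) {j : ℕ} (hj : j ≤ d) :
    IsAdmissible D (syzLo (extSeq L lam) j) (syzHi (extSeq L lam) j) := by
  have ha := extSeq_antitone hlam hlast
  cases j with
  | zero =>
    exact (H.admissible_cover hlam hlast (NeZero.pos d)).mono (syzLo_succ_le ha 0) le_rfl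
  | succ j => exact (H.admissible_cover hlam hlast hj).mono le_rfl (syzHi_succ_le ha j)

lemma IsNakayama.projective_cover (H : IsNakayama k D L) {lam : Vtx (d + 1)}
    (hlam : lam ∈ osL L (d + 1)) (hlast : L (lam 0) < lam (Fin.last d)) {j : ℕ} (hj : j < d) :
    Projective (ModuleCat.of (QuotAlg k D)
      (IntervalModule k (H.admissible_cover hlam hlast hj))) := by
  have ha := extSeq_antitone hlam hlast
  refine projective_interval _ ((syzLo_succ_le ha j).trans (syzLo_le_syzHi ha j)) fun y h1 h2 =>
    H.ar_eq_zero_lower (fun i i' hii => (syzHi_succ_apply _ j hii).ge) ?_ h1 h2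
  rw [syzHi_zero_apply hj, syzLo_lastIdx]

/-- It suffices to extend a transfer map, that is, to keep the translated upper end of the cover
below `upper mu`. -/
lemma IsNakayama.exists_extension (H : IsNakayama k D L) {lam : Vtx (d + 1)}
    (hlam : lam ∈ osL L (d + 1)) (hlast : L (lam 0) < lam (Fin.last d))
    {mu : Vtx (d + 1)} (hmu : mu ∈ osL L (d + 1)) {j : ℕ}
    (hj : j + 1 < d)
    (φ : IntervalModule k (H.admissible_syz hlam hlast hj.le) →ₗ[QuotAlg k D]
      IntervalModule k (H.adm mu hmu)) :
    ∃ ψ : IntervalModule k (H.admissible_cover hlam hlast (Nat.lt_of_succ_lt hj)) →ₗ[QuotAlg k D]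
      IntervalModule k (H.adm mu hmu),
      ψ.comp (canMap _ _ le_rfl (syzHi_succ_le (extSeq_antitone hlam hlast) j)) = φ := by
  have ha := extSeq_antitone hlam hlast
  let S : AddSubgroup (IntervalModule k (H.admissible_syz hlam hlast hj.le) →ₗ[QuotAlg k D]
      IntervalModule k (H.adm mu hmu)) :=
    { carrier := {φ | ∃ ψ : IntervalModule k
        (H.admissible_cover hlam hlast (Nat.lt_of_succ_lt hj)) →ₗ[QuotAlg k D]
        IntervalModule k (H.adm mu hmu),
        ψ.comp (canMap _ _ le_rfl (syzHi_succ_le (extSeq_antitone hlam hlast) j)) = φ}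
      zero_mem' := ⟨0, LinearMap.zero_comp _⟩
      add_mem' := by
        rintro _ _ ⟨ψ, rfl⟩ ⟨ψ', rfl⟩
        exact ⟨ψ + ψ', LinearMap.add_comp _ _ _⟩
      neg_mem' := by
        rintro _ ⟨ψ, rfl⟩
        exact ⟨-ψ, LinearMap.neg_comp _ _⟩ }
  refine hom_mem_of_transfer (syzLo_le_syzHi ha _) φ S fun c m h1 h2 _ _ => ?_
  have h2' : shift p m (syzHi (extSeq L lam) j) ≤ upper mu := by
    intro i
    by_cases hi : (i : ℕ) + j + 1 = d
    · have h3 := h1 ⟨i - 1, by omega⟩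
      simp only [shift, syzLo, syzHi, lower, upper] at h3 ⊢
      rw [if_pos (by omega)] at h3
      rw [if_pos (by omega)]
      have e : (i : ℕ) - 1 + 1 = i := by omega
      rw [e] at h3
      have e' : (Fin.succ ⟨(i : ℕ) - 1, by omega⟩ : Fin (d + 1)) = i.castSucc := by
        ext; simp; omega
      rwa [e'] at h3
    · have h3 := h2 i
      simp only [shift, syzHi] at h3 ⊢
      split_ifs at h3 ⊢ <;> omega
  refine ⟨transfer _ _ c m h1 h2', ?_⟩
  rw [canMap, transfer_comp_transfer]
  exact transfer_congr (mul_one c) (add_zero m) _ _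

/-- Dimension shifting trades one degree of Ext for one syzygy until degree one, where all maps
extend to the cover. -/
lemma IsNakayama.ext_syz_subsingleton (H : IsNakayama k D L) {lam : Vtx (d + 1)}
    (hlam : lam ∈ osL L (d + 1)) (hlast : L (lam 0) < lam (Fin.last d))
    {mu : Vtx (d + 1)} (hmu : mu ∈ osL L (d + 1)) (i j : ℕ)
    (hij : i + 1 + j < d) :
    Subsingleton (Ext (ModuleCat.of (QuotAlg k D)
      (IntervalModule k (H.admissible_syz hlam hlast (j := j) (by omega))))
      (ModuleCat.of (QuotAlg k D) (IntervalModule k (H.adm mu hmu))) (i + 1)) := by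
  have ha := extSeq_antitone hlam hlast
  have hjd : j < d := by omega
  obtain ⟨w, hS⟩ := shortExact_interval (k := k) (H.admissible_cover hlam hlast hjd)
    (H.admissible_syz hlam hlast (Nat.succ_le_of_lt hjd)) (H.admissible_syz hlam hlast hjd.le)
    (syzLo_succ_le ha j) (syzHi_succ_le ha j) (fun x h1 h2 => syz_cut hjd h1 h2)
  induction i generalizing j with
  | zero =>
    refine ext_one_subsingleton_of_extension hS (H.projective_cover hlam hlast hjd) fun φ => ?_
    obtain ⟨ψ, hψ⟩ := H.exists_extension hlam hlast hmu (j := j) (by omega) φ.hom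
    exact ⟨ModuleCat.ofHom ψ, ModuleCat.hom_ext hψ⟩
  | succ i ih =>
    have hjd' : j + 1 < d := by omega
    obtain ⟨w', hS'⟩ := shortExact_interval (k := k) (H.admissible_cover hlam hlast hjd')
      (H.admissible_syz hlam hlast (Nat.succ_le_of_lt hjd')) (H.admissible_syz hlam hlast hjd'.le)
      (syzLo_succ_le ha _) (syzHi_succ_le ha _) (fun x h1 h2 => syz_cut hjd' h1 h2)
    exact ext_succ_subsingleton hS (H.projective_cover hlam hlast hjd) (i + 1)
      (ih (j + 1) (by omega) hjd' w' hS')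

/-- The interval modules are rigid. -/
theorem IsNakayama.ext_subsingleton (H : IsNakayama k D L) (lam mu : osL L (d + 1)) (i : ℕ)
    (h1 : 1 ≤ i) (hi : i < d) :
    Subsingleton (Ext (ModuleCat.of (QuotAlg k D) (H.Mod lam))
      (ModuleCat.of (QuotAlg k D) (H.Mod mu)) i) := by
  obtain ⟨lam, hlam⟩ := lam
  obtain ⟨mu, hmu⟩ := mu
  obtain ⟨i, rfl⟩ : ∃ i', i = i' + 1 := ⟨i - 1, by omega⟩
  by_cases hlast : L (lam 0) < lam (Fin.last d)
  · have := H.ext_syz_subsingleton hlam hlast hmu i 0 (by omega)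
    have key : ∀ (lo hi : Vtx d) (h : IsAdmissible D lo hi), lo = lower lam → hi = upper lam →
        Subsingleton (Ext (ModuleCat.of (QuotAlg k D) (IntervalModule k h))
          (ModuleCat.of (QuotAlg k D) (IntervalModule k (H.adm mu hmu))) (i + 1)) →
        Subsingleton (Ext (ModuleCat.of (QuotAlg k D) (IntervalModule k (H.adm lam hlam)))
          (ModuleCat.of (QuotAlg k D) (IntervalModule k (H.adm mu hmu))) (i + 1)) := by
      rintro _ _ h rfl rfl hs
      exact hs
    exact key _ _ _ (syzLo_zero lam) (syzHi_zero lam) this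
  -- The last entry now equals `L (lam 0)`, so the module is projective.
  · have hP : Projective (ModuleCat.of (QuotAlg k D) (IntervalModule k (H.adm lam hlam))) := by
      refine projective_interval _ (lower_le_upper hlam) fun y h1 h2 =>
        H.ar_eq_zero_lower (fun i i' hii => ?_) ?_ h1 h2
      · refine le_of_eq (congrArg lam ?_)
        ext; simp [hii]
      · rw [lower_last, lastIdx_succ, upper_zero]; exact not_lt.1 hlast
    exact HasProjectiveDimensionLT.subsingleton _ 1 (i + 1) (by omega) _

end Rigid

section Total

variable {k : Type u} [Field k] {d p : ℕ} [NeZero d] {D : QuotientData d p} {L : ℤ → ℤ}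

/-! ### Finiteness -/

lemma IsNakayama.shift_mem {e : ℕ} [NeZero e] (H : IsNakayama k D L) {μ : Vtx e}
    (h : μ ∈ osL L e) (m : ℤ) : shift p m μ ∈ osL L e := by
  refine ⟨fun i j hij => ?_, ?_⟩
  · have := h.1 hij
    simp only [shift]; linarith
  · have := h.2
    simp only [shift, H.period]; linarith

/-- A translation brings the first entry into a finite set; `bdd` then confines the other entries to
a box. -/
lemma IsNakayama.exists_finset (H : IsNakayama k D L) (e : ℕ) [NeZero e] :
    ∃ F : Finset (Vtx e), ∀ μ ∈ osL L e, ∃ m, shift p m μ ∈ F := by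
  classical
  obtain ⟨B, hB⟩ := H.bdd
  obtain ⟨F, hF⟩ := H.fin
  refine ⟨F.biUnion fun j => Finset.Icc (fun _ => j - B) (fun _ => j), fun μ hμ => ?_⟩
  have h0 : μ (lastIdx e) ≤ μ 0 := last_le_of_os hμ.1 0
  obtain ⟨m, hm⟩ := hF (μ 0) (hμ.2.trans h0)
  refine ⟨m, Finset.mem_biUnion.2 ⟨_, hm, Finset.mem_Icc.2 ⟨fun i => ?_, fun i => ?_⟩⟩⟩
  · have h1 := last_le_of_os hμ.1 i
    have h2 := hB (μ 0)
    have h3 := hμ.2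
    simp only [shift]; linarith
  · have h1 := le_zero_of_os hμ.1 i
    simp only [shift]; linarith

/-- The arrows that are not killed have bounded targets. -/
lemma IsNakayama.exists_upper_bound (H : IsNakayama k D L) (u : Vtx d) :
    ∃ w : Vtx d, ∀ v, u ≤ v → ar k D u v ≠ 0 → v ≤ w := by
  obtain ⟨B, hB⟩ := H.bdd
  refine ⟨fun _ => u (lastIdx d) + B, fun v huv hv i => ?_⟩
  have hu : u ∈ D.verts := by
    by_contra h1; exact hv (ar_eq_zero_of_notMem_left huv h1)
  have hv' : v ∈ D.verts := by
    by_contra h1; exact hv (ar_eq_zero_of_notMem_right huv h1)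
  obtain ⟨-, h2⟩ := H.interlaced u v hu hv' huv hv
  rw [H.verts] at hv'
  have h3 := le_zero_of_os hv'.1 i
  have h4 := hB (v 0)
  simp only
  linarith

/-- Up to translation a surviving arrow starts at one of finitely many vertices, and its target is
bounded by interlacing. -/
lemma IsNakayama.finite_quotAlg (H : IsNakayama k D L) : Module.Finite k (QuotAlg k D) := by
  classical
  obtain ⟨F, hF⟩ := H.exists_finset d
  choose w hw using H.exists_upper_bound
  let T : Finset (QuotAlg k D) := F.biUnion fun u => (Finset.Icc u (w u)).image (ar k D u)
  refine ⟨⟨T, eq_top_iff.2 fun a _ => ?_⟩⟩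
  induction a using quotAlg_induction with
  | h0 => exact Submodule.zero_mem _
  | hadd a b iha ihb => exact Submodule.add_mem _ (iha trivial) (ihb trivial)
  | harrow c u v huv =>
    rw [← Algebra.smul_def]
    refine Submodule.smul_mem _ _ ?_
    by_cases h0 : ar k D u v = 0
    · rw [h0]; exact Submodule.zero_mem _
    have hu : u ∈ D.verts := by
      by_contra h1; exact h0 (ar_eq_zero_of_notMem_left huv h1)
    rw [H.verts] at hu
    obtain ⟨m, hm⟩ := hF u hu
    have huv' := (shift_le_shift p m).2 huv
    rw [← ar_shift m] at h0 ⊢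
    exact Submodule.subset_span (Finset.mem_coe.2 (Finset.mem_biUnion.2 ⟨_, hm,
      Finset.mem_image.2 ⟨_, Finset.mem_Icc.2 ⟨huv', hw _ _ huv' h0⟩, rfl⟩⟩))

/-! ### The sum of the interval modules -/

variable (p L) in
/-- Sequences in the same orbit of translations. -/
def orbitSetoid (e : ℕ) [NeZero e] : Setoid (osL L e) where
  r μ ν := SameOrbit p μ.1 ν.1
  iseqv := ⟨fun _ => .refl _, .symm, .trans⟩

variable (p L) in
/-- Orbits of sequences. -/
abbrev Orbits (e : ℕ) [NeZero e] : Type := Quotient (orbitSetoid p L e)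

lemma IsNakayama.finite_orbits (H : IsNakayama k D L) (e : ℕ) [NeZero e] :
    Finite (Orbits p L e) := by
  classical
  obtain ⟨F, hF⟩ := H.exists_finset e
  have : Finite {μ : osL L e // μ.1 ∈ F} :=
    Finite.of_injective (fun μ => (⟨μ.1.1, μ.2⟩ : F)) fun a b hab =>
      Subtype.ext (Subtype.ext (congrArg (fun x : F => x.1) hab))
  refine Finite.of_surjective
    (fun μ : {μ : osL L e // μ.1 ∈ F} => (Quotient.mk (orbitSetoid p L e) μ.1)) fun o => ?_
  induction o using Quotient.inductionOn with
  | _ μ =>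
    obtain ⟨m, hm⟩ := hF μ.1 μ.2
    exact ⟨⟨⟨shift p m μ.1, H.shift_mem μ.2 m⟩, hm⟩, Quotient.sound ⟨m, rfl⟩⟩

/-- The interval module of a sequence, as an object of the module category. -/
abbrev IsNakayama.obj (H : IsNakayama k D L) (lam : osL L (d + 1)) :
    ModuleCat.{u} (QuotAlg k D) := ModuleCat.of (QuotAlg k D) (H.Mod lam)

/-- The direct sum of all interval modules, one from each orbit. -/
abbrev IsNakayama.total (H : IsNakayama k D L) : ModuleCat.{u} (QuotAlg k D) :=
  ModuleCat.of (QuotAlg k D) (∀ o : Orbits p L (d + 1), H.Mod o.out)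

open Classical in
/-- The inclusion of a summand. -/
def IsNakayama.inj (H : IsNakayama k D L) (o : Orbits p L (d + 1)) : H.obj o.out ⟶ H.total :=
  ModuleCat.ofHom (LinearMap.single (QuotAlg k D) (fun o : Orbits p L (d + 1) => H.Mod o.out) o)

/-- The projection to a summand. -/
def IsNakayama.prj (H : IsNakayama k D L) (o : Orbits p L (d + 1)) : H.total ⟶ H.obj o.out :=
  ModuleCat.ofHom (LinearMap.proj o)

lemma IsNakayama.inj_prj_self (H : IsNakayama k D L) (o : Orbits p L (d + 1)) :
    H.inj o ≫ H.prj o = 𝟙 _ := by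
  classical
  refine ModuleCat.hom_ext (LinearMap.ext fun x => ?_)
  exact Pi.single_eq_same (M := fun o : Orbits p L (d + 1) => H.Mod o.out) o x

lemma IsNakayama.sum_prj_inj (H : IsNakayama k D L) [Fintype (Orbits p L (d + 1))] :
    ∑ o, H.prj o ≫ H.inj o = 𝟙 H.total := by
  classical
  refine ModuleCat.hom_ext (LinearMap.ext fun x => ?_)
  rw [ModuleCat.hom_sum, LinearMap.sum_apply]
  exact Finset.univ_sum_single x

/-- Translation is an isomorphism of interval modules. -/
lemma IsNakayama.exists_iso (H : IsNakayama k D L) {lam mu : osL L (d + 1)}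
    (h : SameOrbit p lam.1 mu.1) : Nonempty (H.obj lam ≅ H.obj mu) := by
  obtain ⟨mu, hmu⟩ := mu
  obtain ⟨lam, hlam⟩ := lam
  obtain ⟨m, h⟩ := h
  obtain rfl : lam = shift p m mu := h
  have e1 : shift p m (lower mu) = lower (shift p m mu) := rfl
  have e2 : shift p m (upper mu) = upper (shift p m mu) := rfl
  have e3 : shift p (-m) (lower (shift p m mu)) = lower mu := by
    rw [← e1, shift_shift, neg_add_cancel, shift_zero]
  have e4 : shift p (-m) (upper (shift p m mu)) = upper mu := by
    rw [← e2, shift_shift, neg_add_cancel, shift_zero]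
  refine ⟨⟨ModuleCat.ofHom (transfer _ _ 1 (-m) e3.le e4.le),
    ModuleCat.ofHom (transfer _ _ 1 m e1.le e2.le), ?_, ?_⟩⟩
  · rw [← ModuleCat.ofHom_comp, transfer_comp_transfer]
    exact congrArg ModuleCat.ofHom (transfer_eq_id (mul_one 1) (add_neg_cancel m) _ _)
  · rw [← ModuleCat.ofHom_comp, transfer_comp_transfer]
    exact congrArg ModuleCat.ofHom (transfer_eq_id (mul_one 1) (neg_add_cancel m) _ _)

lemma IsNakayama.exists_iso_out (H : IsNakayama k D L) (lam : osL L (d + 1)) :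
    Nonempty (H.obj lam ≅ H.obj (Quotient.mk (orbitSetoid p L (d + 1)) lam).out) :=
  H.exists_iso (Quotient.exact (Quotient.out_eq (Quotient.mk (orbitSetoid p L (d + 1)) lam)).symm)

lemma IsNakayama.isSummand_obj (H : IsNakayama k D L) (lam : osL L (d + 1)) :
    IsSummand (H.obj lam) H.total := by
  obtain ⟨e⟩ := H.exists_iso_out lam
  exact ⟨⟨e.hom ≫ H.inj _, H.prj _ ≫ e.inv, by
    rw [Category.assoc, ← Category.assoc (H.inj _), H.inj_prj_self, Category.id_comp,
      e.hom_inv_id]⟩⟩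

lemma inAdd_of_isSummand {Λ : Type u} [Ring Λ] {X M : ModuleCat.{u} Λ} (h : IsSummand X M) :
    InAdd M X := by
  obtain ⟨R⟩ := h
  exact inAdd_of_sum (ι := Unit) (fun _ => R.i) (fun _ => R.r) (by simp)

lemma IsNakayama.inAdd_obj (H : IsNakayama k D L) (lam : osL L (d + 1)) :
    InAdd H.total (H.obj lam) := inAdd_of_isSummand (H.isSummand_obj lam)

lemma inAdd_pi {Λ : Type u} [Ring Λ] {M : ModuleCat.{u} Λ} {ι : Type} [Fintype ι]
    (Y : ι → ModuleCat.{u} Λ) (h : ∀ i, InAdd M (Y i)) :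
    InAdd M (ModuleCat.of Λ (∀ i, Y i)) := by
  classical
  choose r a b hab using fun i => exists_sum_of_inAdd (h i)
  refine inAdd_of_sum (ι := Σ i, Fin (r i))
    (fun t => ModuleCat.ofHom (LinearMap.proj t.1) ≫ a t.1 t.2)
    (fun t => b t.1 t.2 ≫ ModuleCat.ofHom (LinearMap.single Λ (fun i => (Y i : Type u)) t.1)) ?_
  rw [Fintype.sum_sigma]
  have h1 : ∀ i, ∑ j : Fin (r i), (ModuleCat.ofHom (LinearMap.proj i : (∀ i, Y i) →ₗ[Λ] Y i) ≫
      a i j) ≫ b i j ≫ ModuleCat.ofHom (LinearMap.single Λ (fun i => (Y i : Type u)) i) =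
      ModuleCat.ofHom (LinearMap.proj i : (∀ i, Y i) →ₗ[Λ] Y i) ≫
        ModuleCat.ofHom (LinearMap.single Λ (fun i => (Y i : Type u)) i) := by
    intro i
    calc _ = ModuleCat.ofHom (LinearMap.proj i : (∀ i, Y i) →ₗ[Λ] Y i) ≫
          (∑ j, a i j ≫ b i j) ≫
          ModuleCat.ofHom (LinearMap.single Λ (fun i => (Y i : Type u)) i) := by
            simp only [Preadditive.sum_comp, Preadditive.comp_sum, Category.assoc]
      _ = _ := by rw [hab]; simp
  rw [Finset.sum_congr rfl fun i _ => h1 i]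
  refine ModuleCat.hom_ext (LinearMap.ext fun x => ?_)
  rw [ModuleCat.hom_sum, LinearMap.sum_apply]
  exact Finset.univ_sum_single x

lemma IsNakayama.finite_total (H : IsNakayama k D L) :
    Module.Finite (QuotAlg k D) H.total := by
  have := H.finite_orbits (d + 1)
  exact Module.Finite.pi

/-- The sequence of the projective module at a vertex. -/
lemma IsNakayama.exists_projLam (H : IsNakayama k D L) {x : Vtx d} (hx : x ∈ D.verts) :
    ∃ lam : osL L (d + 1), upper lam.1 = x ∧
      ∀ y, y ≤ x → ¬ lower lam.1 ≤ y → ar k D y x = 0 := by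
  rw [H.verts] at hx
  -- The last entry is the smallest value allowed by the first one.
  let lam : Vtx (d + 1) := Fin.snoc (α := fun _ => ℤ) x (L (x 0))
  have hup : upper lam = x := by funext i; simp [upper, lam]
  have hl : lam (Fin.last d) = L (x 0) := by simp [lam]
  have h0 : lam 0 = x 0 := by rw [← upper_zero lam, hup]
  have hs : ∀ (i : Fin d) (hi : (i : ℕ) + 1 < d), lower lam i = x ⟨i + 1, hi⟩ := by
    intro i hi
    have : i.succ = (⟨i + 1, hi⟩ : Fin d).castSucc := rfl
    simp only [lower, this, lam, Fin.snoc_castSucc]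
  have hlow : ∀ i : Fin d, ¬ (i : ℕ) + 1 < d → lower lam i = L (x 0) := by
    intro i hi
    have : i.succ = Fin.last d := by ext; simp; omega
    simp only [lower]
    rw [this, hl]
  have hmem : lam ∈ osL L (d + 1) := by
    refine ⟨?_, ?_⟩
    · rw [Fin.antitone_iff_succ_le]
      intro i
      have e : lam i.castSucc = x i := congrFun hup i
      rw [e]
      change lower lam i ≤ x i
      by_cases hi : (i : ℕ) + 1 < d
      · rw [hs i hi]; exact hx.1 (by rw [Fin.le_def]; simp)
      · rw [hlow i hi]; exact hx.2.trans (last_le_of_os hx.1 i)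
    · rw [lastIdx_succ, hl, h0]
  refine ⟨⟨lam, hmem⟩, hup, fun y h1 h2 => H.ar_eq_zero_lower (fun i j hij => ?_) ?_ h1 h2⟩
  · have hi : (i : ℕ) + 1 < d := by omega
    have hj : j = ⟨i + 1, hi⟩ := by ext; exact hij
    rw [hj]; exact (hs i hi).le
  · exact (hlow _ (by rw [val_lastIdx]; exact lt_irrefl _)).le

/-- The sequence of the injective module at a vertex. -/
lemma IsNakayama.exists_injLam (H : IsNakayama k D L) {x : Vtx d} (hx : x ∈ D.verts) :
    ∃ lam : osL L (d + 1), lower lam.1 = x ∧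
      ∀ y, x ≤ y → ¬ y ≤ upper lam.1 → ar k D x y = 0 := by
  have hxv := hx
  rw [H.verts] at hx
  obtain ⟨B, hB⟩ := H.bdd
  -- The new first entry is the largest one whose bound still admits the last entry of `x`.
  obtain ⟨r, hr1, hr2⟩ := Int.exists_greatest_of_bdd
    (P := fun j => L j ≤ x (lastIdx d)) ⟨x (lastIdx d) + B, fun j hj => by
      have := hB j; linarith⟩ ⟨x 0, hx.2⟩
  let lam : Vtx (d + 1) := Fin.cons (α := fun _ => ℤ) r x
  have hlo : lower lam = x := by funext i; simp [lower, lam]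
  have h0 : lam 0 = r := by simp [lam]
  have hlast : lam (Fin.last d) = x (lastIdx d) := by
    rw [← lastIdx_succ, ← lower_last lam, hlo]
  have hup : ∀ (i j : Fin d), (j : ℕ) = i + 1 → upper lam j = x i := by
    intro i j hij
    have : j.castSucc = i.succ := by ext; simp [hij]
    simp only [upper, this, lam, Fin.cons_succ]
  have hmem : lam ∈ osL L (d + 1) := by
    refine ⟨?_, by rw [lastIdx_succ, hlast, h0]; exact hr1⟩
    rw [Fin.antitone_iff_succ_le]
    intro i
    have e : lam i.succ = x i := congrFun hlo i
    rw [e]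
    change x i ≤ upper lam i
    by_cases hi : (i : ℕ) = 0
    · have : i = 0 := by ext; simpa using hi
      rw [this, upper_zero, h0]; exact hr2 _ hx.2
    · have hi' : (i : ℕ) - 1 < d := by omega
      rw [hup ⟨i - 1, hi'⟩ i (by simp; omega)]
      exact hx.1 (by rw [Fin.le_def]; simp)
  refine ⟨⟨lam, hmem⟩, hlo, fun y h1 h2 => ?_⟩
  by_contra h0'
  have hyv : y ∈ D.verts := by
    by_contra hc; exact h0' (ar_eq_zero_of_notMem_right h1 hc)
  obtain ⟨h3, h4⟩ := H.interlaced x y hxv hyv h1 h0'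
  refine h2 fun i => ?_
  by_cases hi : (i : ℕ) = 0
  · have : i = 0 := by ext; simpa using hi
    rw [this, upper_zero]
    change y 0 ≤ lam 0
    rw [h0]; exact hr2 _ h4
  · have hi' : (i : ℕ) - 1 < d := by omega
    rw [hup ⟨i - 1, hi'⟩ i (by simp; omega)]
    exact h3 _ _ (by simp; omega)

/-- A vector supported at a vertex `x` is the image of the top vector of the projective at `x`,
which is a summand of `M`. Such vectors generate every module additively. -/
lemma IsNakayama.isSeparator_total (H : IsNakayama k D L) : IsSeparator H.total := by
  rw [Preadditive.isSeparator_iff]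
  intro X Y f hf
  refine ModuleCat.hom_ext (LinearMap.ext fun v => ?_)
  have hv := sum_ar_smul (k := k) (D := D) (v : X)
  induction hv using AddSubgroup.closure_induction with
  | zero => simp
  | add a b _ _ ha hb => rw [map_add, ha, hb]; simp
  | neg a _ ha => rw [map_neg, ha]; simp
  | mem w hw =>
    obtain ⟨x, w', hx, rfl⟩ := hw
    obtain ⟨lam, rfl, h0⟩ := H.exists_projLam hx
    have hw' : ∀ y, y ≤ upper lam.1 → ¬ lower lam.1 ≤ y → ar k D y (upper lam.1) • w' = 0 :=
      fun y h1 h2 => by rw [h0 y h1 h2, zero_smul]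
    let φ : H.obj lam ⟶ X := ModuleCat.ofHom (intervalHom (H.adm lam.1 lam.2) w' hw')
    obtain ⟨R⟩ := H.isSummand_obj lam
    have h1 : φ ≫ f = 0 := by
      have := hf (R.r ≫ φ)
      rw [← Category.id_comp φ, ← R.retract, Category.assoc, Category.assoc, ← Category.assoc R.r,
        this, Limits.comp_zero]
    have h2 := congrArg (fun g => g.hom (basisVec (H.adm lam.1 lam.2) (upper lam.1))) h1
    change f.hom (intervalHom (H.adm lam.1 lam.2) w' hw' (basisVec _ (upper lam.1))) = 0 at h2
    rw [intervalHom_basisVec (lower_le_upper lam.2)] at h2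
    rw [h2]; simp

/-- The embedding goes into injectives, one for each representative vertex and each coordinate form
of a `k`-basis of `X`. A vector in the kernel is killed by the idempotent of every kept vertex. -/
lemma IsNakayama.cogenerates_total (H : IsNakayama k D L) : Cogenerates H.total := by
  intro X hX
  have := H.finite_quotAlg
  let : Module k X := Module.restrictScalars k (QuotAlg k D) X
  have : IsScalarTower k (QuotAlg k D) X := IsScalarTower.restrictScalars k (QuotAlg k D) X
  have hfin : Module.Finite k X := Module.Finite.trans (QuotAlg k D) X
  let b := Module.finBasis k X
  obtain ⟨F, hF⟩ := H.exists_finset d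
  let V := {x : F // x.1 ∈ D.verts}
  have : Fintype V := Fintype.ofFinite _
  choose lam hlam h0 using fun x : V => H.exists_injLam x.2
  let ι := V × Fin (Module.finrank k X)
  let φ : ∀ t : ι, X →ₗ[QuotAlg k D] H.Mod (lam t.1) := fun t =>
    intervalCohom (H.adm _ (lam t.1).2) (b.coord t.2).toAddMonoidHom
      (fun c x => by
        change b.coord t.2 (algebraMap k (QuotAlg k D) c • x) = _
        rw [algebraMap_smul, map_smul, smul_eq_mul]; rfl)
      (fun y h1 h2 => by
        rw [hlam] at h1 ⊢
        exact h0 t.1 y h1 h2)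
  refine ⟨ModuleCat.of _ (∀ t : ι, H.obj (lam t.1)), ModuleCat.ofHom (LinearMap.pi φ),
    Module.Finite.pi, inAdd_pi (fun t : ι => H.obj (lam t.1)) (fun t => H.inAdd_obj _), ?_⟩
  rw [ModuleCat.mono_iff_injective]
  refine (injective_iff_map_eq_zero (LinearMap.pi φ)).2 fun v hv => ?_
  have key : ∀ x ∈ D.verts, ar k D x x • v = 0 := by
    intro x hx
    have hx' := hx
    rw [H.verts] at hx'
    obtain ⟨m, hm⟩ := hF x hx'
    rw [← ar_shift m]
    let t : V := ⟨⟨shift p m x, hm⟩, D.verts_shift m x hx⟩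
    refine b.ext_elem fun i => ?_
    have h1 := congrArg (fun w => coeff (w (t, i)) (lower (lam t).1)) hv
    change coeff (φ (t, i) v) _ = coeff (0 : H.Mod (lam t)) _ at h1
    rw [coeff_zero, coeff_intervalCohom _ _ _ _ ⟨le_rfl, lower_le_upper (lam t).2⟩] at h1
    rw [hlam t] at h1
    simpa using h1
  have h1 : ∀ a : QuotAlg k D, a • v = 0 := by
    intro a
    induction a using quotAlg_induction with
    | h0 => simp
    | hadd a b iha ihb => rw [add_smul, iha, ihb, add_zero]
    | harrow c u w huw =>
      by_cases hw : w ∈ D.verts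
      · rw [← ar_mul_ar huw le_rfl, mul_smul, mul_smul, key w hw, smul_zero, smul_zero]
      · rw [ar_eq_zero_of_notMem_right huw hw, mul_zero, zero_smul]
  simpa using h1 1

end Total

/-! ### Projective dimension over the endomorphism ring -/

section Gamma

/-- A short exact sequence of quotient modules. -/
lemma shortExact_quotient {R : Type u} [Ring R] {A B : Type u} [AddCommGroup A] [AddCommGroup B]
    [Module R A] [Module R B] (f : A →ₗ[R] B) (U : Submodule R A) (V V' : Submodule R B)
    (hU : V.comap f = U) (hV : V' = V ⊔ LinearMap.range f) :
    ∃ w, (ShortComplex.mk (X₁ := ModuleCat.of R (A ⧸ U)) (X₂ := ModuleCat.of R (B ⧸ V))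
      (X₃ := ModuleCat.of R (B ⧸ V')) (ModuleCat.ofHom (U.mapQ V f hU.ge))
      (ModuleCat.ofHom (Submodule.factor (hV ▸ le_sup_left : V ≤ V'))) w).ShortExact := by
  have hle : V ≤ V' := hV ▸ le_sup_left
  have hr : LinearMap.range f ≤ V' := hV ▸ le_sup_right
  refine ⟨?_, ?_⟩
  · refine ModuleCat.hom_ext (LinearMap.ext fun (x : A ⧸ U) => ?_)
    obtain ⟨x, rfl⟩ := Submodule.mkQ_surjective U x
    change Submodule.factor hle (U.mapQ V f hU.ge (U.mkQ x)) = 0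
    exact (Submodule.Quotient.mk_eq_zero V').2 (hr ⟨x, rfl⟩)
  · refine { exact := ?_, mono_f := ?_, epi_g := ?_ }
    · rw [ShortComplex.moduleCat_exact_iff]
      intro (y : B ⧸ V) hy
      obtain ⟨y, rfl⟩ := Submodule.mkQ_surjective V y
      have hy' : y ∈ V' := (Submodule.Quotient.mk_eq_zero V').1 hy
      obtain ⟨v, hv, _, ⟨a, rfl⟩, rfl⟩ := Submodule.mem_sup.1 (hV.le hy')
      refine ⟨U.mkQ a, ?_⟩
      change U.mapQ V f hU.ge (U.mkQ a) = V.mkQ (v + f a)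
      rw [map_add, show V.mkQ v = 0 from (Submodule.Quotient.mk_eq_zero V).2 hv, zero_add]
      rfl
    · rw [ModuleCat.mono_iff_injective]
      refine (injective_iff_map_eq_zero (U.mapQ V f hU.ge)).2 fun x hx => ?_
      obtain ⟨x, rfl⟩ := Submodule.mkQ_surjective U x
      have hx' : f x ∈ V := (Submodule.Quotient.mk_eq_zero V).1 hx
      exact (Submodule.Quotient.mk_eq_zero U).2 (hU.le hx')
    · rw [ModuleCat.epi_iff_surjective]
      exact Submodule.factor_surjective hle

/-- Lowering one entry of a sequence. -/
def dec {d : ℕ} (ν : Vtx (d + 1)) (j : Fin (d + 1)) : Vtx (d + 1) := Function.update ν j (ν j - 1)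

lemma dec_le {d : ℕ} (ν : Vtx (d + 1)) (j : Fin (d + 1)) : dec ν j ≤ ν := by
  intro i
  by_cases h : i = j
  · subst h; simp [dec]
  · simp [dec, h]

lemma dec_self {d : ℕ} (ν : Vtx (d + 1)) (j : Fin (d + 1)) : dec ν j j = ν j - 1 := by simp [dec]

lemma dec_of_ne {d : ℕ} (ν : Vtx (d + 1)) {i j : Fin (d + 1)} (h : i ≠ j) : dec ν j i = ν i := by
  simp [dec, h]

variable {k : Type u} [Field k] {d p : ℕ} [NeZero d] {D : QuotientData d p} {L : ℤ → ℤ}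

/-- The endomorphism ring of the sum of the interval modules, acting on the left. -/
abbrev IsNakayama.Gam (H : IsNakayama k D L) : Type u := (End H.total)ᵐᵒᵖ

lemma lower_mono {d : ℕ} {κ ν : Vtx (d + 1)} (h : κ ≤ ν) : lower κ ≤ lower ν := fun i => h i.succ

lemma upper_mono {d : ℕ} {κ ν : Vtx (d + 1)} (h : κ ≤ ν) : upper κ ≤ upper ν :=
  fun i => h i.castSucc

/-- The canonical map between interval modules of comparable sequences. -/
def IsNakayama.can (H : IsNakayama k D L) (κ ν : osL L (d + 1)) (h : κ.1 ≤ ν.1) :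
    H.obj κ ⟶ H.obj ν :=
  ModuleCat.ofHom (canMap (H.adm κ.1 κ.2) (H.adm ν.1 ν.2) (lower_mono h) (upper_mono h))

lemma IsNakayama.can_comp (H : IsNakayama k D L) {κ μ ν : osL L (d + 1)} (h : κ.1 ≤ μ.1)
    (h' : μ.1 ≤ ν.1) : H.can κ μ h ≫ H.can μ ν h' = H.can κ ν (h.trans h') :=
  congrArg ModuleCat.ofHom (canMap_comp_canMap (lower_mono h) (upper_mono h) (lower_mono h')
    (upper_mono h'))

lemma IsNakayama.can_self (H : IsNakayama k D L) (ν : osL L (d + 1)) :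
    H.can ν ν le_rfl = 𝟙 _ :=
  congrArg ModuleCat.ofHom (transfer_eq_id rfl rfl _ _)

/-- The coefficient of a map between interval modules at a translate of its source. -/
def IsNakayama.cf (H : IsNakayama k D L) {lam ν : osL L (d + 1)} (g : H.obj lam ⟶ H.obj ν)
    (m : ℤ) : k :=
  coeff (h := H.adm ν.1 ν.2) (g.hom (basisVec (H.adm lam.1 lam.2) (upper lam.1)))
    (shift p m (upper lam.1))

lemma IsNakayama.cf_add (H : IsNakayama k D L) {lam ν : osL L (d + 1)}
    (g g' : H.obj lam ⟶ H.obj ν) (m : ℤ) : H.cf (g + g') m = H.cf g m + H.cf g' m :=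
  coeff_add _ _ _

lemma IsNakayama.cf_zero (H : IsNakayama k D L) {lam ν : osL L (d + 1)} (m : ℤ) :
    H.cf (0 : H.obj lam ⟶ H.obj ν) m = 0 :=
  coeff_zero _

/-- A non-zero coefficient occurs only at interlaced translates. -/
lemma IsNakayama.le_of_cf_ne_zero (H : IsNakayama k D L) {lam ν : osL L (d + 1)}
    {g : H.obj lam ⟶ H.obj ν} {m : ℤ} (hg : H.cf g m ≠ 0) :
    shift p m lam.1 ≤ ν.1 ∧ ∀ i : Fin d, ν.1 i.succ ≤ shift p m lam.1 i.castSucc := by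
  have h1 := coeff_hom_lower (lower_le_upper lam.2) g.hom hg
  have h2 := mem_of_coeff_ne_zero hg
  refine ⟨fun i => ?_, fun i => h2.1 i⟩
  have hd := NeZero.pos d
  by_cases hi : (i : ℕ) < d
  · exact h2.2 ⟨i, hi⟩
  · have e : i = Fin.succ ⟨d - 1, by omega⟩ := by ext; simp; omega
    rw [e]
    exact h1 _

open Classical in
-- The canonical map only truncates, and the upper bound holds wherever the coefficient is non-zero.
lemma IsNakayama.cf_comp_can (H : IsNakayama k D L) {lam μ ν : osL L (d + 1)}
    (g : H.obj lam ⟶ H.obj μ) (h : μ.1 ≤ ν.1) (m : ℤ) :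
    H.cf (g ≫ H.can μ ν h) m =
      if ∀ i : Fin d, ν.1 i.succ ≤ shift p m lam.1 i.castSucc then H.cf g m else 0 := by
  refine (coeff_canMap (lower_mono h) (upper_mono h) _ _).trans ?_
  change (if _ then H.cf g m else 0) = _
  by_cases hg : H.cf g m = 0
  · rw [hg]; simp
  · have h1 := H.le_of_cf_ne_zero hg
    congr 1
    refine propext ⟨fun h' i => h'.1 i, fun h' => ⟨fun i => h' i, fun i => ?_⟩⟩
    exact (h1.1.trans h) i.castSucc

/-- An interlaced sequence that differs from `ν` lies below a sequence obtained by lowering an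
entry. -/
lemma IsNakayama.exists_dec (H : IsNakayama k D L) {κ ν : Vtx (d + 1)} (hκ : κ ∈ osL L (d + 1))
    (hν : ν ∈ osL L (d + 1)) (hle : κ ≤ ν) (hlace : ∀ i : Fin d, ν i.succ ≤ κ i.castSucc)
    {t : ℕ} (hne : ∃ j : Fin (d + 1), (j : ℕ) < t ∧ κ j ≠ ν j) :
    ∃ j : Fin (d + 1), (j : ℕ) < t ∧ dec ν j ∈ osL L (d + 1) ∧ κ ≤ dec ν j := by
  classical
  let A : Finset (Fin (d + 1)) := Finset.univ.filter fun j => κ j ≠ ν j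
  have hA : A.Nonempty := by
    obtain ⟨j, -, hj⟩ := hne
    exact ⟨j, by simp [A, hj]⟩
  -- At the first difference, lowering is compatible with `κ`. Monotonicity at `j` follows from
  -- interlacing, and if `j` is the last index, then the first entries agree and the `L`-bound of
  -- `κ` suffices.
  let j := A.min' hA
  have hj : κ j ≠ ν j := (Finset.mem_filter.1 (A.min'_mem hA)).2
  have hmin : ∀ i, i < j → κ i = ν i := by
    intro i hi
    by_contra hc
    exact absurd (A.min'_le i (by simp [A, hc])) (not_le.2 hi)
  have hjt : (j : ℕ) < t := by
    obtain ⟨j', hj', hne'⟩ := hne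
    exact lt_of_le_of_lt (Fin.le_def.1 (A.min'_le j' (by simp [A, hne']))) hj'
  have hlt : κ j < ν j := lt_of_le_of_ne (hle j) hj
  have hκd : κ ≤ dec ν j := by
    intro i
    by_cases h : i = j
    · rw [h, dec_self]; exact Int.le_sub_one_of_lt hlt
    · rw [dec_of_ne ν h]; exact hle i
  refine ⟨j, hjt, ⟨?_, ?_⟩, hκd⟩
  · rw [Fin.antitone_iff_succ_le]
    intro i
    by_cases h : i.castSucc = j
    · have h1 := hlace i
      have h2 := dec_le ν j i.succ
      have h3 := hκd i.castSucc
      exact h2.trans (h1.trans h3)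
    · rw [dec_of_ne ν h]
      exact (dec_le ν j _).trans (hν.1 Fin.castSucc_lt_succ.le)
  · rw [lastIdx_succ]
    by_cases h : j = Fin.last d
    · have h0 : (0 : Fin (d + 1)) < j := by
        rw [h, Fin.lt_def]; simpa using NeZero.pos d
      rw [dec_of_ne ν h0.ne, ← hmin 0 h0]
      have := hκ.2
      rw [lastIdx_succ] at this
      exact this.trans (hκd _)
    · rw [dec_of_ne ν (Ne.symm h)]
      have := hν.2
      rw [lastIdx_succ] at this
      exact (H.mono (dec_le ν j 0)).trans this

/-- The maps to an interval module that factor through lowering one of the first `t` entries. -/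
def IsNakayama.low (H : IsNakayama k D L) (ν : osL L (d + 1)) (t : ℕ) :
    Submodule H.Gam ((homFunctor H.total).obj (H.obj ν)) :=
  ⨆ j : {j : Fin (d + 1) // (j : ℕ) < t ∧ dec ν.1 j ∈ osL L (d + 1)},
    LinearMap.range ((homFunctor H.total).map (H.can ⟨dec ν.1 j.1, j.2.2⟩ ν (dec_le _ _))).hom

lemma IsNakayama.mem_low_of_eq (H : IsNakayama k D L) {ν : osL L (d + 1)} {t : ℕ}
    {j : Fin (d + 1)} (hj : (j : ℕ) < t) (hd : dec ν.1 j ∈ osL L (d + 1))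
    (g : H.total ⟶ H.obj ⟨dec ν.1 j, hd⟩) :
    (g ≫ H.can _ ν (dec_le _ _) : H.total ⟶ H.obj ν) ∈ H.low ν t :=
  Submodule.mem_iSup_of_mem (p := fun j : {j : Fin (d + 1) // (j : ℕ) < t ∧
      dec ν.1 j ∈ osL L (d + 1)} => LinearMap.range ((homFunctor H.total).map
        (H.can ⟨dec ν.1 j.1, j.2.2⟩ ν (dec_le _ _))).hom) ⟨j, hj, hd⟩ ⟨g, rfl⟩

/-- A map through the sequence lowered at `j` only has coefficients at translates below it, which
differ from `ν` at `j`. Conversely, `g` is a sum of transfers, and by `exists_dec` each one whose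
translate differs from `ν` among the first `t` entries factors through a lowering. -/
lemma IsNakayama.mem_low_iff (H : IsNakayama k D L) (ν : osL L (d + 1)) (t : ℕ)
    (g : H.total ⟶ H.obj ν) :
    g ∈ H.low ν t ↔ ∀ (o : Orbits p L (d + 1)) (m : ℤ),
      (∀ j : Fin (d + 1), (j : ℕ) < t → shift p m o.out.1 j = ν.1 j) →
        H.cf (H.inj o ≫ g) m = 0 := by
  classical
  constructor
  · intro hg o m hm
    refine Submodule.iSup_induction _
      (motive := fun g : (homFunctor H.total).obj (H.obj ν) =>
        H.cf (H.inj o ≫ (show H.total ⟶ H.obj ν from g)) m = 0) hg ?_ ?_ ?_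
    · rintro ⟨j, hj, hd⟩ _ ⟨h, rfl⟩
      change H.cf (H.inj o ≫ (show H.total ⟶ H.obj ⟨dec ν.1 j, hd⟩ from h) ≫
        H.can ⟨dec ν.1 j, hd⟩ ν (dec_le _ _)) m = 0
      rw [← Category.assoc, cf_comp_can]
      split_ifs with hc
      · by_contra h0
        have h1 := (H.le_of_cf_ne_zero h0).1 j
        have h2 := hm j hj
        have h3 := dec_self ν.1 j
        simp only at h1
        omega
      · rfl
    · change H.cf (H.inj o ≫ 0) m = 0
      rw [Limits.comp_zero, cf_zero]
    · intro x y hx hy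
      change H.cf (H.inj o ≫ ((show H.total ⟶ H.obj ν from x) + (show H.total ⟶ H.obj ν from y)))
        m = 0
      rw [Preadditive.comp_add, cf_add, hx, hy, add_zero]
  · intro hg
    have := H.finite_orbits (d + 1)
    have := Fintype.ofFinite (Orbits p L (d + 1))
    have e : g = ∑ o, H.prj o ≫ H.inj o ≫ g := by
      simp only [← Category.assoc]
      rw [← Preadditive.sum_comp, H.sum_prj_inj, Category.id_comp]
    rw [e]
    refine Submodule.sum_mem _ fun o _ => ?_
    let S : AddSubgroup (H.Mod o.out →ₗ[QuotAlg k D] H.Mod ν) :=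
      { carrier := {φ | (H.prj o ≫ ModuleCat.ofHom φ : H.total ⟶ H.obj ν) ∈ H.low ν t}
        zero_mem' := by
          change (H.prj o ≫ (0 : H.obj o.out ⟶ H.obj ν)) ∈ H.low ν t
          rw [Limits.comp_zero]
          exact Submodule.zero_mem _
        add_mem' := by
          intro a b ha hb
          change (H.prj o ≫ (ModuleCat.ofHom a + ModuleCat.ofHom b : H.obj o.out ⟶ H.obj ν))
            ∈ H.low ν t
          rw [Preadditive.comp_add]
          exact Submodule.add_mem _ ha hb
        neg_mem' := by
          intro a ha
          change (H.prj o ≫ (-ModuleCat.ofHom a : H.obj o.out ⟶ H.obj ν)) ∈ H.low ν t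
          rw [Preadditive.comp_neg]
          exact Submodule.neg_mem _ ha }
    refine hom_mem_of_transfer (lower_le_upper o.out.2) (H.inj o ≫ g).hom S
      fun c m h1 h2 _ h0 => ?_
    have h3 := H.le_of_cf_ne_zero (g := H.inj o ≫ g) (m := m) h0
    have hne : ∃ j : Fin (d + 1), (j : ℕ) < t ∧ shift p m o.out.1 j ≠ ν.1 j := by
      by_contra hc
      push Not at hc
      exact h0 (hg o m hc)
    obtain ⟨j, hj, hdec, hle⟩ := H.exists_dec (H.shift_mem o.out.2 m) ν.2 h3.1 h3.2 hne
    have h4 := H.mem_low_of_eq hj hdec (H.prj o ≫ ModuleCat.ofHom (transfer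
      (H.adm o.out.1 o.out.2) (H.adm _ hdec) c m (lower_mono hle) (upper_mono hle)))
    rw [Category.assoc] at h4
    have h5 := (transfer_comp_transfer (h := H.adm o.out.1 o.out.2) (h' := H.adm _ hdec)
      (h'' := H.adm ν.1 ν.2) c 1 m 0 (lower_mono hle) (upper_mono hle)
      (zero_shift_le (lower_mono (dec_le ν.1 j)))
      (zero_shift_le (upper_mono (dec_le ν.1 j)))).trans
      (transfer_congr (one_mul c) (zero_add m) _ _)
    exact (congrArg (fun φ => (H.prj o ≫ ModuleCat.ofHom φ : H.total ⟶ H.obj ν) ∈ H.low ν t)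
      h5).mp h4

/-- Both memberships test coefficients at the same translates, since lowering `j` does not touch the
earlier entries. This gives the injectivity on quotients needed for `shortExact_quotient`. -/
lemma IsNakayama.comap_low (H : IsNakayama k D L) (ν : osL L (d + 1)) (j : Fin (d + 1))
    (hd : dec ν.1 j ∈ osL L (d + 1)) :
    (H.low ν j).comap ((homFunctor H.total).map (H.can ⟨dec ν.1 j, hd⟩ ν (dec_le _ _))).hom =
      H.low ⟨dec ν.1 j, hd⟩ j := by
  classical
  ext (g : H.total ⟶ H.obj ⟨dec ν.1 j, hd⟩)
  change (g ≫ H.can ⟨dec ν.1 j, hd⟩ ν (dec_le _ _) : H.total ⟶ H.obj ν) ∈ H.low ν j ↔ _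
  rw [H.mem_low_iff]
  refine Iff.trans ?_ (H.mem_low_iff ⟨dec ν.1 j, hd⟩ j g).symm
  refine forall_congr' fun o => forall_congr' fun m => ?_
  have e : (∀ i : Fin (d + 1), (i : ℕ) < j → shift p m o.out.1 i = ν.1 i) ↔
      ∀ i : Fin (d + 1), (i : ℕ) < j → shift p m o.out.1 i = dec ν.1 j i := by
    refine forall_congr' fun i => forall_congr' fun hi => ?_
    rw [dec_of_ne ν.1 (fun h => by rw [h] at hi; exact lt_irrefl _ hi)]
  rw [← e]
  refine forall_congr' fun hm => ?_
  rw [← Category.assoc, cf_comp_can]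
  split_ifs with hc
  · rfl
  · refine ⟨fun _ => ?_, fun _ => rfl⟩
    by_contra h0
    have h1 := H.le_of_cf_ne_zero h0
    refine hc fun i => ?_
    -- Only here is interlacing with `ν` stronger than with the lowered sequence. It holds because
    -- the translate agrees with `ν` at the preceding entry.
    by_cases hi : i.succ = j
    · have h2 := hm i.castSucc (by rw [← hi]; simp)
      rw [h2]
      exact ν.2.1 Fin.castSucc_lt_succ.le
    · have := h1.2 i
      simp only [dec_of_ne ν.1 hi] at this
      exact this

/-- The passage from `t` to `t + 1` divides by the image of the quotient for the sequence lowered at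
`t`, which embeds. So the dimension grows by at most one, starting from the projective `Hom(M,
M_ν)`. -/
lemma IsNakayama.hasProjectiveDimensionLT_low (H : IsNakayama k D L) (t : ℕ) (ht : t ≤ d + 1)
    (ν : osL L (d + 1)) :
    HasProjectiveDimensionLT (ModuleCat.of H.Gam
      (((homFunctor H.total).obj (H.obj ν)) ⧸ H.low ν t)) (t + 1) := by
  induction t generalizing ν with
  | zero =>
    have hbot : H.low ν 0 = ⊥ := by
      refine iSup_eq_bot.2 ?_
      rintro ⟨j, hj, -⟩
      exact absurd hj (Nat.not_lt_zero _)
    have hP := projective_homFunctor (H.inAdd_obj ν)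
    have := hasProjectiveDimensionLT_of_projective (n := 1) hP le_rfl
    exact hasProjectiveDimensionLT_of_iso
      (Submodule.quotEquivOfEqBot _ hbot).symm.toModuleIso 1
  | succ t ih =>
    let j : Fin (d + 1) := ⟨t, ht⟩
    by_cases hd : dec ν.1 j ∈ osL L (d + 1)
    · have hsup : H.low ν (t + 1) = H.low ν t ⊔ LinearMap.range
          ((homFunctor H.total).map (H.can ⟨dec ν.1 j, hd⟩ ν (dec_le _ _))).hom := by
        refine le_antisymm (iSup_le ?_) (sup_le (iSup_le ?_) ?_)
        · rintro ⟨i, hi, hdi⟩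
          by_cases hit : (i : ℕ) < t
          · refine le_sup_of_le_left ?_
            rintro _ ⟨g, rfl⟩
            exact H.mem_low_of_eq hit hdi g
          · have : i = j := by ext; simp [j]; omega
            subst this
            exact le_sup_right
        · rintro ⟨i, hi, hdi⟩ _ ⟨g, rfl⟩
          exact H.mem_low_of_eq (Nat.lt_succ_of_lt hi) hdi g
        · rintro _ ⟨g, rfl⟩
          exact H.mem_low_of_eq (Nat.lt_succ_self t) hd g
      obtain ⟨w, hS⟩ := shortExact_quotient _ _ _ _ (H.comap_low ν j hd) hsup
      exact hS.hasProjectiveDimensionLT_X₃ (t + 1) (ih (by omega) _)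
        (by
          have := ih (by omega) ν
          exact hasProjectiveDimensionLT_of_ge _ (t + 1) _ (Nat.le_succ _))
    -- If the entry cannot be lowered, nothing new is divided out.
    · have heq : H.low ν (t + 1) = H.low ν t := by
        refine le_antisymm (iSup_le ?_) (iSup_le ?_)
        · rintro ⟨i, hi, hdi⟩ _ ⟨g, rfl⟩
          have hit : (i : ℕ) < t := by
            by_contra hc
            have : i = j := by ext; simp [j]; omega
            exact hd (this ▸ hdi)
          exact H.mem_low_of_eq hit hdi g
        · rintro ⟨i, hi, hdi⟩ _ ⟨g, rfl⟩
          exact H.mem_low_of_eq (Nat.lt_succ_of_lt hi) hdi g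
      rw [heq]
      have := ih (by omega) ν
      exact hasProjectiveDimensionLT_of_ge _ (t + 1) _ (Nat.le_succ _)

end Gamma

/-! ### Simple modules over the endomorphism ring -/

section Simple

variable {k : Type u} [Field k] {d p : ℕ} [NeZero d] {D : QuotientData d p} {L : ℤ → ℤ}
  (H : IsNakayama k D L) {S : Type u} [AddCommGroup S] [Module H.Gam S]

/-- The map to a module given by an element and a summand. -/
def IsNakayama.evalMap (o : Orbits p L (d + 1)) (s : S) :
    (homFunctor H.total).obj (H.obj o.out) →ₗ[H.Gam] S where
  toFun g := (MulOpposite.op (show End H.total from (show H.total ⟶ H.obj o.out from g) ≫ H.inj o) :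
    H.Gam) • s
  map_add' g g' := by
    rw [← add_smul, ← MulOpposite.op_add]
    exact congrArg (fun a : End H.total => (MulOpposite.op a : H.Gam) • s)
      (Preadditive.add_comp _ _ _ (show H.total ⟶ H.obj o.out from g) g' (H.inj o))
  map_smul' a g := by
    rw [RingHom.id_apply, ← mul_smul]
    exact congrArg (fun a : End H.total => (MulOpposite.op a : H.Gam) • s)
      (Category.assoc (show H.total ⟶ H.total from a.unop) (show H.total ⟶ H.obj o.out from g)
        (H.inj o))

lemma IsNakayama.exists_evalMap_ne_zero {s : S} (hs : s ≠ 0) :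
    ∃ o, H.evalMap o s ≠ 0 := by
  by_contra hc
  push Not at hc
  have := H.finite_orbits (d + 1)
  have := Fintype.ofFinite (Orbits p L (d + 1))
  refine hs ?_
  have h1 : ∀ o, (MulOpposite.op (show End H.total from H.prj o ≫ H.inj o) : H.Gam) • s = 0 :=
    fun o => congrArg (fun φ => φ (H.prj o)) (hc o)
  have h2 : (1 : H.Gam) =
      ∑ o, (MulOpposite.op (show End H.total from H.prj o ≫ H.inj o) : H.Gam) := by
    refine (congrArg MulOpposite.op H.sum_prj_inj.symm).trans ?_
    exact map_sum (MulOpposite.opAddEquiv : End H.total ≃+ H.Gam) _ _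
  rw [← one_smul H.Gam s, h2, Finset.sum_smul]
  exact Finset.sum_eq_zero fun o _ => h1 o

lemma IsNakayama.interlaced_of_can_ne_zero {κ ν : osL L (d + 1)} (h : κ.1 ≤ ν.1)
    (h0 : H.can κ ν h ≠ 0) : lower ν.1 ≤ upper κ.1 := by
  classical
  by_contra hc
  refine h0 (ModuleCat.hom_ext (LinearMap.ext fun (w : H.Mod κ) =>
    interval_ext (h := H.adm ν.1 ν.2) fun x hx1 hx2 => ?_))
  refine (coeff_canMap (lower_mono h) (upper_mono h) w x).trans ?_
  rw [if_pos ⟨hx1, hx2⟩]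
  exact (coeff_of_notMem _ fun h' => hc (hx1.trans h'.2)).trans (coeff_zero _).symm

/-- A bound from below on the entry sums of sequences with a non-zero canonical map to `ν`; it makes
repeated lowering terminate. -/
lemma IsNakayama.sum_ge_of_interlaced (H : IsNakayama k D L) {κ ν : osL L (d + 1)}
    (h : lower ν.1 ≤ upper κ.1) :
    ∑ i, lower ν.1 i + L (lower ν.1 0) ≤ ∑ i, κ.1 i := by
  rw [Fin.sum_univ_castSucc]
  refine add_le_add (Finset.sum_le_sum fun i _ => h i) ?_
  have h1 := κ.2.2
  rw [lastIdx_succ] at h1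
  refine (H.mono ?_).trans h1
  have h2 := h 0
  rwa [upper_zero] at h2

lemma sum_dec {d : ℕ} (ν : Vtx (d + 1)) (j : Fin (d + 1)) : ∑ i, dec ν j i = ∑ i, ν i - 1 := by
  have h1 := Finset.sum_update_of_mem (Finset.mem_univ j) ν (ν j - 1)
  have h2 := Finset.sum_eq_add_sum_sdiff_singleton_of_mem (Finset.mem_univ j) ν
  rw [dec]
  linarith

/-- A non-zero map from `Hom(-, M_ν)` yields one that kills the maps that lower an entry. -/
lemma IsNakayama.exists_low_le_ker {ν : osL L (d + 1)}
    (φ : (homFunctor H.total).obj (H.obj ν) →ₗ[H.Gam] S) (n : ℕ) (κ : osL L (d + 1))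
    (hκ : κ.1 ≤ ν.1) (h0 : φ.comp ((homFunctor H.total).map (H.can κ ν hκ)).hom ≠ 0)
    (hn : ∑ i, κ.1 i < ∑ i, lower ν.1 i + L (lower ν.1 0) + n) :
    ∃ (κ : osL L (d + 1)) (ψ : (homFunctor H.total).obj (H.obj κ) →ₗ[H.Gam] S), ψ ≠ 0 ∧
      H.low κ (d + 1) ≤ LinearMap.ker ψ := by
  -- The number `n` measures the distance of the entry sum from the bound for non-zero canonical
  -- maps. Each lowering decreases the sum by one, and at `n = 0` the canonical map would vanish.
  induction n generalizing κ with
  | zero =>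
    have h1 : H.can κ ν hκ ≠ 0 := by
      intro hc
      refine h0 (LinearMap.ext fun g => ?_)
      change φ ((show H.total ⟶ H.obj κ from g) ≫ H.can κ ν hκ) = 0
      rw [hc, Limits.comp_zero]
      exact map_zero φ
    have h2 := H.sum_ge_of_interlaced (H.interlaced_of_can_ne_zero hκ h1)
    simp at hn
    linarith
  | succ n ih =>
    by_cases hlow : H.low κ (d + 1) ≤
        LinearMap.ker (φ.comp ((homFunctor H.total).map (H.can κ ν hκ)).hom)
    · exact ⟨κ, _, h0, hlow⟩
    · have : ∃ j, ∃ hd : dec κ.1 j ∈ osL L (d + 1), ∃ g : H.total ⟶ H.obj ⟨dec κ.1 j, hd⟩,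
          φ ((g ≫ H.can _ κ (dec_le _ _)) ≫ H.can κ ν hκ) ≠ 0 := by
        by_contra hc
        push Not at hc
        refine hlow (iSup_le ?_)
        rintro ⟨j, hj, hd⟩ _ ⟨g, rfl⟩
        exact hc j hd g
      obtain ⟨j, hd, g, hg⟩ := this
      refine ih ⟨dec κ.1 j, hd⟩ ((dec_le _ _).trans hκ) (fun hc => hg ?_) ?_
      · rw [Category.assoc, H.can_comp]
        exact congrArg (fun ψ => ψ g) hc
      · simp only [sum_dec]
        push_cast at hn
        linarith

lemma IsNakayama.cf_congr {lam ν : osL L (d + 1)} (g : H.obj lam ⟶ H.obj ν) {m m' : ℤ}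
    (h : shift p m lam.1 = shift p m' lam.1) : H.cf g m = H.cf g m' := by
  have : shift p m (upper lam.1) = shift p m' (upper lam.1) := congrArg upper h
  rw [IsNakayama.cf, IsNakayama.cf, this]

/-- Multiplication by a scalar on an interval module. -/
def IsNakayama.scale (lam : osL L (d + 1)) (c : k) : H.obj lam ⟶ H.obj lam :=
  ModuleCat.ofHom (transfer (H.adm lam.1 lam.2) (H.adm lam.1 lam.2) c 0 (zero_shift_le le_rfl)
    (zero_shift_le le_rfl))

lemma IsNakayama.cf_scale_comp {lam ν : osL L (d + 1)} (c : k) (g : H.obj lam ⟶ H.obj ν) (m : ℤ) :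
    H.cf (H.scale lam c ≫ g) m = c * H.cf g m := by
  have hl := lower_le_upper lam.2
  have h1 := transfer_basisVec (k := k) (h := H.adm lam.1 lam.2) (h' := H.adm lam.1 lam.2) hl c 0
    (zero_shift_le le_rfl) (zero_shift_le le_rfl) (by rwa [shift_zero])
  rw [shift_zero] at h1
  have h2 := (congrArg g.hom h1).trans (map_smul g.hom _ _)
  exact (congrArg (fun w => coeff (h := H.adm ν.1 ν.2) w (shift p m (upper lam.1))) h2).trans
    (coeff_algebraMap_smul c _ _)

lemma IsNakayama.cf_sub {lam ν : osL L (d + 1)}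
    (g g' : H.obj lam ⟶ H.obj ν) (m : ℤ) : H.cf (g - g') m = H.cf g m - H.cf g' m := by
  rw [eq_sub_iff_add_eq, ← cf_add, sub_add_cancel]

/-- The maps that lower an entry form a maximal submodule. -/
lemma IsNakayama.ker_le_low {ν : osL L (d + 1)}
    (ψ : (homFunctor H.total).obj (H.obj ν) →ₗ[H.Gam] S) (h0 : ψ ≠ 0)
    (hlow : H.low ν (d + 1) ≤ LinearMap.ker ψ) : LinearMap.ker ψ ≤ H.low ν (d + 1) := by
  intro (g : H.total ⟶ H.obj ν) (hg : ψ g = 0)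
  by_contra hc
  replace hc := mt (H.mem_low_iff ν (d + 1) g).2 hc
  push Not at hc
  obtain ⟨o, m, hm, hcf⟩ := hc
  have hm' : shift p m o.out.1 = ν.1 := funext fun j => hm j j.2
  refine h0 (LinearMap.ext fun (g' : H.total ⟶ H.obj ν) => ?_)
  -- This scalar removes from `g'` the coefficient at the translate equal to `ν`, the only one that
  -- the submodule does not see.
  let c := H.cf (H.inj o ≫ g') m / H.cf (H.inj o ≫ g) m
  let r : H.total ⟶ H.total := H.prj o ≫ H.scale o.out c ≫ H.inj o
  have hmem : g' - r ≫ g ∈ H.low ν (d + 1) := by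
    rw [H.mem_low_iff]
    intro o' m' hm1
    have hm1' : shift p m' o'.out.1 = ν.1 := funext fun j => hm1 j j.2
    have ho : o' = o := by
      rw [← Quotient.out_eq o, ← Quotient.out_eq o']
      refine Quotient.sound ⟨-m' + m, ?_⟩
      rw [← shift_shift, hm', ← hm1', shift_shift, neg_add_cancel, shift_zero]
    subst ho
    -- Different `m` can give the same translate, as always happens for `p = 0`.
    rw [H.cf_congr _ (hm1'.trans hm'.symm), Preadditive.comp_sub, cf_sub]
    have e : H.inj o' ≫ r ≫ g = H.scale o'.out c ≫ H.inj o' ≫ g := by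
      simp only [r, Category.assoc]
      rw [← Category.assoc (H.inj o'), H.inj_prj_self, Category.id_comp]
    rw [e, cf_scale_comp, div_mul_cancel₀ _ hcf, sub_self]
  have h1 : ψ (g' - r ≫ g) = 0 := hlow hmem
  have h2 : ψ (r ≫ g) = (MulOpposite.op (show End H.total from r) : H.Gam) • ψ g :=
    map_smul ψ (MulOpposite.op (show End H.total from r) : H.Gam) g
  have h3 : ψ (g' - r ≫ g) = ψ g' - ψ (r ≫ g) := map_sub ψ g' (r ≫ g)
  rw [h1, h2, hg, smul_zero, sub_zero] at h3
  exact h3.symm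

/-- A non-zero map from some `Hom(M, M_o)` to the simple module is moved down until it kills all
lowerings. Its kernel is then exactly the last step of the filtration. -/
lemma IsNakayama.hasProjectiveDimensionLT_simple [IsSimpleModule H.Gam S] :
    HasProjectiveDimensionLT (ModuleCat.of H.Gam S) (d + 2) := by
  have := IsSimpleModule.nontrivial H.Gam S
  obtain ⟨s, hs⟩ := exists_ne (0 : S)
  obtain ⟨o, ho⟩ := H.exists_evalMap_ne_zero hs
  have hcan : (H.evalMap o s).comp ((homFunctor H.total).map (H.can o.out o.out le_rfl)).hom ≠ 0 := by
    rw [H.can_self, CategoryTheory.Functor.map_id]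
    exact ho
  obtain ⟨n, hn⟩ : ∃ n : ℕ, ∑ i, o.out.1 i <
      ∑ i, lower o.out.1 i + L (lower o.out.1 0) + n := by
    obtain ⟨n, hn⟩ := exists_nat_gt (∑ i, o.out.1 i - (∑ i, lower o.out.1 i + L (lower o.out.1 0)))
    exact ⟨n, by linarith⟩
  obtain ⟨ν, ψ, h0, hlow⟩ := H.exists_low_le_ker (H.evalMap o s) n o.out le_rfl hcan hn
  have hker := le_antisymm (H.ker_le_low ψ h0 hlow) hlow
  have := H.hasProjectiveDimensionLT_low (d + 1) le_rfl ν
  exact hasProjectiveDimensionLT_of_iso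
    ((Submodule.quotEquivOfEq _ _ hker.symm).trans
      (ψ.quotKerEquivOfSurjective (LinearMap.surjective_of_ne_zero h0))).toModuleIso (d + 2)

lemma hasProjectiveDimensionLT_of_isFiniteLength {R : Type u} [Ring R] {n : ℕ}
    (hs : ∀ (S : Type u) [AddCommGroup S] [Module R S] [IsSimpleModule R S],
      HasProjectiveDimensionLT (ModuleCat.of R S) n)
    {N : Type u} [AddCommGroup N] [Module R N] (hN : IsFiniteLength R N) :
    HasProjectiveDimensionLT (ModuleCat.of R N) n := by
  induction hN with
  | @of_subsingleton M =>
    have := (ModuleCat.isZero_of_subsingleton (ModuleCat.of R M)).hasProjectiveDimensionLT_zero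
    exact hasProjectiveDimensionLT_of_ge _ 0 _ (Nat.zero_le _)
  | @of_simple_quotient M _ _ N _ _ ih =>
    have w : ModuleCat.ofHom N.subtype ≫ ModuleCat.ofHom N.mkQ = 0 := by
      rw [← ModuleCat.ofHom_comp]
      refine ModuleCat.hom_ext ?_
      ext x
      simp
    have hS : (ShortComplex.mk (ModuleCat.ofHom N.subtype) (ModuleCat.ofHom N.mkQ) w).ShortExact :=
      { exact := by
          rw [ShortComplex.moduleCat_exact_iff]
          intro x hx
          exact ⟨⟨x, (Submodule.Quotient.mk_eq_zero N).1 hx⟩, rfl⟩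
        mono_f := by
          rw [ModuleCat.mono_iff_injective]
          exact N.injective_subtype
        epi_g := by
          rw [ModuleCat.epi_iff_surjective]
          exact N.mkQ_surjective }
    exact hS.hasProjectiveDimensionLT_X₂ n ih (hs _)

end Simple

/-! ### The total module is cluster-tilting -/

section Main

variable {k : Type u} [Field k] {d p : ℕ} [NeZero d] {D : QuotientData d p} {L : ℤ → ℤ}

lemma finite_end {Λ M : Type u} [Ring Λ] [Algebra k Λ] [AddCommGroup M] [Module k M] [Module Λ M]
    [IsScalarTower k Λ M] [Module.Finite k M] : Module.Finite k (Module.End Λ M) :=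
  Module.Finite.of_injective (LinearMap.restrictScalarsₗ k Λ M M k)
    (LinearMap.restrictScalars_injective k)

lemma IsNakayama.finite_total_field (H : IsNakayama k D L) :
    Module.Finite k (∀ o : Orbits p L (d + 1), H.Mod o.out) := by
  have := H.finite_orbits (d + 1)
  exact Module.Finite.pi

lemma IsNakayama.isNoetherianRing_gam (H : IsNakayama k D L) :
    IsNoetherianRing H.Gam ∧ IsArtinianRing H.Gam := by
  have := H.finite_total_field
  let M := ∀ o : Orbits p L (d + 1), H.Mod o.out
  have hE : Module.Finite k (Module.End (QuotAlg k D) M) := finite_end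
  have hE' : Module.Finite k (Module.End (QuotAlg k D) M)ᵐᵒᵖ :=
    Module.Finite.equiv (MulOpposite.opLinearEquiv k)
  have h1 : IsNoetherianRing (Module.End (QuotAlg k D) M)ᵐᵒᵖ := IsNoetherianRing.of_finite k _
  have h2 : IsArtinianRing (Module.End (QuotAlg k D) M)ᵐᵒᵖ := IsArtinianRing.of_finite k _
  let e : (Module.End (QuotAlg k D) M)ᵐᵒᵖ ≃+* H.Gam :=
    (RingEquiv.op (ModuleCat.endRingEquiv H.total)).symm
  exact ⟨isNoetherianRing_of_ringEquiv _ e, e.surjective.isArtinianRing⟩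

lemma IsNakayama.ext_total_subsingleton (H : IsNakayama k D L) (i : ℕ) (h1 : 1 ≤ i) (hi : i < d) :
    Subsingleton (Abelian.Ext H.total H.total i) := by
  have := H.finite_orbits (d + 1)
  have := Fintype.ofFinite (Orbits p L (d + 1))
  refine ext_right_subsingleton_of_sum H.prj H.inj H.sum_prj_inj i fun o => ?_
  exact ext_left_subsingleton_of_sum H.prj H.inj H.sum_prj_inj i fun o' =>
    H.ext_subsingleton _ _ i h1 hi

theorem IsNakayama.isClusterTilting (H : IsNakayama k D L) : IsClusterTilting d H.total := by
  obtain ⟨hN, hA⟩ := H.isNoetherianRing_gam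
  have := H.finite_quotAlg
  have : IsNoetherianRing (QuotAlg k D) := IsNoetherianRing.of_finite k _
  have := H.finite_total
  refine isClusterTilting_of_projectiveDimension (NeZero.pos d) H.isSeparator_total
    H.cogenerates_total H.ext_total_subsingleton fun N hfin => ?_
  refine hasProjectiveDimensionLT_of_isFiniteLength (N := N)
    (fun S _ _ _ => H.hasProjectiveDimensionLT_simple) ?_
  exact isFiniteLength_iff_isNoetherian_isArtinian.2 ⟨inferInstance, inferInstance⟩

end Main

/-! ### Indecomposability -/

section Indecomposable

variable {k : Type u} [Field k] {d p : ℕ} {D : QuotientData d p} {lo hi : Vtx d}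
  {h : IsAdmissible D lo hi}

lemma coeff_hom_apply (g : Module.End (QuotAlg k D) (IntervalModule k h))
    (w : IntervalModule k h) (x : Vtx d) :
    coeff (g w) x =
      ∑ y ∈ Finset.Icc lo hi, coeff w y * coeff (ar k D y hi • g (basisVec h hi)) x := by
  conv_lhs => rw [eq_sum_basisVec w]
  rw [map_sum, coeff_sum]
  refine Finset.sum_congr rfl fun y hy => ?_
  rw [map_smul, coeff_algebraMap_smul, ← ar_smul_basisVec (Finset.mem_Icc.1 hy), map_smul]

lemma le_of_coeff_ar_smul_ne_zero {y x : Vtx d} (hy : y ≤ hi) {w : IntervalModule k h}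
    (h0 : coeff (ar k D y hi • w) x ≠ 0) : coeff w (x + (hi - y)) ≠ 0 := by
  classical
  rw [coeff_ar_smul hy] at h0
  intro hc
  rw [hc] at h0
  simp at h0

/-- The coefficient at the top of an interval is multiplicative on endomorphisms. -/
lemma coeff_mul_top (hlh : lo ≤ hi) (g g' : Module.End (QuotAlg k D) (IntervalModule k h)) :
    coeff ((g * g') (basisVec h hi)) hi =
      coeff (g (basisVec h hi)) hi * coeff (g' (basisVec h hi)) hi := by
  classical
  rw [Module.End.mul_apply, coeff_hom_apply, Finset.sum_eq_single hi]
  · rw [coeff_ar_smul le_rfl, if_pos ⟨.refl _, hlh, le_rfl⟩, sub_self, add_zero, mul_comm]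
  · intro y hy hne
    have hy' := Finset.mem_Icc.1 hy
    by_cases h0 : coeff (ar k D y hi • g (basisVec h hi)) hi = 0
    · rw [h0, mul_zero]
    -- For `y` strictly below `hi` the coefficient would sit strictly above the top of the interval.
    · have h1 := (mem_of_coeff_ne_zero (le_of_coeff_ar_smul_ne_zero hy'.2 h0)).2
      refine absurd (le_antisymm hy'.2 fun i => ?_) hne
      have := h1 i
      simp only [Pi.add_apply, Pi.sub_apply] at this
      linarith
  · intro hc
    exact absurd (Finset.mem_Icc.2 ⟨hlh, le_rfl⟩) hc

/-- Let `w` be the image of the top vector and `z` maximal in its support. As `e w = w`, the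
coefficient at `z` needs a support element `z + (hi - y)`; maximality forces `y = hi`, but `w` has
coefficient zero there. -/
lemma eq_zero_of_coeff_top {e : Module.End (QuotAlg k D) (IntervalModule k h)}
    (he : e * e = e) (h0 : coeff (e (basisVec h hi)) hi = 0) : e = 0 := by
  classical
  refine interval_hom_ext ?_
  rw [LinearMap.zero_apply]
  by_contra hne
  let w := e (basisVec h hi)
  have hew : e w = w := congrArg (fun f : Module.End _ _ => f (basisVec h hi)) he
  let T := (Finset.Icc lo hi).filter fun z => coeff w z ≠ 0
  have hT : ∀ z, coeff w z ≠ 0 → z ∈ T := fun z hz =>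
    Finset.mem_filter.2 ⟨Finset.mem_Icc.2 (mem_of_coeff_ne_zero hz), hz⟩
  have hTne : T.Nonempty := by
    by_contra hc
    rw [Finset.not_nonempty_iff_eq_empty] at hc
    refine hne (interval_ext fun x _ _ => ?_)
    rw [coeff_zero]
    by_contra hx
    have := hT x hx
    rw [hc] at this
    simp at this
  obtain ⟨z, hz⟩ := T.exists_maximal hTne
  have hz0 : coeff w z ≠ 0 := (Finset.mem_filter.1 hz.1).2
  have h1 := hz0
  rw [← hew, coeff_hom_apply] at h1
  obtain ⟨y, hy, hy0⟩ := Finset.exists_ne_zero_of_sum_ne_zero h1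
  have hy' := Finset.mem_Icc.1 hy
  have h2 := hT _ (le_of_coeff_ar_smul_ne_zero hy'.2 (right_ne_zero_of_mul hy0))
  have h3 := hz.2 h2 (le_add_of_nonneg_right (sub_nonneg.2 hy'.2))
  have h4 : y = hi := by
    refine le_antisymm hy'.2 fun i => ?_
    have := h3 i
    simp only [Pi.add_apply, Pi.sub_apply] at this
    linarith
  subst h4
  exact left_ne_zero_of_mul hy0 h0

/-- The top coefficient of `e` is an idempotent of the field `k`, so it vanishes for `e` or for `1 -
e`. -/
lemma eq_zero_or_eq_one (hlh : lo ≤ hi) {e : Module.End (QuotAlg k D) (IntervalModule k h)}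
    (he : e * e = e) : e = 0 ∨ e = 1 := by
  classical
  have h1 := coeff_mul_top hlh e e
  rw [he] at h1
  have h2 : coeff ((1 - e) (basisVec h hi)) hi = 1 - coeff (e (basisVec h hi)) hi := by
    rw [eq_sub_iff_add_eq, ← coeff_add, ← LinearMap.add_apply, sub_add_cancel,
      Module.End.one_apply, coeff_basisVec ⟨hlh, le_rfl⟩, if_pos rfl]
  by_cases hc : coeff (e (basisVec h hi)) hi = 0
  · exact Or.inl (eq_zero_of_coeff_top he hc)
  · right
    have h3 : coeff (e (basisVec h hi)) hi = 1 := by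
      have : coeff (e (basisVec h hi)) hi * (coeff (e (basisVec h hi)) hi - 1) = 0 := by
        rw [mul_sub, ← h1, mul_one, sub_self]
      exact sub_eq_zero.1 ((mul_eq_zero.1 this).resolve_left hc)
    have h4 : (1 - e) * (1 - e) = 1 - e := by
      rw [mul_sub, mul_one, sub_mul, one_mul, he, sub_self, sub_zero]
    exact (sub_eq_zero.1 (eq_zero_of_coeff_top h4 (by rw [h2, h3, sub_self]))).symm

lemma interval_comp_eq_zero_or_id (hlh : lo ≤ hi)
    {e : ModuleCat.of (QuotAlg k D) (IntervalModule k h) ⟶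
      ModuleCat.of (QuotAlg k D) (IntervalModule k h)} (he : e ≫ e = e) : e = 0 ∨ e = 𝟙 _ := by
  rcases eq_zero_or_eq_one hlh (e := e.hom) (congrArg ModuleCat.Hom.hom he) with h1 | h1
  · exact Or.inl (ModuleCat.hom_ext h1)
  · exact Or.inr (ModuleCat.hom_ext h1)

lemma indecomposable_interval (hlh : lo ≤ hi) :
    Indecomposable (ModuleCat.of (QuotAlg k D) (IntervalModule k h)) := by
  classical
  refine ⟨fun hz => ?_, fun Y Z φ => ?_⟩
  · have h1 := congrArg (fun f => f.hom (basisVec h hi)) (hz.eq_of_src (𝟙 _) 0)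
    have h2 := congrArg (fun w : IntervalModule k h => coeff w hi) h1
    change coeff (basisVec h hi) hi = coeff (0 : IntervalModule k h) hi at h2
    rw [coeff_basisVec ⟨hlh, le_rfl⟩, if_pos rfl, coeff_zero] at h2
    exact one_ne_zero h2
  · rcases interval_comp_eq_zero_or_id hlh
      (e := φ.hom ≫ Limits.biprod.fst ≫ Limits.biprod.inl ≫ φ.inv) (by simp) with h1 | h1
    · left
      rw [Limits.IsZero.iff_id_eq_zero]
      have := congrArg (fun f => (Limits.biprod.inl ≫ φ.inv) ≫ f ≫ φ.hom ≫ Limits.biprod.fst) h1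
      simpa using this
    · right
      rw [Limits.IsZero.iff_id_eq_zero]
      have := congrArg (fun f => (Limits.biprod.inr ≫ φ.inv) ≫ f ≫ φ.hom ≫ Limits.biprod.snd) h1
      simpa using this.symm

end Indecomposable

/-! ### Summands of finite direct sums -/

section KrullSchmidt

variable {Λ : Type u} [Ring Λ]

/-- The Fitting lemma: an endomorphism of an indecomposable module is nilpotent or invertible. -/
lemma isNilpotent_or_isUnit_of_indecomposable {X : ModuleCat.{u} Λ} (hX : Indecomposable X)
    [IsNoetherian Λ X] [IsArtinian Λ X] (f : Module.End Λ X) : IsNilpotent f ∨ IsUnit f := by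
  obtain ⟨n, hn, hc⟩ := ((Filter.eventually_ge_atTop 1).and
    f.eventually_isCompl_ker_pow_range_pow).exists
  have e : X ≅ ModuleCat.of Λ (LinearMap.ker (f ^ n)) ⊞ ModuleCat.of Λ (LinearMap.range (f ^ n)) :=
    (Submodule.prodEquivOfIsCompl _ _ hc).symm.toModuleIso ≪≫
      (ModuleCat.biprodIsoProd (ModuleCat.of Λ (LinearMap.ker (f ^ n)))
        (ModuleCat.of Λ (LinearMap.range (f ^ n)))).symm
  rcases hX.2 _ _ e with h | h
  · right
    have h1 : LinearMap.ker (f ^ n) = ⊥ :=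
      Submodule.subsingleton_iff_eq_bot.1 (ModuleCat.subsingleton_of_isZero h)
    have h2 : LinearMap.range (f ^ n) = ⊤ := by
      have := hc.sup_eq_top
      rwa [h1, bot_sup_eq] at this
    have h3 : IsUnit (f ^ n) := (Module.End.isUnit_iff _).2
      ⟨LinearMap.ker_eq_bot.1 h1, LinearMap.range_eq_top.1 h2⟩
    exact (isUnit_pow_iff (by omega)).1 h3
  · left
    exact ⟨n, LinearMap.range_eq_bot.1
      (Submodule.subsingleton_iff_eq_bot.1 (ModuleCat.subsingleton_of_isZero h))⟩

/-- Such a ring is local: after normalizing the sum to `1`, a summand that is not a unit is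
nilpotent, and the remainder is one minus a nilpotent. -/
lemma exists_isUnit_of_isUnit_sum {R : Type*} [Ring R] [Nontrivial R]
    (hR : ∀ f : R, IsNilpotent f ∨ IsUnit f) {ι : Type*} (s : Finset ι) (a : ι → R)
    (h : IsUnit (∑ i ∈ s, a i)) : ∃ i ∈ s, IsUnit (a i) := by
  classical
  induction s using Finset.induction_on with
  | empty => simp at h
  | insert j s hj ih =>
    rw [Finset.sum_insert hj] at h
    obtain ⟨v, hv⟩ := h
    have h1 : ↑v⁻¹ * a j + ↑v⁻¹ * ∑ i ∈ s, a i = 1 := by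
      rw [← mul_add, ← hv, Units.inv_mul]
    rcases hR (↑v⁻¹ * a j) with h2 | h2
    · have h3 : IsUnit (↑v⁻¹ * ∑ i ∈ s, a i) := by
        rw [← eq_sub_iff_add_eq'] at h1
        rw [h1]
        exact h2.isUnit_one_sub
      obtain ⟨i, hi, hu⟩ := ih ((Units.isUnit_units_mul _ _).1 h3)
      exact ⟨i, Finset.mem_insert_of_mem hi, hu⟩
    · exact ⟨j, Finset.mem_insert_self _ _, (Units.isUnit_units_mul _ _).1 h2⟩

/-- Some `p i ≫ q i` is invertible, so `X` is a retract of `N i`. The corresponding idempotent of `N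
i` cannot be zero, hence is the identity. -/
lemma exists_iso_of_indecomposable {X : ModuleCat.{u} Λ} (hX : Indecomposable X)
    [IsNoetherian Λ X] [IsArtinian Λ X] {ι : Type*} [Fintype ι] {N : ι → ModuleCat.{u} Λ}
    (hN : ∀ i (e : N i ⟶ N i), e ≫ e = e → e = 0 ∨ e = 𝟙 _) (p : ∀ i, X ⟶ N i)
    (q : ∀ i, N i ⟶ X) (h : ∑ i, p i ≫ q i = 𝟙 X) : ∃ i, Nonempty (X ≅ N i) := by
  have hnt : Nontrivial X := by
    by_contra hc
    rw [not_nontrivial_iff_subsingleton] at hc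
    exact hX.1 (ModuleCat.isZero_of_subsingleton X)
  obtain ⟨i, -, hi⟩ := exists_isUnit_of_isUnit_sum
    (isNilpotent_or_isUnit_of_indecomposable hX) Finset.univ (fun i => (p i ≫ q i).hom) (by
      rw [← ModuleCat.hom_sum, h]
      exact isUnit_one)
  have hiso : IsIso (p i ≫ q i) := by
    rw [ConcreteCategory.isIso_iff_bijective]
    exact (Module.End.isUnit_iff _).1 hi
  let t := q i ≫ inv (p i ≫ q i)
  have ht : p i ≫ t = 𝟙 X := by
    simp only [t]
    rw [← Category.assoc, IsIso.hom_inv_id]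
  refine ⟨i, ?_⟩
  rcases hN i (t ≫ p i) (by rw [Category.assoc, ← Category.assoc (p i), ht, Category.id_comp])
    with h0 | h1
  · refine absurd ?_ hX.1
    have h2 : (p i ≫ t) ≫ p i ≫ t = 0 := by
      rw [Category.assoc, ← Category.assoc t, h0, Limits.zero_comp, Limits.comp_zero]
    rwa [ht, Category.comp_id, ← Limits.IsZero.iff_id_eq_zero] at h2
  · exact ⟨⟨p i, t, ht, h1⟩⟩

end KrullSchmidt

section Summands

variable {k : Type u} [Field k] {d p : ℕ} [NeZero d] {D : QuotientData d p} {L : ℤ → ℤ}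

lemma IsSummand.of_iso {Λ : Type u} [Ring Λ] {X Y M : ModuleCat.{u} Λ} (e : X ≅ Y)
    (h : IsSummand Y M) : IsSummand X M := by
  obtain ⟨R⟩ := h
  exact ⟨⟨e.hom ≫ R.i, R.r ≫ e.inv, by simp⟩⟩

lemma IsSummand.finite {Λ : Type u} [Ring Λ] {X M : ModuleCat.{u} Λ} [Module.Finite Λ M]
    (h : IsSummand X M) : Module.Finite Λ X := by
  obtain ⟨R⟩ := h
  refine Module.Finite.of_surjective R.r.hom fun x => ⟨R.i.hom x, ?_⟩
  exact congrArg (fun f => f.hom x) R.retract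

lemma exists_iso_of_isSummand {Λ : Type u} [Ring Λ] [IsNoetherianRing Λ] [IsArtinianRing Λ]
    {X M : ModuleCat.{u} Λ} [Module.Finite Λ M] (hX : Indecomposable X) (hXM : IsSummand X M)
    {ι : Type*} [Fintype ι] {N : ι → ModuleCat.{u} Λ}
    (hN : ∀ i (e : N i ⟶ N i), e ≫ e = e → e = 0 ∨ e = 𝟙 _) (p : ∀ i, M ⟶ N i)
    (q : ∀ i, N i ⟶ M) (h : ∑ i, p i ≫ q i = 𝟙 M) : ∃ i, Nonempty (X ≅ N i) := by
  have := hXM.finite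
  obtain ⟨R⟩ := hXM
  refine exists_iso_of_indecomposable hX hN (fun i => R.i ≫ p i) (fun i => q i ≫ R.r) ?_
  have h1 : ∀ i, (R.i ≫ p i) ≫ q i ≫ R.r = R.i ≫ (p i ≫ q i) ≫ R.r := by
    intro i; simp only [Category.assoc]
  simp only [h1]
  rw [← Preadditive.comp_sum, ← Preadditive.sum_comp, h, Category.id_comp, R.retract]

theorem IsNakayama.summandsAre (H : IsNakayama k D L) : SummandsAre H.total H.obj := by
  refine ⟨fun lam => indecomposable_interval (lower_le_upper lam.2), fun X hX => ⟨fun hs => ?_, ?_⟩⟩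
  · have := H.finite_orbits (d + 1)
    have := Fintype.ofFinite (Orbits p L (d + 1))
    have := H.finite_quotAlg
    have : IsNoetherianRing (QuotAlg k D) := IsNoetherianRing.of_finite k _
    have : IsArtinianRing (QuotAlg k D) := IsArtinianRing.of_finite k _
    have := H.finite_total
    obtain ⟨o, ho⟩ := exists_iso_of_isSummand hX hs
      (fun o e he => interval_comp_eq_zero_or_id (lower_le_upper (Quotient.out o).2) he)
      H.prj H.inj H.sum_prj_inj
    exact ⟨_, ho⟩
  · rintro ⟨lam, ⟨e⟩⟩
    exact (H.isSummand_obj lam).of_iso e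

end Summands

/-! ### The higher Nakayama algebras -/

section Special

variable {k : Type u} [Field k] {d p n : ℕ} [NeZero d] [NeZero n] {D : QuotientData d p}
  {L : ℤ → ℤ}

/-- An arrow with a jump in the lower bound along it is killed. -/
lemma ar_eq_zero_of_jump (hd : d = 1) (mono : Monotone L)
    (hrel : d = 1 → ∀ i u v : ℤ, L u ≤ u → L v ≤ v → u < i → i ≤ v → L (i - 1) < L i →
      L i ≤ i ∧ ((fun _ => L i - 1, fun _ => i) : Vtx d × Vtx d) ∈ D.rels)
    {u v : Vtx d} (hu : L (u 0) ≤ u 0) (hv : L (v 0) ≤ v 0)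
    (h : u 0 < L (v 0)) : ar k D u v = 0 := by
  -- At the first index where `L` jumps over `u 0`, the killed path from `L i - 1` to `i` lies
  -- between `u` and `v`.
  obtain ⟨i, hi, hmin⟩ := Int.exists_least_of_bdd (P := fun i => u 0 < L i)
    ⟨u 0, fun i (hi : u 0 < L i) => by
      by_contra hc
      have := mono (le_of_lt (not_le.1 hc))
      omega⟩ ⟨v 0, h⟩
  have h1 : i ≤ v 0 := hmin _ h
  have h2 : u 0 < i := by
    by_contra hc
    have := mono (not_lt.1 hc)
    omega
  have h3 : L (i - 1) ≤ u 0 := by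
    by_contra hc
    have := hmin _ (not_le.1 hc)
    omega
  obtain ⟨h4, h5⟩ := hrel hd i (u 0) (v 0) hu hv h2 h1 (by omega)
  have h0 : ∀ j : Fin d, j = 0 := by
    intro j; ext; have := j.2; simp; omega
  let a : Vtx d := fun _ => L i - 1
  let b : Vtx d := fun _ => i
  have hua : u ≤ a := fun j => by rw [h0 j]; simp only [a]; omega
  have hab : a ≤ b := fun j => by simp only [a, b]; omega
  have hbv : b ≤ v := fun j => by rw [h0 j]; simp only [b]; omega
  rw [← ar_mul_ar hua (hab.trans hbv), ← ar_mul_ar hab hbv, ar_eq_zero_of_rels h5, zero_mul,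
    mul_zero]

/-- Interlacing is the axiom to derive: for a pair that is not interlaced, some vertex between `u`
and `v` is not kept, or for `d = 1` a killed path lies between them. -/
lemma IsNakayama.of_rels (mono : Monotone L) (period : ∀ m j : ℤ, L (j + m * p) = L j + m * p)
    (bdd : ∃ B : ℤ, ∀ j, j - B ≤ L j)
    (fin : ∃ F : Finset ℤ, ∀ j, L j ≤ j → ∃ m : ℤ, j + m * p ∈ F) (verts : D.verts = osL L d)
    (adm : ∀ lam ∈ osL L (d + 1), IsAdmissible D (lower lam) (upper lam))
    (hrel : d = 1 → ∀ i u v : ℤ, L u ≤ u → L v ≤ v → u < i → i ≤ v → L (i - 1) < L i →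
      L i ≤ i ∧ ((fun _ => L i - 1, fun _ => i) : Vtx d × Vtx d) ∈ D.rels) :
    IsNakayama k D L where
  mono := mono
  period := period
  bdd := bdd
  fin := fin
  verts := verts
  adm := adm
  interlaced := by
    intro u v hu hv huv h0
    rw [verts] at hu hv
    constructor
    · intro i j hij
      by_contra hc
      -- This vertex increases from `i` to `j`, so it is not kept.
      let z : Vtx d := fun t => if t ≤ i then u t else v t
      refine h0 (ar_eq_zero_of_between (z := z) (fun t => ?_) (fun t => ?_) ?_)
      · simp only [z]; split_ifs
        exacts [le_rfl, huv t]
      · simp only [z]; split_ifs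
        exacts [huv t, le_rfl]
      · rw [verts]
        intro hz
        have h1 := hz.1 (show i ≤ j by rw [Fin.le_def]; omega)
        have h2 : ¬ j ≤ i := by rw [Fin.le_def]; omega
        simp only [z, le_rfl, if_true, if_neg h2] at h1
        exact hc h1
    · by_contra hc
      rw [not_le] at hc
      by_cases hd : d = 1
      · have e : lastIdx d = 0 := by
          have := val_lastIdx d
          ext; simp only [Fin.val_zero]; omega
        have h1 := hu.2
        have h2 := hv.2
        rw [e] at h1 h2 hc
        exact h0 (ar_eq_zero_of_jump hd mono hrel h1 h2 hc)
      -- Combining the first entry of `v` with the last entry of `u` violates the bound; this needs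
      -- two distinct coordinates.
      · let z : Vtx d := fun t => if t = 0 then v t else u t
        refine h0 (ar_eq_zero_of_between (z := z) (fun t => ?_) (fun t => ?_) ?_)
        · simp only [z]; split_ifs
          exacts [huv t, le_rfl]
        · simp only [z]; split_ifs
          exacts [le_rfl, huv t]
        · rw [verts]
          intro hz
          have h1 := hz.2
          have h2 : lastIdx d ≠ 0 := by
            intro h'
            have h3 := val_lastIdx d
            have := NeZero.pos d
            rw [h'] at h3
            simp at h3
            omega
          simp only [z, if_true, if_neg h2] at h1
          exact absurd h1 (not_le.2 hc)

lemma SummandsAre.reindex {Λ : Type u} [Ring Λ] {ι ι' : Type} {M : ModuleCat.{u} Λ}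
    {N : ι → ModuleCat.{u} Λ} {N' : ι' → ModuleCat.{u} Λ} (h : SummandsAre M N) (e : ι' ≃ ι)
    (hN : ∀ j, N' j = N (e j)) : SummandsAre M N' := by
  refine ⟨fun j => hN j ▸ h.1 _, fun X hX => (h.2 X hX).trans ?_⟩
  refine ⟨fun ⟨j, hj⟩ => ⟨e.symm j, ?_⟩, fun ⟨j, hj⟩ => ⟨e j, hN j ▸ hj⟩⟩
  rw [hN, e.apply_symm_apply]
  exact hj

/-- The index of the last composition factor of a projective module of type `𝔸̃`. -/
def KupischTilde.socle (ℓ : KupischTilde n) (j : ℤ) : ℤ := j - ℓ.len (j : ZMod n) + 1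

lemma KupischTilde.os_eq (ℓ : KupischTilde n) (e : ℕ) [NeZero e] : ℓ.os e = osL ℓ.socle e := by
  ext μ
  refine and_congr Iff.rfl ?_
  simp only [KupischTilde.socle]
  constructor <;> intro h <;> omega

lemma KupischTilde.socle_le (ℓ : KupischTilde n) (j : ℤ) : ℓ.socle j ≤ j := by
  have := ℓ.pos (j : ZMod n)
  simp only [KupischTilde.socle]
  omega

lemma KupischTilde.isNakayama (ℓ : KupischTilde n) : IsNakayama k (ℓ.data d) ℓ.socle := by
  refine .of_rels (fun i j hij => ?_) (fun m j => ?_) ⟨(∑ i, ℓ.len i : ℕ), fun j => ?_⟩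
    ⟨Finset.Ico 0 (n : ℤ), fun j _ => ⟨-(j / n), ?_⟩⟩ (ℓ.os_eq d)
    (fun lam hlam => ℓ.isAdmissible (by rwa [ℓ.os_eq])) (fun hd i u v _ _ _ _ hi =>
      ⟨ℓ.socle_le i, hd, i, ?_, ?_⟩)
  · have := ℓ.mono hij
    simp only [KupischTilde.socle]
    omega
  · simp only [KupischTilde.socle]
    have : ((j + m * n : ℤ) : ZMod n) = (j : ZMod n) := by simp
    rw [this]
    ring
  · have hB : ℓ.len (j : ZMod n) ≤ ∑ i, ℓ.len i :=
      Finset.single_le_sum (f := ℓ.len) (fun _ _ => Nat.zero_le _) (Finset.mem_univ _)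
    simp only [KupischTilde.socle]
    omega
  · have hn : (0 : ℤ) < n := by exact_mod_cast NeZero.pos n
    have e : j + -(j / n) * n = j % n := by
      rw [Int.emod_def]; ring
    rw [e, Finset.mem_Ico]
    exact ⟨Int.emod_nonneg _ hn.ne', Int.emod_lt_of_pos _ hn⟩
  -- A jump of `L` at `i` means exactly `ℓ_i ≤ ℓ_{i-1}`.
  · simp only [KupischTilde.socle] at hi
    omega
  · simp only [KupischTilde.socle, add_sub_cancel_right]

/-- The index of the last composition factor of a projective module of type `𝔸`, extended to all
integers so that there are no sequences with first entry out of range. -/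
def KupischA.socle (ℓ : KupischA n) (j : ℤ) : ℤ :=
  if h : 0 ≤ j ∧ j < n then j - ℓ.len ⟨j.toNat, by omega⟩ + 1 else j + 1

lemma KupischA.socle_of_mem (ℓ : KupischA n) {j : ℤ} (h : 0 ≤ j ∧ j < n) :
    ℓ.socle j = j - ℓ.len ⟨j.toNat, by omega⟩ + 1 := dif_pos h

lemma KupischA.socle_of_notMem (ℓ : KupischA n) {j : ℤ} (h : ¬ (0 ≤ j ∧ j < n)) :
    ℓ.socle j = j + 1 := dif_neg h

/-- The function `i - ℓ_i` is monotone and starts at `-1`, because `ℓ_0 = 1`. -/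
lemma KupischA.socle_nonneg (ℓ : KupischA n) {j : ℤ} (h : 0 ≤ j) : 0 ≤ ℓ.socle j := by
  by_cases hj : j < n
  · rw [ℓ.socle_of_mem ⟨h, hj⟩]
    have h1 := ℓ.mono (i := 0) (j := ⟨j.toNat, by omega⟩) (Fin.zero_le _)
    rw [ℓ.first] at h1
    simp only [Fin.val_zero, Nat.cast_zero, Nat.cast_one, Int.toNat_of_nonneg h] at h1
    omega
  · rw [ℓ.socle_of_notMem fun h => hj h.2]
    omega

/-- The value `j + 1` outside the range excludes such first entries, so the single condition of
`osL` also encodes `0 ≤ j < n`. -/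
lemma KupischA.socle_le_iff (ℓ : KupischA n) {j : ℤ} : ℓ.socle j ≤ j ↔ 0 ≤ j ∧ j < n := by
  by_cases h : 0 ≤ j ∧ j < n
  · have := ℓ.pos ⟨j.toNat, by omega⟩
    rw [ℓ.socle_of_mem h]
    simp only [h, and_self, iff_true]
    omega
  · rw [ℓ.socle_of_notMem h]
    simp only [h, iff_false]
    omega

lemma KupischA.socle_mono (ℓ : KupischA n) : Monotone ℓ.socle := by
  intro i j hij
  by_cases hi : 0 ≤ i ∧ i < n
  · by_cases hj : 0 ≤ j ∧ j < n
    · have h1 := ℓ.mono (i := ⟨i.toNat, by omega⟩) (j := ⟨j.toNat, by omega⟩)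
        (by rw [Fin.le_def]; simp only; omega)
      rw [ℓ.socle_of_mem hi, ℓ.socle_of_mem hj]
      simp only [Int.toNat_of_nonneg hi.1, Int.toNat_of_nonneg hj.1] at h1
      omega
    · have := ℓ.socle_le_iff.2 hi
      rw [ℓ.socle_of_notMem hj]
      omega
  · rw [ℓ.socle_of_notMem hi]
    by_cases hj : 0 ≤ j ∧ j < n
    -- Here `i` is negative, so its value `i + 1` is at most zero.
    · have := ℓ.socle_nonneg hj.1
      omega
    · rw [ℓ.socle_of_notMem hj]
      omega

lemma KupischA.os_eq (ℓ : KupischA n) (e : ℕ) [NeZero e] : ℓ.os e = osL ℓ.socle e := by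
  ext μ
  constructor
  · rintro ⟨⟨h1, h2, h3⟩, i, hi, hlen⟩
    refine ⟨h1, ?_⟩
    have h4 : 0 ≤ μ 0 ∧ μ 0 < n := by omega
    rw [ℓ.socle_of_mem h4]
    have : (⟨(μ 0).toNat, by omega⟩ : Fin n) = i := by ext; simp only; omega
    rw [this]
    omega
  · rintro ⟨h1, h2⟩
    have h3 := last_le_of_os (e := e) h1 0
    have h4 := ℓ.socle_le_iff.1 (h2.trans h3)
    have h5 := ℓ.socle_nonneg h4.1
    refine ⟨⟨h1, by omega, by omega⟩, ⟨(μ 0).toNat, by omega⟩, ?_, ?_⟩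
    · simp only; omega
    · rw [ℓ.socle_of_mem h4] at h2
      omega

lemma KupischA.isNakayama (ℓ : KupischA n) : IsNakayama k (ℓ.data d) ℓ.socle := by
  refine .of_rels ℓ.socle_mono (fun m j => by simp) ⟨n, fun j => ?_⟩
    ⟨Finset.Ico 0 (n : ℤ), fun j hj => ⟨0, ?_⟩⟩ (ℓ.os_eq d)
    (fun lam hlam => ℓ.isAdmissible (by rwa [ℓ.os_eq])) (fun hd i u v hu hv hui hiv hi => ?_)
  · by_cases h : 0 ≤ j ∧ j < n
    · have := ℓ.socle_nonneg h.1
      omega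
    · rw [ℓ.socle_of_notMem h]
      omega
  · simpa using ℓ.socle_le_iff.1 hj
  -- The vertices `u` and `v` are in range and enclose `i - 1` and `i`, so both entries of the
  -- Kupisch series exist.
  · rw [ℓ.socle_le_iff] at hu hv
    have h1 : 0 ≤ i ∧ i < n := by omega
    have h2 : 0 ≤ i - 1 ∧ i - 1 < n := by omega
    rw [ℓ.socle_of_mem h1, ℓ.socle_of_mem h2] at hi
    refine ⟨ℓ.socle_le_iff.2 h1, hd, ⟨(i - 1).toNat, by omega⟩, ⟨i.toNat, by omega⟩, ?_, ?_, ?_⟩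
    · simp only; omega
    · omega
    · rw [ℓ.socle_of_mem h1]
      simp only [Int.toNat_of_nonneg h1.1, add_sub_cancel_right]

end Special

end HigherNakayama

end

/-! ### The theorem for both types -/

open CategoryTheory HigherNakayama in
theorem mainTheorem3 {k : Type*} [Field k] (d n : ℕ) [NeZero d] [NeZero n] :
    (∀ ℓ : KupischA n,
      IsWeaklyRepFinite k (NakayamaA k ℓ d) d ∧
        ∃ M : ModuleCat (NakayamaA k ℓ d),
          IsClusterTilting d M ∧ SummandsAre M (intervalA k ℓ d)) ∧
    (∀ ℓ : KupischTilde n,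
      IsWeaklyRepFinite k (NakayamaTilde k ℓ d) d ∧
        ∃ M : ModuleCat (NakayamaTilde k ℓ d),
          IsClusterTilting d M ∧ SummandsAre M (intervalTilde k ℓ d)) := by
  refine ⟨fun ℓ => ?_, fun ℓ => ?_⟩
  · have H : IsNakayama k (ℓ.data d) ℓ.socle := ℓ.isNakayama
    exact ⟨⟨H.finite_quotAlg, _, H.isClusterTilting⟩, _, H.isClusterTilting,
      H.summandsAre.reindex (Equiv.setCongr (ℓ.os_eq (d + 1))) fun _ => rfl⟩
  · have H : IsNakayama k (ℓ.data d) ℓ.socle := ℓ.isNakayama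
    exact ⟨⟨H.finite_quotAlg, _, H.isClusterTilting⟩, _, H.isClusterTilting,
      H.summandsAre.reindex (Equiv.setCongr (ℓ.os_eq (d + 1))) fun _ => rfl⟩
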